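/- Let $\mu^\star\in\mathbb R^d$ and $\Sigma^\star\in\mathbb R^{d\times d}$ with $\Sigma^\star\succ 0$, and let $(x_1,y_1^\star),\dots,(x_n,y_n^\star)\in\mathbb R^d\times\{\pm1\}$ be i.i.d. with $\mathbb P(y_i^\star=1)=\mathbb P(y_i^\star=-1)=1/2$ and $x_i\mid y_i^\star\sim N(y_i^\star\mu^\star,\Sigma^\star)$. Put $\mathrm{SNR}=\mu^{\star\top}(\Sigma^\star)^{-1}\mu^\star$ and $\sigma=1/\sqrt{\mathrm{SNR}+1}$. For $y,y'\in\{\pm1\}^n$ let $$\mathcal R(y,y')=n^{-1}\min_{s=\pm1}|\{i\in[n]: s y_i\ne y'_i\}|.$$ The spectral algorithm takes the data matrix $X=(x_1,\dots,x_n)^\top\in\mathbb R^{n\times d}$, forms $W=\sqrt n\,X(X^\top X)^{-1/2}$ with rows $w_1^\top,\dots,w_n^\top$ (if $X^\top X$ is singular, the pseudoinverse is used in place of the inverse) and $$S=\frac1n\sum_{i=1}^n(\|w_i\|_2^2-d)\,w_iw_i^\top,$$ picks any unit eigenvector $v$ of $S$ associated with its smallest eigenvalue, and outputs $\widehat y^{\mathrm{spec}}=\mathrm{sgn}(Wv)$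 entrywise, where $\mathrm{sgn}(t)=1$ for $t\ge0$ and $\mathrm{sgn}(t)=-1$ for $t<0$. Theorem (Spectral initialization). For all constants $\delta\in(0,1)$, $c>0$ and $C_1>0$ there is a constant $C_2>0$, depending only on $\delta$, $c$ and $C_1$, such that for all $n$, $d$, $\mu^\star$ and $\Sigma^\star\succ0$ with $\sigma<1-\delta$ and $n>c\,d^2\log^3 n$, $$\mathbb P\left[\mathcal R(\widehat y^{\mathrm{spec}},y^\star)\le C_2\left(\sigma^2+\frac{d^2\log^3 n}{n}\right)\right]\ge 1-n^{-C_1},$$ whichever bottom eigenvectors $v$ are chosen. -/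

import Mathlib

open MeasureTheory ProbabilityTheory

noncomputable section

/-- `sgn t = 1` if `t ≥ 0` and `sgn t = -1` otherwise; labels live in `ℤˣ = {1, -1}`. -/
def sgn (t : ℝ) : ℤˣ := if 0 ≤ t then 1 else -1

/-- The signal-to-noise ratio `μᵀ Σ⁻¹ μ`. -/
def snr {d : ℕ} (m : EuclideanSpace ℝ (Fin d)) (Sig : Matrix (Fin d) (Fin d) ℝ) : ℝ :=
  m.ofLp ⬝ᵥ (Sig⁻¹).mulVec m.ofLp

/-- The noise level `σ = 1 / √(SNR + 1)`. -/
def noiseLevel {d : ℕ} (m : EuclideanSpace ℝ (Fin d)) (Sig : Matrix (Fin d) (Fin d) ℝ) : ℝ :=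
  1 / √(snr m Sig + 1)

/-- The pairs `(x i, y i)` are i.i.d. samples of the symmetric two-component Gaussian mixture:
`y i` is a uniform sign and, given `y i = s`, the vector `x i` has law `N(s • m, Sig)`. -/
structure IsMixtureSample {Ω : Type*} [MeasurableSpace Ω] (P : Measure Ω) {n d : ℕ}
    (m : EuclideanSpace ℝ (Fin d)) (Sig : Matrix (Fin d) (Fin d) ℝ)
    (x : Fin n → Ω → EuclideanSpace ℝ (Fin d)) (y : Fin n → Ω → ℤˣ) : Prop where
  measurable_x : ∀ i, Measurable (x i)
  measurable_y : ∀ i, Measurable (y i)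
  indep : iIndepFun (fun i ω => (x i ω, y i ω)) P
  prob_label : ∀ i (s : ℤˣ), P (y i ⁻¹' {s}) = 1 / 2
  law_cond : ∀ i (s : ℤˣ),
    (cond P (y i ⁻¹' {s})).map (x i) = multivariateGaussian (((s : ℤ) : ℝ) • m) Sig

/-- The data matrix whose `i`-th row is the `i`-th sample. -/
def dataMatrix {n d : ℕ} (x : Fin n → EuclideanSpace ℝ (Fin d)) : Matrix (Fin n) (Fin d) ℝ :=
  Matrix.of fun i j => x i j

/-- `A^{-1/2}` for a positive semidefinite matrix `A`, by functional calculus. For singular `A`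
the zero eigenvalues are sent to `0`, which gives the square root of the pseudoinverse. -/
def invSqrt {d : ℕ} (A : Matrix (Fin d) (Fin d) ℝ) : Matrix (Fin d) (Fin d) ℝ :=
  cfc (fun t : ℝ => (√t)⁻¹) A

/-- Whitened data `W = √n X (XᵀX)^{-1/2}`. -/
def whiten {n d : ℕ} (X : Matrix (Fin n) (Fin d) ℝ) : Matrix (Fin n) (Fin d) ℝ :=
  √(n : ℝ) • (X * invSqrt (X.transpose * X))

/-- Weighted sample covariance `n⁻¹ ∑ i, (‖w i‖² - d) w i (w i)ᵀ`, with `w i` the `i`-th row of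
`W`. -/
def weightedCov {n d : ℕ} (W : Matrix (Fin n) (Fin d) ℝ) : Matrix (Fin d) (Fin d) ℝ :=
  (n : ℝ)⁻¹ • ∑ i, ((∑ j, W i j ^ 2) - (d : ℝ)) • Matrix.vecMulVec (W i) (W i)

/-- `v` is a unit eigenvector of `S` associated with its smallest eigenvalue. -/
def IsBottomEigenvector {d : ℕ} (S : Matrix (Fin d) (Fin d) ℝ) (v : EuclideanSpace ℝ (Fin d)) :
    Prop :=
  ‖v‖ = 1 ∧ ∃ l : ℝ, IsLeast {t : ℝ | Module.End.HasEigenvalue (Matrix.toEuclideanLin S) t} l ∧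
    Matrix.toEuclideanLin S v = l • v

/-- `yhat` is an output of the spectral algorithm on the data matrix `X`: the sign vector of `W v`
for some choice of the bottom unit eigenvector `v` of the weighted covariance. -/
def IsSpectralOutput {n d : ℕ} (X : Matrix (Fin n) (Fin d) ℝ) (yhat : Fin n → ℤˣ) : Prop :=
  ∃ v : EuclideanSpace ℝ (Fin d), IsBottomEigenvector (weightedCov (whiten X)) v ∧
    yhat = fun i => sgn ((whiten X).mulVec v.ofLp i)

/-- Misclassification proportion `n⁻¹ min_{s = ±1} |{i : s yhat i ≠ y i}|`. -/
def misclass {n : ℕ} (yhat y : Fin n → ℤˣ) : ℝ :=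
  (n : ℝ)⁻¹ * min ((Finset.univ.filter fun i => yhat i ≠ y i).card : ℝ)
    ((Finset.univ.filter fun i => -yhat i ≠ y i).card : ℝ)

end

/-!
The leverage scores `‖w i‖²`, and the form `v ↦ ∑ i, (‖w i‖² - d) ⟪w i, v⟫²` up to the change of
variables by the sample covariance, do not change when the data undergo an invertible linear map.
One may therefore assume that `x i = u i` is isotropic with independent coordinates, one of them
equal to `√(1 - σ²) y i + σ γ i` and the others standard Gaussian. Then `‖w i‖²` is close to
`‖u i‖²`, and `𝔼 (‖u‖² - d) ⟪u, v⟫² = ∑ k, (𝔼 u_k⁴ - 1) v_k²` for every vector `v`. The coefficient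
is `2` in the Gaussian directions and, for small `σ`, at most `1 / 4` in the label direction,
because a random sign has the smallest possible kurtosis, so the bottom eigenvector is close to the
label direction. The fluctuations of the empirical form, of order `d (log n)^{3/2} / √n`, are
controlled over a net of the unit ball, with truncation to handle the heavy tails of the
fourth-degree summands. Finally, a misclassified sample contributes a constant to the squared
distance between the labels and the scores `⟪w i, v⟫`, which bounds the number of errors by that
distance.
-/

section Concentration

variable {Ω : Type*} [MeasurableSpace Ω] {P : Measure Ω}

/-- The rate `√(log n / n)` at which averages of `n` independent variables concentrate with
polynomially small failure probability. -/
noncomputable def logRate (n : ℕ) : ℝ := √(Real.log n / n)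

theorem logRate_nonneg (n : ℕ) : 0 ≤ logRate n := Real.sqrt_nonneg _

theorem logRate_le_one (n : ℕ) : logRate n ≤ 1 :=
  Real.sqrt_le_one.2 (div_le_one_of_le₀ (Real.log_le_self n.cast_nonneg) n.cast_nonneg)

theorem natCast_mul_logRate_sq (n : ℕ) : n * logRate n ^ 2 = Real.log n := by
  rcases eq_or_ne n 0 with rfl | hn
  · simp
  · rw [logRate, Real.sq_sqrt (div_nonneg (Real.log_natCast_nonneg n) n.cast_nonneg)]
    field_simp

theorem exp_neg_mul_log_natCast {n : ℕ} (hn : n ≠ 0) (κ : ℝ) :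
    Real.exp (-(κ * Real.log n)) = (n : ℝ) ^ (-κ) := by
  rw [Real.rpow_def_of_pos (by positivity), mul_neg, mul_comm]

theorem exp_le_one_add_add_sq_mul_exp (x : ℝ) :
    Real.exp x ≤ 1 + x + x ^ 2 * Real.exp (max x 0) := by
  by_cases hx : |x| ≤ 1
  · have h_exp := (abs_le.1 (Real.abs_exp_sub_one_sub_id_le hx)).2
    have h_one : 1 ≤ Real.exp (max x 0) := Real.one_le_exp (le_max_right _ _)
    nlinarith [sq_nonneg x]
  · rcases lt_abs.1 (not_le.1 hx) with hx | hx
    · rw [max_eq_left (by linarith)]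
      nlinarith [mul_pos (Real.exp_pos x) (show 0 < x ^ 2 - 1 by nlinarith)]
    · rw [max_eq_right (by linarith), Real.exp_zero]
      nlinarith [Real.exp_le_one_iff.2 (show x ≤ 0 by linarith)]

-- A one-sided Bernstein bound: only the positive part of `f` has to be exponentially integrable.
theorem mgf_le_exp_of_sq_mul_exp_le [IsProbabilityMeasure P] {f g : Ω → ℝ} {lam m V : ℝ}
    (hlam : 0 ≤ lam) (hf : Integrable f P) (hm : ∫ ω, f ω ∂P ≤ m) (hg : Integrable g P)
    (hfg : ∀ ω, f ω ^ 2 * Real.exp (lam * max (f ω) 0) ≤ g ω) (hV : ∫ ω, g ω ∂P ≤ V) :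
    Integrable (fun ω => Real.exp (lam * f ω)) P ∧
      mgf f P lam ≤ Real.exp (lam * m + lam ^ 2 * V) := by
  have h_exp (ω : Ω) : Real.exp (lam * f ω) ≤ 1 + lam * f ω + lam ^ 2 * g ω := by
    have h_max : max (lam * f ω) 0 = lam * max (f ω) 0 := by
      rw [mul_max_of_nonneg _ _ hlam, mul_zero]
    calc Real.exp (lam * f ω)
        ≤ 1 + lam * f ω + lam ^ 2 * (f ω ^ 2 * Real.exp (lam * max (f ω) 0)) := by
          simpa only [h_max, mul_pow, mul_assoc] using exp_le_one_add_add_sq_mul_exp (lam * f ω)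
      _ ≤ 1 + lam * f ω + lam ^ 2 * g ω := by gcongr; exact hfg ω
  have h_lin : Integrable (fun ω => 1 + lam * f ω) P :=
    (integrable_const 1).add (hf.const_mul lam)
  have h_quad : Integrable (fun ω => 1 + lam * f ω + lam ^ 2 * g ω) P :=
    h_lin.add (hg.const_mul _)
  have h_int : Integrable (fun ω => Real.exp (lam * f ω)) P :=
    h_quad.mono' (by have := hf.aestronglyMeasurable.aemeasurable; fun_prop)
      (.of_forall fun ω => by rw [Real.norm_eq_abs, Real.abs_exp]; exact h_exp ω)
  refine ⟨h_int, ?_⟩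
  calc mgf f P lam ≤ ∫ ω, (1 + lam * f ω + lam ^ 2 * g ω) ∂P := integral_mono h_int h_quad h_exp
    _ = 1 + lam * ∫ ω, f ω ∂P + lam ^ 2 * ∫ ω, g ω ∂P := by
      rw [integral_add h_lin (hg.const_mul _), integral_add (integrable_const 1) (hf.const_mul lam),
        integral_const_mul, integral_const_mul, integral_const, probReal_univ, one_smul]
    _ ≤ (lam * m + lam ^ 2 * V) + 1 := by
      have := mul_le_mul_of_nonneg_left hm hlam
      have := mul_le_mul_of_nonneg_left hV (sq_nonneg lam)
      linarith
    _ ≤ _ := Real.add_one_le_exp _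

theorem measureReal_sum_ge_le_exp {ι : Type*} {f : ι → Ω → ℝ} (hind : iIndepFun f P)
    (hmeas : ∀ i, Measurable (f i)) {lam b : ℝ} (hlam : 0 ≤ lam) (s : Finset ι)
    (hint : ∀ i, Integrable (fun ω => Real.exp (lam * f i ω)) P)
    (hmgf : ∀ i, mgf (f i) P lam ≤ Real.exp b) (t : ℝ) :
    P.real {ω | t ≤ ∑ i ∈ s, f i ω} ≤ Real.exp (-lam * t + s.card * b) := by
  have := hind.isProbabilityMeasure
  have h_chernoff := measure_ge_le_exp_mul_mgf (μ := P) (X := ∑ i ∈ s, f i) t hlam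
    (hind.integrable_exp_mul_sum hmeas fun i _ => hint i)
  simp only [hind.mgf_sum hmeas, Finset.sum_apply] at h_chernoff
  calc P.real {ω | t ≤ ∑ i ∈ s, f i ω}
      ≤ Real.exp (-lam * t) * ∏ i ∈ s, mgf (f i) P lam := h_chernoff
    _ ≤ Real.exp (-lam * t) * ∏ _i ∈ s, Real.exp b := by
      gcongr with i
      · exact fun _ _ => mgf_nonneg
      · exact hmgf i
    _ = _ := by rw [Finset.prod_const, ← Real.exp_nat_mul, ← Real.exp_add]

theorem abs_le_mul_exp_sqrt_half (x : ℝ) : |x| ≤ 8 * Real.exp (√|x| / 2) := by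
  have h := Real.pow_div_factorial_le_exp (√|x| / 2) (by positivity) 2
  rw [div_pow, Real.sq_sqrt (abs_nonneg x)] at h
  norm_num [Nat.factorial] at h
  linarith

theorem abs_le_mul_exp_sqrt (x : ℝ) : |x| ≤ 8 * Real.exp √|x| :=
  (abs_le_mul_exp_sqrt_half x).trans (by gcongr; linarith [Real.sqrt_nonneg |x|])

theorem sq_le_mul_exp_sqrt (x : ℝ) : x ^ 2 ≤ 24 * Real.exp √|x| := by
  have h := Real.pow_div_factorial_le_exp √|x| (by positivity) 4
  rw [show √|x| ^ 4 = (√|x| ^ 2) ^ 2 by ring, Real.sq_sqrt (abs_nonneg x), sq_abs] at h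
  norm_num [Nat.factorial] at h
  linarith

theorem truncation_sq_le_add_exp_sqrt {α : Type*} (f : α → ℝ) (R : ℝ) (ω : α) :
    truncation f (R ^ 2) ω ≤ f ω + 8 * Real.exp (-(R / 2)) * Real.exp √|f ω| := by
  rcases lt_or_ge |f ω| (R ^ 2) with h | h
  · rw [truncation_eq_self h]
    exact le_add_of_nonneg_right (by positivity)
  · have h_exp : Real.exp (√|f ω| / 2) ≤ Real.exp (-(R / 2)) * Real.exp √|f ω| := by
      rw [← Real.exp_add, Real.exp_le_exp]
      linarith [Real.le_sqrt_of_sq_le h]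
    have h_trunc : truncation f (R ^ 2) ω ≤ f ω + |f ω| := by
      unfold truncation Set.indicator
      simp only [Function.comp_apply, id_eq]
      split_ifs
      · exact le_add_of_nonneg_right (abs_nonneg _)
      · linarith [neg_abs_le (f ω)]
    linarith [abs_le_mul_exp_sqrt_half (f ω)]

section Truncation

variable {f : Ω → ℝ} {K R : ℝ}

theorem integrable_of_integrable_exp_sqrt_abs (hf : Measurable f)
    (hint : Integrable (fun ω => Real.exp √|f ω|) P) : Integrable f P :=
  (hint.const_mul 8).mono' hf.aestronglyMeasurable (.of_forall fun ω => abs_le_mul_exp_sqrt (f ω))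

variable [IsProbabilityMeasure P]

theorem integral_truncation_sq_le (hf : Measurable f)
    (hint : Integrable (fun ω => Real.exp √|f ω|) P) (hK : ∫ ω, Real.exp √|f ω| ∂P ≤ K) :
    ∫ ω, truncation f (R ^ 2) ω ∂P ≤ ∫ ω, f ω ∂P + 8 * Real.exp (-(R / 2)) * K := by
  have hf_int := integrable_of_integrable_exp_sqrt_abs hf hint
  calc ∫ ω, truncation f (R ^ 2) ω ∂P
      ≤ ∫ ω, (f ω + 8 * Real.exp (-(R / 2)) * Real.exp √|f ω|) ∂P :=
        integral_mono hf.aestronglyMeasurable.integrable_truncation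
          (hf_int.add (hint.const_mul _)) (truncation_sq_le_add_exp_sqrt f R)
    _ = ∫ ω, f ω ∂P + 8 * Real.exp (-(R / 2)) * ∫ ω, Real.exp √|f ω| ∂P := by
        rw [integral_add hf_int (hint.const_mul _), integral_const_mul]
    _ ≤ _ := by gcongr

theorem mgf_truncation_sq_le {lam m : ℝ} (hf : Measurable f)
    (hint : Integrable (fun ω => Real.exp √|f ω|) P) (hK : ∫ ω, Real.exp √|f ω| ∂P ≤ K)
    (hm : ∫ ω, f ω ∂P ≤ m) (hlam : 0 ≤ lam) (hlamR : lam * R ^ 2 ≤ 1) :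
    Integrable (fun ω => Real.exp (lam * truncation f (R ^ 2) ω)) P ∧
      mgf (truncation f (R ^ 2)) P lam ≤
        Real.exp (lam * (m + 8 * Real.exp (-(R / 2)) * K) + lam ^ 2 * (72 * K)) := by
  refine mgf_le_exp_of_sq_mul_exp_le (g := fun ω => 72 * Real.exp √|f ω|) hlam
    hf.aestronglyMeasurable.integrable_truncation
    ((integral_truncation_sq_le hf hint hK).trans (by gcongr)) (hint.const_mul _)
    (fun ω => ?_) (by rw [integral_const_mul]; gcongr)
  have h_sq : truncation f (R ^ 2) ω ^ 2 ≤ 24 * Real.exp √|f ω| :=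
    (sq_le_sq.2 (abs_truncation_le_abs_self f (R ^ 2) ω)).trans (sq_le_mul_exp_sqrt (f ω))
  have h_max : max (truncation f (R ^ 2) ω) 0 ≤ R ^ 2 :=
    max_le (le_of_abs_le ((abs_truncation_le_bound f _ ω).trans (abs_sq R).le)) (sq_nonneg R)
  have h_exp : Real.exp (lam * max (truncation f (R ^ 2) ω) 0) ≤ 3 :=
    calc _ ≤ Real.exp 1 := Real.exp_le_exp.2 ((by gcongr : _ ≤ lam * R ^ 2).trans hlamR)
      _ ≤ 3 := Real.exp_one_lt_d9.le.trans (by norm_num)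
  linarith [mul_le_mul h_sq h_exp (Real.exp_pos _).le (by positivity)]

theorem measureReal_sq_le_abs_le (hint : Integrable (fun ω => Real.exp √|f ω|) P)
    (hK : ∫ ω, Real.exp √|f ω| ∂P ≤ K) : P.real {ω | R ^ 2 ≤ |f ω|} ≤ Real.exp (-R) * K := by
  have h_markov := mul_meas_ge_le_integral_of_nonneg
    (.of_forall fun ω => (Real.exp_pos √|f ω|).le) hint (Real.exp R)
  have h_sub : P.real {ω | R ^ 2 ≤ |f ω|} ≤ P.real {ω | Real.exp R ≤ Real.exp √|f ω|} :=
    measureReal_mono fun ω hω => Real.exp_le_exp.2 (Real.le_sqrt_of_sq_le hω)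
  rw [Real.exp_neg, ← div_eq_inv_mul, le_div_iff₀' (Real.exp_pos R)]
  calc _ ≤ _ := mul_le_mul_of_nonneg_left h_sub (Real.exp_pos _).le
    _ ≤ K := h_markov.trans hK

end Truncation

section Sums

variable {ι : Type*} [Fintype ι] {f : ι → Ω → ℝ} {κ K m : ℝ}

theorem measureReal_sum_ge_le_of_truncation (hind : iIndepFun f P) (hmeas : ∀ i, Measurable (f i))
    (hint : ∀ i, Integrable (fun ω => Real.exp √|f i ω|) P)
    (hK : ∀ i, ∫ ω, Real.exp √|f i ω| ∂P ≤ K) (hm : ∀ i, ∫ ω, f i ω ∂P ≤ m)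
    {lam R : ℝ} (hlam : 0 ≤ lam) (hlamR : lam * R ^ 2 ≤ 1) (t : ℝ) :
    P.real {ω | t ≤ ∑ i, f i ω} ≤
      Real.exp (-lam * t + Fintype.card ι *
        (lam * (m + 8 * Real.exp (-(R / 2)) * K) + lam ^ 2 * (72 * K))) +
      Fintype.card ι * (Real.exp (-R) * K) := by
  have := hind.isProbabilityMeasure
  have h_trunc : Measurable (Set.indicator (Set.Ioc (-R ^ 2) (R ^ 2)) (id : ℝ → ℝ)) :=
    measurable_id.indicator measurableSet_Ioc
  have h_mgf (i : ι) := mgf_truncation_sq_le (hmeas i) (hint i) (hK i) (hm i) hlam hlamR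
  have h_sum := measureReal_sum_ge_le_exp (f := fun i => truncation (f i) (R ^ 2))
    (hind.comp _ fun _ => h_trunc) (fun i => h_trunc.comp (hmeas i)) hlam Finset.univ
    (fun i => (h_mgf i).1) (fun i => (h_mgf i).2) t
  have h_sub : {ω | t ≤ ∑ i, f i ω} ⊆
      {ω | t ≤ ∑ i, truncation (f i) (R ^ 2) ω} ∪ ⋃ i, {ω | R ^ 2 ≤ |f i ω|} := by
    intro ω hω
    by_cases h : ∃ i, R ^ 2 ≤ |f i ω|
    · exact Or.inr (Set.mem_iUnion.2 h)
    · push Not at h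
      left
      simpa only [Set.mem_ofPred_eq, truncation_eq_self (h _)] using hω
  calc _ ≤ _ := measureReal_mono h_sub
    _ ≤ _ := measureReal_union_le _ _
    _ ≤ _ := by
      refine add_le_add h_sum ((measureReal_iUnion_fintype_le _).trans ?_)
      calc _ ≤ ∑ _i : ι, Real.exp (-R) * K :=
            Finset.sum_le_sum fun i _ => measureReal_sq_le_abs_le (hint i) (hK i)
        _ = _ := by rw [Finset.sum_const, Finset.card_univ, nsmul_eq_mul]

-- Truncating at `((κ + 1) log n)²` perturbs neither the event nor the mean by more than `O(1 / n)`.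
theorem measureReal_sum_ge_le_of_exp_sqrt {n : ℕ} (hn : Fintype.card ι = n) (hn0 : n ≠ 0)
    (hind : iIndepFun f P) (hmeas : ∀ i, Measurable (f i)) (hκ : 1 ≤ κ)
    (hint : ∀ i, Integrable (fun ω => Real.exp √|f i ω|) P)
    (hK : ∀ i, ∫ ω, Real.exp √|f i ω| ∂P ≤ K) (hm : ∀ i, ∫ ω, f i ω ∂P ≤ m)
    (hsmall : logRate n * ((κ + 1) * Real.log n) ^ 2 ≤ 1) :
    P.real {ω | n * (m + (72 * K + κ) * logRate n) ≤ ∑ i, f i ω} ≤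
      (Real.exp (8 * K) + K) * (n : ℝ) ^ (-κ) := by
  have hn_pos : (0 : ℝ) < n := by positivity
  have hlog : 0 ≤ Real.log n := Real.log_natCast_nonneg n
  have hK0 : 0 ≤ K := by
    obtain ⟨i⟩ : Nonempty ι := Fintype.card_pos_iff.1 (by omega)
    exact (integral_nonneg fun ω => (Real.exp_pos _).le).trans (hK i)
  have h_half : n * Real.exp (-((κ + 1) * Real.log n / 2)) ≤ 1 := by
    rw [← Real.exp_log hn_pos, ← Real.exp_add, Real.exp_le_one_iff, Real.log_exp]
    nlinarith
  have h_sum := measureReal_sum_ge_le_of_truncation hind hmeas hint hK hm (logRate_nonneg n) hsmall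
    (n * (m + (72 * K + κ) * logRate n))
  rw [hn] at h_sum
  have h_exponent : -logRate n * (n * (m + (72 * K + κ) * logRate n)) + n * (logRate n *
      (m + 8 * Real.exp (-((κ + 1) * Real.log n / 2)) * K) + logRate n ^ 2 * (72 * K)) ≤
      8 * K + -(κ * Real.log n) := by
    have h_trunc : logRate n * (n * Real.exp (-((κ + 1) * Real.log n / 2))) ≤ 1 :=
      mul_le_one₀ (logRate_le_one n) (by positivity) h_half
    linear_combination (8 * K) * h_trunc - κ * natCast_mul_logRate_sq n
  calc _ ≤ _ := h_sum
    _ ≤ Real.exp (8 * K + -(κ * Real.log n)) + n * (Real.exp (-((κ + 1) * Real.log n)) * K) := by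
      gcongr
    _ = Real.exp (8 * K) * (n : ℝ) ^ (-κ) + K * (n * (n : ℝ) ^ (-(κ + 1))) := by
      rw [Real.exp_add, exp_neg_mul_log_natCast hn0, exp_neg_mul_log_natCast hn0]; ring
    _ = _ := by
      rw [← Real.rpow_one_add' hn_pos.le (by linarith), show 1 + -(κ + 1) = -κ by ring]; ring

end Sums

end Concentration

section Subgaussian

variable {Ω : Type*} [MeasurableSpace Ω] {P : Measure Ω}

theorem lintegral_exp_mul_sq_gaussianReal {s : ℝ} (hs : s < 1 / 2) :
    ∫⁻ z, ENNReal.ofReal (Real.exp (s * z ^ 2)) ∂(gaussianReal 0 1) =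
      ENNReal.ofReal (√(1 - 2 * s))⁻¹ := by
  have h_density (z : ℝ) :
      (gaussianPDF 0 1 * fun z => ENNReal.ofReal (Real.exp (s * z ^ 2))) z =
        ENNReal.ofReal ((√(2 * Real.pi))⁻¹ * Real.exp (-(1 / 2 - s) * z ^ 2)) := by
    rw [Pi.mul_apply, gaussianPDF, ← ENNReal.ofReal_mul (gaussianPDFReal_nonneg _ _ _),
      gaussianPDFReal, mul_assoc, ← Real.exp_add, NNReal.coe_one]
    ring_nf
  rw [gaussianReal_of_var_ne_zero _ one_ne_zero,
    lintegral_withDensity_eq_lintegral_mul _ (measurable_gaussianPDF 0 1) (by fun_prop)]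
  simp_rw [h_density]
  rw [← ofReal_integral_eq_lintegral_ofReal
    ((integrable_exp_neg_mul_sq (by linarith)).const_mul _) (.of_forall fun z => by positivity),
    integral_const_mul, integral_gaussian, ← Real.sqrt_inv, ← Real.sqrt_inv,
    ← Real.sqrt_mul (by positivity)]
  congr 2
  have : 1 - 2 * s ≠ 0 := by linarith
  have : 1 / 2 - s ≠ 0 := by linarith
  have := Real.pi_ne_zero
  field_simp

-- `exp (t Y² / 2)` is the moment generating function, evaluated at `Y`, of a centred Gaussian of
-- variance `t`; exchanging the two expectations leaves a Gaussian integral.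
theorem lintegral_exp_mul_sq_le_of_hasSubgaussianMGF [SFinite P] {Y : Ω → ℝ} {c : NNReal} {t : ℝ}
    (hY : HasSubgaussianMGF Y c P) (ht : 0 ≤ t) (htc : t * c < 1) :
    ∫⁻ ω, ENNReal.ofReal (Real.exp (t * Y ω ^ 2 / 2)) ∂P ≤ ENNReal.ofReal (√(1 - t * c))⁻¹ := by
  have hY_meas := hY.aemeasurable
  have h_mix (ω : Ω) : ENNReal.ofReal (Real.exp (t * Y ω ^ 2 / 2)) =
      ∫⁻ z, ENNReal.ofReal (Real.exp (√t * Y ω * z)) ∂(gaussianReal 0 1) := by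
    have h_mgf := mgf_gaussianReal (p := gaussianReal 0 1) (X := id) (μ := 0) (v := 1)
      Measure.map_id (√t * Y ω)
    rw [mul_pow, Real.sq_sqrt ht, NNReal.coe_one, zero_mul, zero_add, one_mul] at h_mgf
    rw [← h_mgf, mgf]
    exact ofReal_integral_eq_lintegral_ofReal (integrable_exp_mul_gaussianReal _)
      (.of_forall fun _ => (Real.exp_pos _).le)
  have h_mgf (z : ℝ) : ∫⁻ ω, ENNReal.ofReal (Real.exp (√t * Y ω * z)) ∂P ≤
      ENNReal.ofReal (Real.exp (t * c / 2 * z ^ 2)) := by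
    have h_comm (ω : Ω) : √t * Y ω * z = √t * z * Y ω := by ring
    simp_rw [h_comm]
    rw [← ofReal_integral_eq_lintegral_ofReal (hY.integrable_exp_mul _)
      (.of_forall fun _ => (Real.exp_pos _).le)]
    refine ENNReal.ofReal_le_ofReal ((hY.mgf_le (√t * z)).trans_eq ?_)
    rw [mul_pow, Real.sq_sqrt ht]
    ring_nf
  calc ∫⁻ ω, ENNReal.ofReal (Real.exp (t * Y ω ^ 2 / 2)) ∂P
      = ∫⁻ z, ∫⁻ ω, ENNReal.ofReal (Real.exp (√t * Y ω * z)) ∂P ∂(gaussianReal 0 1) := by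
        simp_rw [h_mix]
        exact lintegral_lintegral_swap (by fun_prop)
    _ ≤ ∫⁻ z, ENNReal.ofReal (Real.exp (t * c / 2 * z ^ 2)) ∂(gaussianReal 0 1) :=
        lintegral_mono h_mgf
    _ = ENNReal.ofReal (√(1 - t * c))⁻¹ := by
        rw [lintegral_exp_mul_sq_gaussianReal (by linarith)]; ring_nf

theorem integrable_exp_sq_of_hasSubgaussianMGF [SFinite P] {Y : Ω → ℝ}
    (hY : HasSubgaussianMGF Y 1 P) :
    Integrable (fun ω => Real.exp (Y ω ^ 2 / 4)) P ∧ ∫ ω, Real.exp (Y ω ^ 2 / 4) ∂P ≤ 2 := by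
  have hY_meas := hY.aemeasurable
  have h_const : (√(1 - 1 / 2 * ((1 : NNReal) : ℝ)))⁻¹ ≤ 2 := by
    rw [inv_le_comm₀ (Real.sqrt_pos.2 (by norm_num)) two_pos]
    exact Real.le_sqrt_of_sq_le (by norm_num)
  have h_lint : ∫⁻ ω, ENNReal.ofReal (Real.exp (Y ω ^ 2 / 4)) ∂P ≤ ENNReal.ofReal 2 := by
    refine le_trans (le_of_eq ?_) ((lintegral_exp_mul_sq_le_of_hasSubgaussianMGF (t := 1 / 2) hY
      (by norm_num) (by norm_num)).trans (ENNReal.ofReal_le_ofReal h_const))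
    ring_nf
  have h_meas : AEStronglyMeasurable (fun ω => Real.exp (Y ω ^ 2 / 4)) P :=
    ((hY_meas.pow_const 2).div_const 4).exp.aestronglyMeasurable
  refine ⟨⟨h_meas, ?_⟩, ?_⟩
  · rw [hasFiniteIntegral_iff_ofReal (.of_forall fun _ => (Real.exp_pos _).le)]
    exact h_lint.trans_lt ENNReal.ofReal_lt_top
  · rw [integral_eq_lintegral_of_nonneg_ae (.of_forall fun _ => (Real.exp_pos _).le) h_meas]
    exact ENNReal.toReal_le_of_le_ofReal zero_le_two h_lint

theorem mgf_le_exp_of_sq_mul_exp_abs_le [IsProbabilityMeasure P] {f g : Ω → ℝ} {lam V : ℝ}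
    (hf : Integrable f P) (hf0 : ∫ ω, f ω ∂P = 0) (hg : Integrable g P)
    (hfg : ∀ ω, f ω ^ 2 * Real.exp |lam * f ω| ≤ g ω) (hV : ∫ ω, g ω ∂P ≤ V) :
    Integrable (fun ω => Real.exp (lam * f ω)) P ∧ mgf f P lam ≤ Real.exp (lam ^ 2 * V) := by
  have h := mgf_le_exp_of_sq_mul_exp_le (P := P) (f := fun ω => lam * f ω) (m := 0)
    (g := fun ω => lam ^ 2 * g ω) zero_le_one (hf.const_mul lam)
    (by rw [integral_const_mul, hf0, mul_zero]) (hg.const_mul _) (fun ω => ?_)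
    (V := lam ^ 2 * V) (by rw [integral_const_mul]; gcongr)
  · simpa only [mgf, one_mul, mul_zero, zero_add, one_pow] using h
  · calc (lam * f ω) ^ 2 * Real.exp (1 * max (lam * f ω) 0)
        ≤ (lam * f ω) ^ 2 * Real.exp |lam * f ω| := by
          rw [one_mul]; gcongr; exact max_le (le_abs_self _) (abs_nonneg _)
      _ = lam ^ 2 * (f ω ^ 2 * Real.exp |lam * f ω|) := by ring
      _ ≤ lam ^ 2 * g ω := by gcongr; exact hfg ω

theorem sq_sub_one_mul_exp_le {x : ℝ} (hx : 0 ≤ x) :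
    (x - 1) ^ 2 * Real.exp ((x + 1) / 8) ≤ 256 * Real.exp (x / 4) := by
  have h_quad : (x + 1) ^ 2 / 128 ≤ Real.exp ((x + 1) / 8) := by
    have h := Real.pow_div_factorial_le_exp ((x + 1) / 8) (by positivity) 2
    norm_num [Nat.factorial] at h
    linarith
  have h_const : Real.exp (1 / 4) ≤ 2 := by
    have h := Real.exp_bound_div_one_sub_of_interval (x := 1 / 4) (by norm_num) (by norm_num)
    linarith
  calc (x - 1) ^ 2 * Real.exp ((x + 1) / 8)
      ≤ (128 * Real.exp ((x + 1) / 8)) * Real.exp ((x + 1) / 8) := by gcongr; nlinarith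
    _ = 128 * Real.exp (x / 4) * Real.exp (1 / 4) := by
      rw [mul_assoc, mul_assoc, ← Real.exp_add, ← Real.exp_add]; ring_nf
    _ ≤ 128 * Real.exp (x / 4) * 2 := by gcongr
    _ = _ := by ring

theorem mgf_sq_sub_one_le_of_hasSubgaussianMGF {Y : Ω → ℝ} [IsProbabilityMeasure P]
    (hY : HasSubgaussianMGF Y 1 P) (hY2 : ∫ ω, Y ω ^ 2 ∂P = 1) {lam : ℝ} (hlam : |lam| ≤ 1 / 8) :
    Integrable (fun ω => Real.exp (lam * (Y ω ^ 2 - 1))) P ∧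
      mgf (fun ω => Y ω ^ 2 - 1) P lam ≤ Real.exp (512 * lam ^ 2) := by
  obtain ⟨h_int, h_le⟩ := integrable_exp_sq_of_hasSubgaussianMGF hY
  have h_sq : Integrable (fun ω => Y ω ^ 2) P := (hY.memLp 2).integrable_sq
  have h_mean : ∫ ω, (Y ω ^ 2 - 1) ∂P = 0 := by
    rw [integral_sub h_sq (integrable_const 1), hY2, integral_const, probReal_univ, one_smul,
      sub_self]
  rw [mul_comm 512]
  refine mgf_le_exp_of_sq_mul_exp_abs_le (h_sq.sub (integrable_const 1)) h_mean
    (h_int.const_mul 256) (fun ω => le_trans ?_ (sq_sub_one_mul_exp_le (sq_nonneg (Y ω))))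
    (by rw [integral_const_mul]; linarith)
  gcongr
  have h_abs : |Y ω ^ 2 - 1| ≤ Y ω ^ 2 + 1 := abs_le.2 ⟨by nlinarith [sq_nonneg (Y ω)], by linarith⟩
  rw [abs_mul]
  linarith [mul_le_mul hlam h_abs (abs_nonneg _) (by norm_num)]

end Subgaussian

section IsotropicVector

variable {Ω : Type*} [MeasurableSpace Ω] {P : Measure Ω} {d : ℕ}

theorem euclideanSpace_real_inner_eq_sum (w v : EuclideanSpace ℝ (Fin d)) :
    inner ℝ w v = ∑ k, w k * v k := by
  simp only [PiLp.inner_apply, RCLike.inner_apply, conj_trivial, mul_comm]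

theorem mul_inner_sq_eq_sum (c : ℝ) (w v : EuclideanSpace ℝ (Fin d)) :
    c * inner ℝ w v ^ 2 = ∑ l, ∑ m, w l * w m * (c * (v l * v m)) := by
  rw [euclideanSpace_real_inner_eq_sum, sq, Finset.sum_mul_sum, Finset.mul_sum]
  refine Finset.sum_congr rfl fun l _ => ?_
  rw [Finset.mul_sum]
  exact Finset.sum_congr rfl fun m _ => by ring

theorem norm_sq_sub_natCast_eq_sum (v : EuclideanSpace ℝ (Fin d)) :
    ‖v‖ ^ 2 - d = ∑ k, (v k ^ 2 - 1) := by
  rw [EuclideanSpace.real_norm_sq_eq, Finset.sum_sub_distrib, Finset.sum_const, Finset.card_univ,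
    Fintype.card_fin, nsmul_one]

/-- A random vector with independent centred coordinates of unit variance that are subgaussian
with variance proxy `1`. -/
structure IsIsotropic (P : Measure Ω) (u : Ω → EuclideanSpace ℝ (Fin d)) : Prop where
  measurable : Measurable u
  indep : iIndepFun (fun k ω => u ω k) P
  subgaussian : ∀ k, HasSubgaussianMGF (fun ω => u ω k) 1 P
  mean : ∀ k, ∫ ω, u ω k ∂P = 0
  second_moment : ∀ k, ∫ ω, u ω k ^ 2 ∂P = 1

namespace IsIsotropic

variable {u : Ω → EuclideanSpace ℝ (Fin d)}

theorem isProbabilityMeasure (h : IsIsotropic P u) : IsProbabilityMeasure P :=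
  h.indep.isProbabilityMeasure

theorem measurable_apply (h : IsIsotropic P u) (k : Fin d) : Measurable fun ω => u ω k := by
  have := h.measurable
  fun_prop

theorem measurable_inner (h : IsIsotropic P u) (w : EuclideanSpace ℝ (Fin d)) :
    Measurable fun ω => inner ℝ w (u ω) := by
  have := h.measurable
  fun_prop

theorem subgaussian_inner (h : IsIsotropic P u) {w : EuclideanSpace ℝ (Fin d)} (hw : ‖w‖ = 1) :
    HasSubgaussianMGF (fun ω => inner ℝ w (u ω)) 1 P := by
  have h_indep : iIndepFun (fun k ω => w k * u ω k) P :=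
    h.indep.comp (fun k x => w k * x) fun k => by fun_prop
  have h_coord (k : Fin d) : HasSubgaussianMGF (fun ω => w k * u ω k) (‖w k‖₊ ^ 2) P := by
    convert! (h.subgaussian k).const_mul (w k) using 1
    refine NNReal.eq ?_
    rw [NNReal.coe_pow, coe_nnnorm, Real.norm_eq_abs, sq_abs]
    exact (mul_one _).symm
  have h_norm : ∑ k, ‖w k‖₊ ^ 2 = 1 := by
    ext
    push_cast
    rw [← one_pow 2, ← hw, EuclideanSpace.norm_sq_eq]
  have h_sum := HasSubgaussianMGF.sum_of_iIndepFun h_indep (s := Finset.univ) fun k _ => h_coord k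
  rw [h_norm] at h_sum
  simpa only [euclideanSpace_real_inner_eq_sum] using h_sum

theorem integrable_mul (h : IsIsotropic P u) (l m : Fin d) :
    Integrable (fun ω => u ω l * u ω m) P :=
  MemLp.integrable_mul (p := 2) (q := 2) ((h.subgaussian l).memLp 2) ((h.subgaussian m).memLp 2)

theorem integrable_sq (h : IsIsotropic P u) (k : Fin d) : Integrable (fun ω => u ω k ^ 2) P :=
  ((h.subgaussian k).memLp 2).integrable_sq

theorem integrable_pow_four (h : IsIsotropic P u) (k : Fin d) :
    Integrable (fun ω => u ω k ^ 4) P := by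
  have h_norm := ((h.subgaussian k).memLp 4).integrable_norm_pow (p := 4) four_ne_zero
  simpa only [Real.norm_eq_abs, Even.pow_abs (show Even 4 by decide)] using h_norm

theorem memLp_mul (h : IsIsotropic P u) (l m : Fin d) : MemLp (fun ω => u ω l * u ω m) 2 P := by
  have : ENNReal.HolderTriple 4 4 2 := by
    refine ⟨?_⟩
    rw [← two_mul, show (4 : ENNReal) = 2 * 2 by norm_num, ENNReal.mul_inv (by simp) (by simp),
      ← mul_assoc, ENNReal.mul_inv_cancel (by simp) (by simp), one_mul]
  exact ((h.subgaussian m).memLp 4).mul (p := 4) (q := 4) ((h.subgaussian l).memLp 4)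

theorem integrable_sq_sub_one_mul (h : IsIsotropic P u) (k l m : Fin d) :
    Integrable (fun ω => (u ω k ^ 2 - 1) * (u ω l * u ω m)) P := by
  have := h.isProbabilityMeasure
  refine MemLp.integrable_mul (p := 2) (q := 2) (MemLp.sub ?_ (memLp_const 1)) (h.memLp_mul l m)
  simpa only [sq] using h.memLp_mul k k

theorem integral_mul (h : IsIsotropic P u) (l m : Fin d) :
    ∫ ω, u ω l * u ω m ∂P = if l = m then 1 else 0 := by
  split_ifs with hlm
  · simpa only [hlm, sq] using h.second_moment m
  · have h_meas := h.measurable_apply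
    rw [(h.indep.indepFun hlm).integral_fun_mul_eq_mul_integral
      (h_meas l).aestronglyMeasurable (h_meas m).aestronglyMeasurable, h.mean, zero_mul]

theorem integral_sq_sub_one (h : IsIsotropic P u) (k : Fin d) : ∫ ω, (u ω k ^ 2 - 1) ∂P = 0 := by
  have := h.isProbabilityMeasure
  rw [integral_sub (h.integrable_sq k) (integrable_const 1), h.second_moment, integral_const,
    probReal_univ, one_smul, sub_self]

theorem integral_sq_sub_one_mul_of_ne (h : IsIsotropic P u) {k l m : Fin d} (hlm : l ≠ m)
    (hkm : k ≠ m) : ∫ ω, (u ω k ^ 2 - 1) * (u ω l * u ω m) ∂P = 0 := by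
  have h_meas := h.measurable_apply
  have h_indep : IndepFun (fun ω => (u ω k ^ 2 - 1) * u ω l) (fun ω => u ω m) P :=
    (h.indep.indepFun_prodMk h_meas k l m hkm hlm).comp
      (φ := fun p : ℝ × ℝ => (p.1 ^ 2 - 1) * p.2) (ψ := id) (by fun_prop) measurable_id
  have h_prod := h_indep.integral_fun_mul_eq_mul_integral
    ((((h_meas k).pow_const 2).sub_const 1).mul (h_meas l)).aestronglyMeasurable
    (h_meas m).aestronglyMeasurable
  rw [h.mean, mul_zero] at h_prod
  simpa only [mul_assoc] using h_prod

theorem integral_sq_sub_one_mul_sq_of_ne (h : IsIsotropic P u) {k l : Fin d} (hkl : k ≠ l) :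
    ∫ ω, (u ω k ^ 2 - 1) * (u ω l * u ω l) ∂P = 0 := by
  have h_meas := h.measurable_apply
  have h_indep : IndepFun (fun ω => u ω k ^ 2 - 1) (fun ω => u ω l * u ω l) P :=
    (h.indep.indepFun hkl).comp
      (φ := fun p : ℝ => p ^ 2 - 1) (ψ := fun p : ℝ => p * p) (by fun_prop) (by fun_prop)
  rw [h_indep.integral_fun_mul_eq_mul_integral
    (((h_meas k).pow_const 2).sub_const 1).aestronglyMeasurable
    ((h_meas l).mul (h_meas l)).aestronglyMeasurable, h.integral_sq_sub_one, zero_mul]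

theorem integral_sq_sub_one_mul (h : IsIsotropic P u) (k l m : Fin d) :
    ∫ ω, (u ω k ^ 2 - 1) * (u ω l * u ω m) ∂P =
      if l = m ∧ l = k then ∫ ω, u ω k ^ 4 ∂P - 1 else 0 := by
  rcases eq_or_ne l m with rfl | hlm
  · rcases eq_or_ne l k with rfl | hlk
    · have h_expand (ω : Ω) : (u ω l ^ 2 - 1) * (u ω l * u ω l) = u ω l ^ 4 - u ω l ^ 2 := by ring
      simp only [and_self, if_true, h_expand]
      rw [integral_sub (h.integrable_pow_four l) (h.integrable_sq l), h.second_moment]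
    · rw [if_neg fun hc => hlk hc.2, h.integral_sq_sub_one_mul_sq_of_ne hlk.symm]
  · rw [if_neg fun hc => hlm hc.1]
    rcases eq_or_ne k m with rfl | hkm
    · simp_rw [mul_comm (u _ l)]
      exact h.integral_sq_sub_one_mul_of_ne hlm.symm hlm.symm
    · exact h.integral_sq_sub_one_mul_of_ne hlm hkm

theorem integrable_weight_mul (h : IsIsotropic P u) (l m : Fin d) :
    Integrable (fun ω => (‖u ω‖ ^ 2 - d) * (u ω l * u ω m)) P := by
  simp_rw [norm_sq_sub_natCast_eq_sum, Finset.sum_mul]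
  exact integrable_finsetSum _ fun k _ => h.integrable_sq_sub_one_mul k l m

theorem integral_weight_mul (h : IsIsotropic P u) (l m : Fin d) :
    ∫ ω, (‖u ω‖ ^ 2 - d) * (u ω l * u ω m) ∂P =
      if l = m then ∫ ω, u ω l ^ 4 ∂P - 1 else 0 := by
  simp_rw [norm_sq_sub_natCast_eq_sum, Finset.sum_mul]
  rw [integral_finsetSum _ fun k _ => h.integrable_sq_sub_one_mul k l m]
  simp_rw [h.integral_sq_sub_one_mul]
  by_cases hlm : l = m <;> simp [hlm]

theorem integral_inner_sq (h : IsIsotropic P u) (w : EuclideanSpace ℝ (Fin d)) :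
    ∫ ω, inner ℝ w (u ω) ^ 2 ∂P = ‖w‖ ^ 2 := by
  have h_expand (ω : Ω) : inner ℝ w (u ω) ^ 2 = ∑ l, ∑ m, w l * w m * (u ω l * u ω m) := by
    simpa only [one_mul] using mul_inner_sq_eq_sum 1 w (u ω)
  simp_rw [h_expand]
  rw [integral_finsetSum _ fun l _ => integrable_finsetSum _ fun m _ =>
    (h.integrable_mul l m).const_mul _, EuclideanSpace.real_norm_sq_eq]
  refine Finset.sum_congr rfl fun l _ => ?_
  rw [integral_finsetSum _ fun m _ => (h.integrable_mul l m).const_mul _]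
  simp_rw [integral_const_mul, h.integral_mul]
  simp [sq]

theorem integrable_weight_inner_sq (h : IsIsotropic P u) (w : EuclideanSpace ℝ (Fin d)) :
    Integrable (fun ω => (‖u ω‖ ^ 2 - d) * inner ℝ w (u ω) ^ 2) P := by
  simp_rw [mul_inner_sq_eq_sum]
  exact integrable_finsetSum _ fun l _ => integrable_finsetSum _ fun m _ =>
    (h.integrable_weight_mul l m).const_mul _

theorem integral_weight_inner_sq (h : IsIsotropic P u) (w : EuclideanSpace ℝ (Fin d)) :
    ∫ ω, (‖u ω‖ ^ 2 - d) * inner ℝ w (u ω) ^ 2 ∂P =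
      ∑ l, w l ^ 2 * (∫ ω, u ω l ^ 4 ∂P - 1) := by
  simp_rw [mul_inner_sq_eq_sum]
  rw [integral_finsetSum _ fun l _ => integrable_finsetSum _ fun m _ =>
    (h.integrable_weight_mul l m).const_mul _]
  refine Finset.sum_congr rfl fun l _ => ?_
  rw [integral_finsetSum _ fun m _ => (h.integrable_weight_mul l m).const_mul _]
  simp_rw [integral_const_mul, h.integral_weight_mul]
  simp [sq]

theorem mgf_weight_le (h : IsIsotropic P u) {lam : ℝ} (hlam : |lam| ≤ 1 / 8) :
    Integrable (fun ω => Real.exp (lam * (‖u ω‖ ^ 2 - d))) P ∧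
      mgf (fun ω => ‖u ω‖ ^ 2 - d) P lam ≤ Real.exp (512 * lam ^ 2 * d) := by
  have := h.isProbabilityMeasure
  have h_coord (k : Fin d) :=
    mgf_sq_sub_one_le_of_hasSubgaussianMGF (h.subgaussian k) (h.second_moment k) hlam
  have h_indep : iIndepFun (fun k ω => u ω k ^ 2 - 1) P :=
    h.indep.comp (fun _ x => x ^ 2 - 1) fun _ => (measurable_id.pow_const 2).sub_const 1
  have h_meas (k : Fin d) : Measurable fun ω => u ω k ^ 2 - 1 :=
    ((h.measurable_apply k).pow_const 2).sub_const 1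
  have h_sum : (fun ω => ‖u ω‖ ^ 2 - (d : ℝ)) = ∑ k, fun ω => u ω k ^ 2 - 1 := by
    ext ω
    rw [norm_sq_sub_natCast_eq_sum, Finset.sum_apply]
  constructor
  · have h_int := h_indep.integrable_exp_mul_sum h_meas (s := Finset.univ) (t := lam)
      fun k _ => (h_coord k).1
    rwa [← h_sum] at h_int
  · calc mgf (fun ω => ‖u ω‖ ^ 2 - d) P lam = ∏ k, mgf (fun ω => u ω k ^ 2 - 1) P lam := by
          rw [h_sum, h_indep.mgf_sum h_meas]
      _ ≤ ∏ _k : Fin d, Real.exp (512 * lam ^ 2) :=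
          Finset.prod_le_prod (fun _ _ => mgf_nonneg) fun k _ => (h_coord k).2
      _ = Real.exp (512 * lam ^ 2 * d) := by
          rw [Finset.prod_const, ← Real.exp_nat_mul, Finset.card_univ, Fintype.card_fin, mul_comm]

theorem integrable_exp_abs_weight (h : IsIsotropic P u) (hd : 0 < d) :
    Integrable (fun ω => Real.exp (|‖u ω‖ ^ 2 - d| / (32 * √d))) P ∧
      ∫ ω, Real.exp (|‖u ω‖ ^ 2 - d| / (32 * √d)) ∂P ≤ 6 := by
  set lam := (32 * √(d : ℝ))⁻¹ with hlam
  have hlam_abs : |lam| ≤ 1 / 8 := by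
    have h_sqrt : (1 : ℝ) ≤ √d := Real.one_le_sqrt.2 (by exact_mod_cast hd)
    rw [abs_of_nonneg (by positivity), hlam, one_div]
    exact inv_anti₀ (by norm_num) (by linarith)
  have hlam_sq : 512 * lam ^ 2 * d = 1 / 2 := by
    rw [hlam, inv_pow, mul_pow, Real.sq_sqrt d.cast_nonneg]
    field_simp
    norm_num
  obtain ⟨h_int, h_le⟩ := h.mgf_weight_le hlam_abs
  obtain ⟨h_int', h_le'⟩ := h.mgf_weight_le (lam := -lam) (by rwa [abs_neg])
  rw [neg_sq, hlam_sq] at h_le'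
  rw [hlam_sq] at h_le
  have h_bound (ω : Ω) : Real.exp (|‖u ω‖ ^ 2 - d| / (32 * √d)) ≤
      Real.exp (lam * (‖u ω‖ ^ 2 - d)) + Real.exp (-lam * (‖u ω‖ ^ 2 - d)) := by
    rw [div_eq_inv_mul, ← hlam]
    rcases abs_choice (‖u ω‖ ^ 2 - (d : ℝ)) with h_abs | h_abs <;> rw [h_abs]
    · exact le_add_of_nonneg_right (Real.exp_pos _).le
    · rw [mul_neg, neg_mul]
      exact le_add_of_nonneg_left (Real.exp_pos _).le
  have h_abs_int : Integrable (fun ω => Real.exp (|‖u ω‖ ^ 2 - d| / (32 * √d))) P :=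
    (h_int.add h_int').mono' (by have := h.measurable; fun_prop)
      (.of_forall fun ω => by rw [Real.norm_eq_abs, Real.abs_exp]; exact h_bound ω)
  refine ⟨h_abs_int, ?_⟩
  calc _ ≤ ∫ ω, (Real.exp (lam * (‖u ω‖ ^ 2 - d)) + Real.exp (-lam * (‖u ω‖ ^ 2 - d))) ∂P :=
        integral_mono h_abs_int (h_int.add h_int') h_bound
    _ = mgf (fun ω => ‖u ω‖ ^ 2 - d) P lam + mgf (fun ω => ‖u ω‖ ^ 2 - d) P (-lam) :=
        integral_add h_int h_int'
    _ ≤ Real.exp 1 + Real.exp 1 := by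
        refine add_le_add (h_le.trans ?_) (h_le'.trans ?_) <;> gcongr <;> norm_num
    _ ≤ 6 := by linarith [Real.exp_one_lt_d9]

end IsIsotropic

end IsotropicVector

section Deviations

variable {Ω ι : Type*} [MeasurableSpace Ω] {P : Measure Ω} {n d : ℕ} {s : ℝ}

theorem measureReal_mul_sum_sq_sub_one_ge_le {Y : ι → Ω → ℝ} (hind : iIndepFun Y P)
    (hmeas : ∀ i, Measurable (Y i)) (hsub : ∀ i, HasSubgaussianMGF (Y i) 1 P)
    (h2 : ∀ i, ∫ ω, Y i ω ^ 2 ∂P = 1) {J : Finset ι} (hJ : J.card ≤ n) (hs0 : 0 ≤ s)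
    (hs : s ≤ 256) {c : ℝ} (hc : |c| = 1) :
    P.real {ω | n * s ≤ c * ∑ j ∈ J, (Y j ω ^ 2 - 1)} ≤ Real.exp (-(n * s ^ 2 / 4096)) := by
  have := hind.isProbabilityMeasure
  set lam := s / 2048 with hlam
  have hφ : Measurable fun x : ℝ => c * (x ^ 2 - 1) := by fun_prop
  have hmgf (i : ι) := mgf_sq_sub_one_le_of_hasSubgaussianMGF (lam := lam * c) (hsub i) (h2 i)
    (by rw [abs_mul, hc, mul_one, abs_of_nonneg (by positivity)]; linarith)
  have h_chernoff := measureReal_sum_ge_le_exp (f := fun i ω => c * (Y i ω ^ 2 - 1))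
    (lam := lam) (b := 512 * lam ^ 2) (hind.comp (fun _ x => c * (x ^ 2 - 1)) fun _ => hφ)
    (fun i => hφ.comp (hmeas i)) (by positivity) J
    (fun i => by simpa only [mul_assoc] using (hmgf i).1)
    (fun i => by simpa only [mgf, mul_assoc, mul_pow, ← sq_abs c, hc, one_pow, mul_one]
      using (hmgf i).2) (n * s)
  simp_rw [Finset.mul_sum]
  refine h_chernoff.trans (Real.exp_le_exp.2 ?_)
  calc -lam * (n * s) + J.card * (512 * lam ^ 2) ≤ -lam * (n * s) + n * (512 * lam ^ 2) := by
        gcongr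
    _ = -(n * s ^ 2 / 4096) - n * s ^ 2 / 8192 := by rw [hlam]; ring
    _ ≤ -(n * s ^ 2 / 4096) := sub_le_self _ (by positivity)

theorem measureReal_abs_sum_sq_sub_one_gt_le {Y : ι → Ω → ℝ} (hind : iIndepFun Y P)
    (hmeas : ∀ i, Measurable (Y i)) (hsub : ∀ i, HasSubgaussianMGF (Y i) 1 P)
    (h2 : ∀ i, ∫ ω, Y i ω ^ 2 ∂P = 1) {J : Finset ι} (hJ : J.card ≤ n) (hs0 : 0 ≤ s)
    (hs : s ≤ 256) :
    P.real {ω | n * s < |∑ j ∈ J, (Y j ω ^ 2 - 1)|} ≤ 2 * Real.exp (-(n * s ^ 2 / 4096)) := by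
  have := hind.isProbabilityMeasure
  have h_tail {c : ℝ} (hc : |c| = 1) :=
    measureReal_mul_sum_sq_sub_one_ge_le hind hmeas hsub h2 hJ hs0 hs hc
  have h_sub : {ω | n * s < |∑ j ∈ J, (Y j ω ^ 2 - 1)|} ⊆
      {ω | n * s ≤ 1 * ∑ j ∈ J, (Y j ω ^ 2 - 1)} ∪
        {ω | n * s ≤ -1 * ∑ j ∈ J, (Y j ω ^ 2 - 1)} := by
    intro ω hω
    simp only [Set.mem_ofPred_eq, Set.mem_union, one_mul, neg_mul] at hω ⊢
    exact (lt_abs.1 hω).imp le_of_lt le_of_lt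
  calc _ ≤ _ := measureReal_mono h_sub
    _ ≤ _ := measureReal_union_le _ _
    _ ≤ _ := add_le_add (h_tail abs_one) (h_tail (by rw [abs_neg, abs_one]))
    _ = _ := (two_mul _).symm

theorem measureReal_abs_sum_inner_sq_gt_le {u : ι → Ω → EuclideanSpace ℝ (Fin d)}
    (hu : ∀ i, IsIsotropic P (u i)) (hind : iIndepFun u P) (w : EuclideanSpace ℝ (Fin d))
    {J : Finset ι} (hJ : J.card ≤ n) (hs0 : 0 ≤ s) (hs : s ≤ 256) :
    P.real {ω | n * s * ‖w‖ ^ 2 < |∑ j ∈ J, (inner ℝ w (u j ω) ^ 2 - ‖w‖ ^ 2)|} ≤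
      2 * Real.exp (-(n * s ^ 2 / 4096)) := by
  have := hind.isProbabilityMeasure
  rcases eq_or_ne w 0 with rfl | hw
  · simp only [norm_zero, inner_zero_left, sub_self, Finset.sum_const_zero, abs_zero, ne_eq,
      OfNat.ofNat_ne_zero, not_false_eq_true, zero_pow, mul_zero, lt_self_iff_false,
      Set.ofPred_false, measureReal_empty]
    positivity
  set e := ‖w‖⁻¹ • w with he
  have he1 : ‖e‖ = 1 := norm_smul_inv_norm (𝕜 := ℝ) hw
  have h_scale (ω : Ω) : ∑ j ∈ J, (inner ℝ w (u j ω) ^ 2 - ‖w‖ ^ 2) =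
      ‖w‖ ^ 2 * ∑ j ∈ J, (inner ℝ e (u j ω) ^ 2 - 1) := by
    rw [Finset.mul_sum]
    refine Finset.sum_congr rfl fun j _ => ?_
    have := norm_pos_iff.2 hw
    rw [he, real_inner_smul_left]
    field_simp
  refine le_trans (measureReal_mono fun ω hω => ?_)
    (measureReal_abs_sum_sq_sub_one_gt_le (Y := fun j ω => inner ℝ e (u j ω))
      (hind.comp (fun _ x => inner ℝ e x) fun _ => by fun_prop)
      (fun j => (hu j).measurable_inner e) (fun j => (hu j).subgaussian_inner he1)
      (fun j => by rw [(hu j).integral_inner_sq, he1, one_pow]) hJ hs0 hs)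
  simp only [Set.mem_ofPred_eq, h_scale] at hω ⊢
  rw [abs_mul, abs_of_nonneg (sq_nonneg ‖w‖), mul_comm] at hω
  exact lt_of_mul_lt_mul_left hω (sq_nonneg _)

theorem measureReal_prodMk_mem_le_of_indepFun [IsProbabilityMeasure P] {α β : Type*}
    [MeasurableSpace α] [MeasurableSpace β] {X : Ω → α} {Z : Ω → β} (hX : Measurable X)
    (hZ : Measurable Z) (hXZ : IndepFun X Z P) {B : Set (α × β)} (hB : MeasurableSet B) {c : ℝ}
    (hc : 0 ≤ c) (h : ∀ x, P.real {ω | (x, Z ω) ∈ B} ≤ c) :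
    P.real {ω | (X ω, Z ω) ∈ B} ≤ c := by
  refine ENNReal.toReal_le_of_le_ofReal hc ?_
  have := Measure.isProbabilityMeasure_map (μ := P) hX.aemeasurable
  calc P {ω | (X ω, Z ω) ∈ B} = P.map (fun ω => (X ω, Z ω)) B :=
        (Measure.map_apply (hX.prodMk hZ) hB).symm
    _ = ∫⁻ x, P.map Z (Prod.mk x ⁻¹' B) ∂P.map X := by
        rw [(indepFun_iff_map_prod_eq_prod_map_map hX.aemeasurable hZ.aemeasurable).1 hXZ,
          Measure.prod_apply hB]
    _ ≤ ∫⁻ _, ENNReal.ofReal c ∂P.map X := by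
        refine lintegral_mono fun x => ?_
        rw [Measure.map_apply hZ (measurable_prodMk_left hB)]
        exact (ENNReal.le_ofReal_iff_toReal_le (measure_ne_top _ _) hc).2 (h x)
    _ = ENNReal.ofReal c := by rw [lintegral_const, measure_univ, mul_one]

theorem measureReal_abs_sum_inner_sq_gt_le_of_notMem {u : ι → Ω → EuclideanSpace ℝ (Fin d)}
    (hu : ∀ i, IsIsotropic P (u i)) (hind : iIndepFun u P) {J : Finset ι} {i : ι} (hi : i ∉ J)
    (hJ : J.card ≤ n) (hs0 : 0 ≤ s) (hs : s ≤ 256) :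
    P.real {ω | n * s * ‖u i ω‖ ^ 2 <
        |∑ j ∈ J, (inner ℝ (u i ω) (u j ω) ^ 2 - ‖u i ω‖ ^ 2)|} ≤
      2 * Real.exp (-(n * s ^ 2 / 4096)) := by
  have := hind.isProbabilityMeasure
  have hm (i : ι) : Measurable (u i) := (hu i).measurable
  let Z : Ω → (J → EuclideanSpace ℝ (Fin d)) := fun ω j => u j ω
  have h_indep : IndepFun (u i) Z P :=
    (hind.indepFun_finset {i} J (Finset.disjoint_singleton_left.2 hi) hm).comp
      (φ := fun z : ({i} : Finset ι) → EuclideanSpace ℝ (Fin d) =>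
        z ⟨i, Finset.mem_singleton_self i⟩) (ψ := id) (by fun_prop) measurable_id
  let B : Set (EuclideanSpace ℝ (Fin d) × (J → EuclideanSpace ℝ (Fin d))) :=
    {p | n * s * ‖p.1‖ ^ 2 < |∑ j, (inner ℝ p.1 (p.2 j) ^ 2 - ‖p.1‖ ^ 2)|}
  have hB : MeasurableSet B := measurableSet_lt (by fun_prop) (by fun_prop)
  have h_mem (w : EuclideanSpace ℝ (Fin d)) (ω : Ω) : (w, Z ω) ∈ B ↔
      n * s * ‖w‖ ^ 2 < |∑ j ∈ J, (inner ℝ w (u j ω) ^ 2 - ‖w‖ ^ 2)| := by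
    rw [← Finset.sum_coe_sort J]
    rfl
  simp_rw [← h_mem]
  refine measureReal_prodMk_mem_le_of_indepFun (hm i) (by fun_prop) h_indep hB (by positivity)
    fun w => ?_
  simp_rw [h_mem]
  exact measureReal_abs_sum_inner_sq_gt_le hu hind w hJ hs0 hs

theorem measureReal_abs_weight_gt_le {u : Ω → EuclideanSpace ℝ (Fin d)} (hu : IsIsotropic P u)
    (hd : 0 < d) (t : ℝ) :
    P.real {ω | 32 * √d * t < |‖u ω‖ ^ 2 - d|} ≤ 6 * Real.exp (-t) := by
  have := hu.isProbabilityMeasure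
  obtain ⟨h_int, h_le⟩ := hu.integrable_exp_abs_weight hd
  have h_markov := mul_meas_ge_le_integral_of_nonneg
    (.of_forall fun ω => (Real.exp_pos (|‖u ω‖ ^ 2 - d| / (32 * √d))).le) h_int (Real.exp t)
  have h_sub : P.real {ω | 32 * √d * t < |‖u ω‖ ^ 2 - d|} ≤
      P.real {ω | Real.exp t ≤ Real.exp (|‖u ω‖ ^ 2 - d| / (32 * √d))} := by
    refine measureReal_mono fun ω hω => ?_
    rw [Set.mem_ofPred_eq, Real.exp_le_exp, le_div_iff₀' (by positivity)]
    exact le_of_lt hω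
  rw [Real.exp_neg, ← div_eq_mul_inv, le_div_iff₀' (Real.exp_pos _)]
  exact (mul_le_mul_of_nonneg_left h_sub (Real.exp_pos _).le).trans (h_markov.trans h_le)

theorem sq_mul_sq_mul_exp_le {a y δ : ℝ} (hδ : 0 < δ) :
    a ^ 2 * (y ^ 4 * Real.exp (y ^ 2 / 16)) ≤
      δ / 2 * (32 ^ 4 * 24 * Real.exp (|a| / (32 * √δ)) + 8 ^ 4 * 24 * Real.exp (y ^ 2 / 4)) := by
  have h_pow_four {x : ℝ} (hx : 0 ≤ x) : x ^ 4 ≤ 24 * Real.exp x := by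
    have h := Real.pow_div_factorial_le_exp x hx 4
    norm_num [Nat.factorial] at h
    linarith
  have h_sqrt : √δ ^ 4 = δ ^ 2 := by rw [show 4 = 2 * 2 by norm_num, pow_mul, Real.sq_sqrt hδ.le]
  have ha : a ^ 4 = 32 ^ 4 * δ ^ 2 * (|a| / (32 * √δ)) ^ 4 := by
    rw [div_pow, mul_pow, h_sqrt, Even.pow_abs (by decide)]
    field_simp
  have h_exp_sq : Real.exp (y ^ 2 / 16) ^ 2 = Real.exp (y ^ 2 / 8) := by
    rw [← Real.exp_nat_mul]; push_cast; ring_nf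
  have h_exp_mul : Real.exp (y ^ 2 / 8) * Real.exp (y ^ 2 / 8) = Real.exp (y ^ 2 / 4) := by
    rw [← Real.exp_add]; ring_nf
  set E := Real.exp (y ^ 2 / 16)
  have h_young : a ^ 2 * (y ^ 4 * E) ≤ 1 / 2 * (a ^ 4 / δ + δ * (y ^ 8 * E ^ 2)) := by
    have h_sq : 0 ≤ 1 / δ * (a ^ 2 - δ * (y ^ 4 * E)) ^ 2 := by positivity
    have h_expand : 1 / δ * (a ^ 2 - δ * (y ^ 4 * E)) ^ 2 =
        a ^ 4 / δ - 2 * (a ^ 2 * (y ^ 4 * E)) + δ * (y ^ 8 * E ^ 2) := by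
      field_simp; ring
    linarith
  calc a ^ 2 * (y ^ 4 * E) ≤ 1 / 2 * (a ^ 4 / δ + δ * (y ^ 8 * E ^ 2)) := h_young
    _ = δ / 2 * (32 ^ 4 * (|a| / (32 * √δ)) ^ 4 +
          8 ^ 4 * ((y ^ 2 / 8) ^ 4 * Real.exp (y ^ 2 / 8))) := by
        rw [ha, h_exp_sq]; field_simp
    _ ≤ δ / 2 * (32 ^ 4 * (24 * Real.exp (|a| / (32 * √δ))) +
          8 ^ 4 * ((24 * Real.exp (y ^ 2 / 8)) * Real.exp (y ^ 2 / 8))) := by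
        gcongr <;> exact h_pow_four (by positivity)
    _ = _ := by rw [mul_assoc 24, h_exp_mul]; ring

/- The weight is bounded below by `-d`, so the upper tail of minus the weighted square is
exponential and a Bernstein-type bound of the moment generating function is available. -/
theorem mgf_neg_weight_inner_sq_le {u : Ω → EuclideanSpace ℝ (Fin d)} (hu : IsIsotropic P u)
    (hd : 0 < d) {e : EuclideanSpace ℝ (Fin d)} (he : ‖e‖ = 1) {m lam : ℝ} (hlam0 : 0 ≤ lam)
    (hlam : lam * d ≤ 1 / 16) (hm : m ≤ ∫ ω, (‖u ω‖ ^ 2 - d) * inner ℝ e (u ω) ^ 2 ∂P) :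
    Integrable (fun ω => Real.exp (lam * -((‖u ω‖ ^ 2 - d) * inner ℝ e (u ω) ^ 2))) P ∧
      mgf (fun ω => -((‖u ω‖ ^ 2 - d) * inner ℝ e (u ω) ^ 2)) P lam ≤
        Real.exp (lam * -m + lam ^ 2 * (10 ^ 9 * d)) := by
  have := hu.isProbabilityMeasure
  have hd' : (0 : ℝ) < d := by positivity
  obtain ⟨ha_int, ha_le⟩ := hu.integrable_exp_abs_weight hd
  obtain ⟨hy_int, hy_le⟩ := integrable_exp_sq_of_hasSubgaussianMGF (hu.subgaussian_inner he)
  refine mgf_le_exp_of_sq_mul_exp_le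
    (g := fun ω => d / 2 * (32 ^ 4 * 24 * Real.exp (|‖u ω‖ ^ 2 - d| / (32 * √d)) +
      8 ^ 4 * 24 * Real.exp (inner ℝ e (u ω) ^ 2 / 4))) hlam0
    (hu.integrable_weight_inner_sq e).neg (by rw [integral_neg]; exact neg_le_neg hm)
    (((ha_int.const_mul _).add (hy_int.const_mul _)).const_mul _) (fun ω => ?_) ?_
  · have h_max : max (-((‖u ω‖ ^ 2 - d) * inner ℝ e (u ω) ^ 2)) 0 ≤ d * inner ℝ e (u ω) ^ 2 :=
      max_le (by nlinarith [sq_nonneg (‖u ω‖ * inner ℝ e (u ω))]) (by positivity)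
    have h_exp : lam * max (-((‖u ω‖ ^ 2 - d) * inner ℝ e (u ω) ^ 2)) 0 ≤
        inner ℝ e (u ω) ^ 2 / 16 := by
      calc lam * max (-((‖u ω‖ ^ 2 - d) * inner ℝ e (u ω) ^ 2)) 0
          ≤ lam * (d * inner ℝ e (u ω) ^ 2) := by gcongr
        _ = lam * d * inner ℝ e (u ω) ^ 2 := by ring
        _ ≤ 1 / 16 * inner ℝ e (u ω) ^ 2 := by gcongr
        _ = inner ℝ e (u ω) ^ 2 / 16 := by ring
    refine (mul_le_mul_of_nonneg_left (Real.exp_le_exp.2 h_exp) (sq_nonneg _)).trans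
      (le_of_eq_of_le ?_ (sq_mul_sq_mul_exp_le hd'))
    ring
  · rw [integral_const_mul, integral_add (ha_int.const_mul _) (hy_int.const_mul _),
      integral_const_mul, integral_const_mul]
    nlinarith

theorem measureReal_sum_weight_inner_sq_lt_le [Fintype ι]
    {u : ι → Ω → EuclideanSpace ℝ (Fin d)} (hn : Fintype.card ι = n)
    (hu : ∀ i, IsIsotropic P (u i)) (hind : iIndepFun u P) (hd : 0 < d)
    {w : EuclideanSpace ℝ (Fin d)}
    (hw : ∀ i, 2 * ‖w‖ ^ 2 ≤ ∫ ω, (‖u i ω‖ ^ 2 - d) * inner ℝ w (u i ω) ^ 2 ∂P) :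
    P.real {ω | ∑ i, (‖u i ω‖ ^ 2 - d) * inner ℝ w (u i ω) ^ 2 < 3 / 2 * n * ‖w‖ ^ 2} ≤
      Real.exp (-(n / (16 * 10 ^ 9 * d))) := by
  have := hind.isProbabilityMeasure
  rcases eq_or_ne w 0 with rfl | hw0
  · simp only [norm_zero, inner_zero_left, ne_eq, OfNat.ofNat_ne_zero, not_false_eq_true, zero_pow,
      mul_zero, Finset.sum_const_zero, lt_self_iff_false, Set.ofPred_false, measureReal_empty]
    positivity
  have hw_pos : 0 < ‖w‖ ^ 2 := by positivity
  set e := ‖w‖⁻¹ • w with he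
  have h_scale (i : ι) (ω : Ω) : (‖u i ω‖ ^ 2 - d) * inner ℝ w (u i ω) ^ 2 =
      ‖w‖ ^ 2 * ((‖u i ω‖ ^ 2 - d) * inner ℝ e (u i ω) ^ 2) := by
    rw [he, real_inner_smul_left]
    field_simp
  set lam : ℝ := 1 / (4 * 10 ^ 9 * d) with hlam
  have hlam_d : lam * d ≤ 1 / 16 := by rw [hlam]; field_simp; norm_num
  have hmgf (i : ι) := mgf_neg_weight_inner_sq_le (hu i) hd (m := 2) (lam := lam)
    (norm_smul_inv_norm (𝕜 := ℝ) hw0) (by positivity) hlam_d (by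
      have h := hw i
      simp_rw [h_scale] at h
      rw [integral_const_mul, mul_comm] at h
      exact le_of_mul_le_mul_left h hw_pos)
  have hφ : Measurable fun v : EuclideanSpace ℝ (Fin d) => -((‖v‖ ^ 2 - d) * inner ℝ e v ^ 2) := by
    fun_prop
  refine le_trans (measureReal_mono fun ω hω => ?_) ((measureReal_sum_ge_le_exp
    (hind.comp (fun _ => _) fun _ => hφ) (fun i => hφ.comp (hu i).measurable) (by positivity)
    Finset.univ (fun i => (hmgf i).1) (fun i => (hmgf i).2) (-(3 / 2 * n))).trans_eq ?_)
  · simp only [Set.mem_ofPred_eq, Function.comp_apply, Finset.sum_neg_distrib] at hω ⊢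
    simp_rw [h_scale] at hω
    rw [← Finset.mul_sum, mul_comm] at hω
    exact neg_le_neg (lt_of_mul_lt_mul_right hω hw_pos.le).le
  · rw [Finset.card_univ, hn, hlam]
    congr 1
    field_simp
    ring

theorem exp_half_add_le (x y : ℝ) :
    Real.exp ((x + y) / 2) ≤ (Real.exp x + Real.exp y) / 2 := by
  have h := convexOn_exp.2 (Set.mem_univ x) (Set.mem_univ y) one_half_pos.le one_half_pos.le
    (add_halves 1)
  simp only [smul_eq_mul] at h
  calc Real.exp ((x + y) / 2) = Real.exp (1 / 2 * x + 1 / 2 * y) := by congr 1; ring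
    _ ≤ 1 / 2 * Real.exp x + 1 / 2 * Real.exp y := h
    _ = (Real.exp x + Real.exp y) / 2 := by ring

theorem exp_sqrt_abs_mul_le {a b y z : ℝ} (ha : 0 ≤ a) (hb : |b| ≤ a * (|y| * |z| / 4)) :
    Real.exp √|b| ≤
      1 / 2 * Real.exp a + 1 / 4 * (Real.exp (y ^ 2 / 4) + Real.exp (z ^ 2 / 4)) := by
  set q := (y ^ 2 / 4 + z ^ 2 / 4) / 2 with hq
  have h_young : |y| * |z| / 4 ≤ q := by
    nlinarith [sq_nonneg (|y| - |z|), sq_abs y, sq_abs z]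
  have h_sqrt : √|b| ≤ (a + q) / 2 := by
    refine Real.sqrt_le_iff.2 ⟨by positivity, hb.trans ?_⟩
    calc a * (|y| * |z| / 4) ≤ a * q := by gcongr
      _ ≤ ((a + q) / 2) ^ 2 := by nlinarith [sq_nonneg (a - q)]
  linarith [Real.exp_le_exp.2 h_sqrt, exp_half_add_le a q, exp_half_add_le (y ^ 2 / 4) (z ^ 2 / 4)]

theorem integrable_exp_sqrt_weight_mul {u : Ω → EuclideanSpace ℝ (Fin d)} (hu : IsIsotropic P u)
    (hd : 0 < d) (l l' : Fin d) {c : ℝ} (hc : |c| ≤ 1) :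
    Integrable (fun ω => Real.exp √|c * ((‖u ω‖ ^ 2 - d) * (u ω l * u ω l')) / (128 * √d)|) P ∧
      ∫ ω, Real.exp √|c * ((‖u ω‖ ^ 2 - d) * (u ω l * u ω l')) / (128 * √d)| ∂P ≤ 4 := by
  have := hu.isProbabilityMeasure
  have h_bound (ω : Ω) : Real.exp √|c * ((‖u ω‖ ^ 2 - d) * (u ω l * u ω l')) / (128 * √d)| ≤
      1 / 2 * Real.exp (|‖u ω‖ ^ 2 - d| / (32 * √d)) +
        1 / 4 * (Real.exp (u ω l ^ 2 / 4) + Real.exp (u ω l' ^ 2 / 4)) := by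
    refine exp_sqrt_abs_mul_le (by positivity) ?_
    have hd' : (0 : ℝ) < 128 * √d := by positivity
    rw [abs_div, abs_mul, abs_mul, abs_mul, abs_of_pos hd']
    calc |c| * (|‖u ω‖ ^ 2 - d| * (|u ω l| * |u ω l'|)) / (128 * √d)
        ≤ 1 * (|‖u ω‖ ^ 2 - d| * (|u ω l| * |u ω l'|)) / (128 * √d) := by gcongr
      _ = |‖u ω‖ ^ 2 - d| / (32 * √d) * (|u ω l| * |u ω l'| / 4) := by field_simp; ring
  obtain ⟨ha_int, ha_le⟩ := hu.integrable_exp_abs_weight hd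
  obtain ⟨hl_int, hl_le⟩ := integrable_exp_sq_of_hasSubgaussianMGF (hu.subgaussian l)
  obtain ⟨hl'_int, hl'_le⟩ := integrable_exp_sq_of_hasSubgaussianMGF (hu.subgaussian l')
  have h_dom := (ha_int.const_mul (1 / 2)).add ((hl_int.add hl'_int).const_mul (1 / 4))
  have h_meas : Measurable fun ω =>
      Real.exp √|c * ((‖u ω‖ ^ 2 - d) * (u ω l * u ω l')) / (128 * √d)| := by
    have := hu.measurable
    fun_prop
  have h_int := h_dom.mono' h_meas.aestronglyMeasurable
    (.of_forall fun ω => by rw [Real.norm_eq_abs, Real.abs_exp]; exact h_bound ω)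
  refine ⟨h_int, (integral_mono h_int h_dom h_bound).trans ?_⟩
  rw [integral_add' (ha_int.const_mul _) ((hl_int.add hl'_int).const_mul _), integral_const_mul,
    integral_const_mul, integral_add' hl_int hl'_int]
  linarith

theorem measureReal_sum_weight_mul_ge_le [Fintype ι] {u : ι → Ω → EuclideanSpace ℝ (Fin d)}
    (hn : Fintype.card ι = n) (hn0 : n ≠ 0) (hu : ∀ i, IsIsotropic P (u i)) (hind : iIndepFun u P)
    (hd : 0 < d) (l l' : Fin d) {κ c m : ℝ} (hκ : 1 ≤ κ)
    (hsmall : logRate n * ((κ + 1) * Real.log n) ^ 2 ≤ 1) (hc : |c| ≤ 1)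
    (hm : ∀ i, c * ∫ ω, (‖u i ω‖ ^ 2 - d) * (u i ω l * u i ω l') ∂P ≤ m) :
    P.real {ω | n * (m + 128 * √d * ((288 + κ) * logRate n)) ≤
        c * ∑ i, (‖u i ω‖ ^ 2 - d) * (u i ω l * u i ω l')} ≤
      (Real.exp 32 + 4) * (n : ℝ) ^ (-κ) := by
  have := hind.isProbabilityMeasure
  have hd' : (0 : ℝ) < 128 * √d := by positivity
  let φ (v : EuclideanSpace ℝ (Fin d)) : ℝ := c * ((‖v‖ ^ 2 - d) * (v l * v l')) / (128 * √d)
  have hφ : Measurable φ := by fun_prop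
  have hφ_int (i : ι) := integrable_exp_sqrt_weight_mul (hu i) hd l l' hc
  have hφ_mean (i : ι) : ∫ ω, φ (u i ω) ∂P ≤ m / (128 * √d) := by
    rw [integral_div, integral_const_mul]
    exact div_le_div_of_nonneg_right (hm i) hd'.le
  have h_tail := measureReal_sum_ge_le_of_exp_sqrt hn hn0
    (hind.comp (fun _ => φ) fun _ => hφ) (fun i => hφ.comp (hu i).measurable) hκ
    (fun i => (hφ_int i).1) (fun i => (hφ_int i).2) hφ_mean hsmall
  norm_num only at h_tail
  refine le_trans (measureReal_mono fun ω hω => ?_) h_tail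
  simp only [Set.mem_ofPred_eq, Function.comp_apply, φ] at hω ⊢
  rw [← Finset.sum_div, ← Finset.mul_sum, le_div_iff₀ hd']
  refine le_of_eq_of_le ?_ hω
  field_simp

end Deviations

section NormalizedForms

variable {E : Type*} [NormedAddCommGroup E] [NormedSpace ℝ E] {B : LinearMap.BilinForm ℝ E}

theorem norm_sq_mul_bilinForm_self_normalize (B : LinearMap.BilinForm ℝ E) (v : E) :
    ‖v‖ ^ 2 * B (‖v‖⁻¹ • v) (‖v‖⁻¹ • v) = B v v := by
  rcases eq_or_ne v 0 with rfl | hv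
  · simp
  · simp only [map_smul, LinearMap.smul_apply, smul_eq_mul]
    field_simp [norm_ne_zero_iff.2 hv]

theorem mul_norm_sq_le_bilinForm_self {c : ℝ} {v : E}
    (h : ∀ a : ℝ, ‖a • v‖ = 1 → c ≤ B (a • v) (a • v)) : c * ‖v‖ ^ 2 ≤ B v v := by
  rcases eq_or_ne v 0 with rfl | hv
  · simp
  rw [← norm_sq_mul_bilinForm_self_normalize B v, mul_comm c]
  gcongr
  exact h _ (norm_smul_inv_norm (𝕜 := ℝ) hv)

theorem abs_bilinForm_self_sub_norm_sq_le {c : ℝ} {v : E}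
    (h : ∀ a : ℝ, ‖a • v‖ = 1 → |B (a • v) (a • v) - 1| ≤ c) :
    |B v v - ‖v‖ ^ 2| ≤ c * ‖v‖ ^ 2 := by
  have hlower := mul_norm_sq_le_bilinForm_self (B := B) (c := 1 - c) (v := v) fun a ha => by
    linarith [(abs_le.1 (h a ha)).1]
  have hupper := mul_norm_sq_le_bilinForm_self (B := -B) (c := -(1 + c)) (v := v) fun a ha => by
    simp only [LinearMap.neg_apply]
    linarith [(abs_le.1 (h a ha)).2]
  simp only [LinearMap.neg_apply] at hupper
  rw [abs_le]
  constructor <;> linarith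

end NormalizedForms

section BilinearForms

variable {E : Type*} [NormedAddCommGroup E] [InnerProductSpace ℝ E]
  {B G A H : LinearMap.BilinForm ℝ E}

theorem abs_bilinForm_le_of_abs_self_le (hB : B.IsSymm) {K : ℝ}
    (hK : ∀ v, |B v v| ≤ K * ‖v‖ ^ 2) (v w : E) : |B v w| ≤ K * (‖v‖ * ‖w‖) := by
  rcases eq_or_ne v 0 with rfl | hv
  · simp
  rcases eq_or_ne w 0 with rfl | hw
  · simp
  have hvw : 0 < ‖v‖ * ‖w‖ := mul_pos (norm_pos_iff.2 hv) (norm_pos_iff.2 hw)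
  set x := ‖w‖ • v with hx
  set y := ‖v‖ • w with hy
  have polarization : B (x + y) (x + y) - B (x - y) (x - y) = 4 * (‖v‖ * ‖w‖ * B v w) := by
    simp only [hx, hy, map_add, map_sub, map_smul, LinearMap.add_apply, LinearMap.sub_apply,
      LinearMap.smul_apply, smul_eq_mul, hB.eq w v]
    ring
  have parallelogram : ‖x + y‖ ^ 2 + ‖x - y‖ ^ 2 = 4 * (‖v‖ * ‖w‖) ^ 2 := by
    rw [parallelogram_law_with_norm ℝ x y, hx, hy, norm_smul, norm_smul, norm_norm, norm_norm]
    ring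
  have hscaled : ‖v‖ * ‖w‖ * |B v w| ≤ K * (‖v‖ * ‖w‖) ^ 2 := by
    have hadd := hK (x + y)
    have hsub := hK (x - y)
    have htri := abs_sub (B (x + y) (x + y)) (B (x - y) (x - y))
    rw [polarization, abs_mul, abs_mul, abs_of_pos hvw, abs_of_pos (four_pos (α := ℝ))] at htri
    linear_combination (htri + hadd + hsub + K * parallelogram) / 4
  refine le_of_mul_le_mul_left (hscaled.trans_eq ?_) hvw
  ring

theorem abs_bilinForm_self_sub_self_le (hB : B.IsSymm) {K : ℝ}
    (hK : ∀ v w, |B v w| ≤ K * (‖v‖ * ‖w‖)) (v p : E) :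
    |B v v - B p p| ≤ K * (‖v - p‖ * ‖v + p‖) := by
  have hfactor : B v v - B p p = B (v - p) (v + p) := by
    simp only [map_add, map_sub, LinearMap.sub_apply, hB.eq p v]
    ring
  rw [hfactor]
  exact hK _ _

theorem norm_sub_le_of_bilinForm_eq_inner {η : ℝ} (hη0 : 0 ≤ η)
    (hG : ∀ v w, |G v w - inner ℝ v w| ≤ η * (‖v‖ * ‖w‖)) {x p : E}
    (hp : ∀ z, G p z = inner ℝ x z) : ‖p - x‖ ≤ η * ‖p‖ := by
  have hsq : ‖p - x‖ * ‖p - x‖ ≤ η * ‖p‖ * ‖p - x‖ :=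
    calc ‖p - x‖ * ‖p - x‖ = -(G p (p - x) - inner ℝ p (p - x)) := by
          rw [hp, ← real_inner_self_eq_norm_mul_norm, inner_sub_left]
          ring
      _ ≤ η * (‖p‖ * ‖p - x‖) := (neg_le_abs _).trans (hG p (p - x))
      _ = η * ‖p‖ * ‖p - x‖ := (mul_assoc _ _ _).symm
  rcases (norm_nonneg (p - x)).eq_or_lt with hzero | hpos
  · rw [← hzero]
    positivity
  · exact le_of_mul_le_mul_right hsq hpos

theorem abs_inner_sub_norm_sq_le {η ε R : ℝ} (hη0 : 0 ≤ η) (hη2 : η ≤ 1 / 2)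
    (hG : ∀ v w, |G v w - inner ℝ v w| ≤ η * (‖v‖ * ‖w‖)) {x p : E}
    (hp : ∀ z, G p z = inner ℝ x z) (hx : |G x x - ‖x‖ ^ 2| ≤ ε) (hR : ‖x‖ ^ 2 ≤ R) :
    |inner ℝ x p - ‖x‖ ^ 2| ≤ ε + 2 * η ^ 2 * R := by
  have hpx : ‖p - x‖ ≤ η * ‖p‖ := norm_sub_le_of_bilinForm_eq_inner hη0 hG hp
  have hpnorm : ‖p‖ ≤ 2 * ‖x‖ := by
    have htri : ‖p‖ ≤ ‖p - x‖ + ‖x‖ := norm_le_norm_sub_add p x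
    have hhalf : η * ‖p‖ ≤ 1 / 2 * ‖p‖ := by gcongr
    linarith
  have hsecond_order : |G (p - x) x - inner ℝ (p - x) x| ≤ 2 * η ^ 2 * R :=
    calc |G (p - x) x - inner ℝ (p - x) x| ≤ η * (‖p - x‖ * ‖x‖) := hG _ _
      _ ≤ η * (η * (2 * ‖x‖) * ‖x‖) := by
          gcongr
          exact hpx.trans (by gcongr)
      _ = 2 * η ^ 2 * ‖x‖ ^ 2 := by ring
      _ ≤ 2 * η ^ 2 * R := by gcongr
  have hexpand : inner ℝ x p - ‖x‖ ^ 2 =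
      -(G x x - ‖x‖ ^ 2) - (G (p - x) x - inner ℝ (p - x) x) := by
    rw [map_sub, LinearMap.sub_apply, hp, inner_sub_left, real_inner_self_eq_norm_sq,
      real_inner_comm p x]
    ring
  rw [hexpand]
  refine (abs_sub _ _).trans ?_
  rw [abs_neg]
  exact add_le_add hx hsecond_order

section Perturbation

variable {e b q : E} {α l ε : ℝ}

theorem generalizedEigenvalue_le (he : ‖e‖ = 1) (hε : ε ≤ 1 / 100)
    (hG : ∀ v w, |G v w - inner ℝ v w| ≤ ε * (‖v‖ * ‖w‖))
    (hHA : ∀ v w, |H v w - A v w| ≤ 2 * ε * (‖v‖ * ‖w‖)) (hAe : A e e ≤ 1 / 2)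
    (hray : l * G e e ≤ H e e) : l ≤ 3 / 5 := by
  have hGe := (abs_le.1 (hG e e)).1
  have hHe := (abs_le.1 (hHA e e)).2
  rw [real_inner_self_eq_norm_sq, he] at hGe
  rw [he] at hHe
  by_contra! hl
  have : 3 / 5 * (99 / 100) ≤ l * G e e := by
    refine mul_le_mul hl.le ?_ (by norm_num) (by linarith)
    linarith
  linarith

/-
Testing the eigenvalue equation against the orthogonal part `b` gives
`7/5 ‖b‖² - O(ε ‖b‖) ≤ H q b = l * G q b ≤ 3/5 ‖b‖² + O(ε ‖b‖)`.
-/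
theorem norm_orthogonal_part_le (hq : q = α • e + b) (heb : inner ℝ e b = 0) (hqnorm : ‖q‖ ≤ 2)
    (hα : |α| ≤ 2) (hε0 : 0 ≤ ε) (hl : l ≤ 3 / 5)
    (hG : ∀ v w, |G v w - inner ℝ v w| ≤ ε * (‖v‖ * ‖w‖))
    (hHA : ∀ v w, |H v w - A v w| ≤ 2 * ε * (‖v‖ * ‖w‖))
    (hAeb : |A e b| ≤ ε * ‖b‖) (hAb : 7 / 5 * ‖b‖ ^ 2 ≤ A b b) (heig : H q b = l * G q b) :
    ‖b‖ ≤ 20 * ε := by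
  by_contra! hlarge
  have hqb : inner ℝ q b = ‖b‖ ^ 2 := by
    rw [hq, inner_add_left, real_inner_smul_left, heb, real_inner_self_eq_norm_sq, mul_zero,
      zero_add]
  have hnorm_mul : ε * (‖q‖ * ‖b‖) ≤ 2 * (ε * ‖b‖) := by
    rw [mul_left_comm]
    gcongr
  have hGqb := abs_le.1 ((hG q b).trans hnorm_mul)
  rw [hqb] at hGqb
  have hHqb := (abs_le.1 (hHA q b)).1
  have hAqb : 7 / 5 * ‖b‖ ^ 2 - 2 * (ε * ‖b‖) ≤ A q b := by
    have hcross : |α * A e b| ≤ 2 * (ε * ‖b‖) := by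
      rw [abs_mul]
      gcongr
    rw [hq, map_add, map_smul, LinearMap.add_apply, LinearMap.smul_apply, smul_eq_mul]
    linarith [(abs_le.1 hcross).1]
  have hb_pos : 0 < ‖b‖ := by linarith
  have hεb : 20 * (ε * ‖b‖) ≤ ‖b‖ ^ 2 := by
    rw [sq, ← mul_assoc]
    gcongr
  have hGqb0 : 0 ≤ G q b := by nlinarith
  have hlG : l * G q b ≤ 3 / 5 * G q b := by gcongr
  have hb_sq : 0 < ‖b‖ ^ 2 := by positivity
  rw [heig] at hHqb
  linarith

theorem exists_eq_smul_add_of_generalizedEigenvector (he : ‖e‖ = 1) (hε0 : 0 ≤ ε)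
    (hε : ε ≤ 1 / 100) (hG : ∀ v w, |G v w - inner ℝ v w| ≤ ε * (‖v‖ * ‖w‖))
    (hHA : ∀ v w, |H v w - A v w| ≤ 2 * ε * (‖v‖ * ‖w‖)) (hAe : A e e ≤ 1 / 2)
    (hAeb : ∀ b, inner ℝ e b = 0 → |A e b| ≤ ε * ‖b‖)
    (hAb : ∀ b, inner ℝ e b = 0 → 7 / 5 * ‖b‖ ^ 2 ≤ A b b)
    (hq : G q q = 1) (heig : ∀ p, H q p = l * G q p) (hray : ∀ p, l * G p p ≤ H p p) :
    ∃ (α : ℝ) (b : E), q = α • e + b ∧ inner ℝ e b = 0 ∧ ‖b‖ ≤ 20 * ε ∧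
      1 / 2 ≤ α ^ 2 ∧ α ^ 2 ≤ 2 := by
  obtain ⟨α, b, hqe, heb⟩ : ∃ (α : ℝ) (b : E), q = α • e + b ∧ inner ℝ e b = 0 := by
    refine ⟨inner ℝ e q, q - inner ℝ e q • e, by abel, ?_⟩
    rw [inner_sub_right, real_inner_smul_right, real_inner_self_eq_norm_sq, he]
    ring
  have hpythagoras : ‖q‖ ^ 2 = α ^ 2 + ‖b‖ ^ 2 := by
    rw [hqe, norm_add_sq_real, real_inner_smul_left, heb, norm_smul, he, Real.norm_eq_abs,
      mul_one, sq_abs]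
    ring
  have hGq := abs_le.1 (hG q q)
  rw [hq, real_inner_self_eq_norm_sq, ← sq] at hGq
  have hq_lower : 100 / 101 ≤ ‖q‖ ^ 2 := by nlinarith [sq_nonneg ‖q‖]
  have hq_upper : ‖q‖ ^ 2 ≤ 100 / 99 := by nlinarith [sq_nonneg ‖q‖]
  have hα_sq : α ^ 2 ≤ 2 := by nlinarith [sq_nonneg ‖b‖]
  have hb : ‖b‖ ≤ 20 * ε :=
    norm_orthogonal_part_le hqe heb
      ((sq_le_sq₀ (norm_nonneg q) zero_le_two).1 (by linarith))
      (abs_le_of_sq_le_sq (by linarith) zero_le_two) hε0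
      (generalizedEigenvalue_le he hε hG hHA hAe (hray e)) hG hHA (hAeb b heb) (hAb b heb) (heig b)
  have hb_sq : ‖b‖ ^ 2 ≤ (1 / 5) ^ 2 := by
    gcongr
    linarith
  exact ⟨α, b, hqe, heb, hb, by linarith, hα_sq⟩

end Perturbation

end BilinearForms

section WeightedForm

variable {E : Type*} [NormedAddCommGroup E] [InnerProductSpace ℝ E] {ι : Type*} [Fintype ι]

/-- The bilinear form `n⁻¹ ∑ i, c i ⟪u i, v⟫ ⟪u i, w⟫` with `n` the number of indices. For `c = 1`
it is the sample second moment of the `u i`, and for `c i = ‖u i‖² - d` it is the quadratic form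
minimised by the spectral algorithm. -/
noncomputable def weightedForm (c : ι → ℝ) (u : ι → E) : LinearMap.BilinForm ℝ E :=
  (Fintype.card ι : ℝ)⁻¹ • ∑ i, c i • LinearMap.BilinForm.linMulLin (innerₛₗ ℝ (u i))
    (innerₛₗ ℝ (u i))

theorem weightedForm_apply (c : ι → ℝ) (u : ι → E) (v w : E) :
    weightedForm c u v w =
      (Fintype.card ι : ℝ)⁻¹ * ∑ i, c i * (inner ℝ (u i) v * inner ℝ (u i) w) := by
  simp [weightedForm, LinearMap.sum_apply, LinearMap.BilinForm.linMulLin_apply]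

theorem isSymm_weightedForm (c : ι → ℝ) (u : ι → E) : (weightedForm c u).IsSymm :=
  ⟨fun v w => by simp only [weightedForm_apply, mul_comm]⟩

theorem weightedForm_sub (c c' : ι → ℝ) (u : ι → E) :
    weightedForm (c - c') u = weightedForm c u - weightedForm c' u := by
  ext v w
  simp only [LinearMap.sub_apply, weightedForm_apply, Pi.sub_apply, sub_mul,
    Finset.sum_sub_distrib, mul_sub]

theorem weightedForm_one_self (u : ι → E) (v : E) :
    weightedForm 1 u v v = (Fintype.card ι : ℝ)⁻¹ * ∑ i, inner ℝ (u i) v ^ 2 := by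
  simp only [weightedForm_apply, Pi.one_apply, one_mul, sq]

variable {u : ι → E} {c : ι → ℝ}

theorem abs_weightedForm_le {M : ℝ} (hM0 : 0 ≤ M) (hM : ∀ i, |c i| ≤ M) (v w : E) :
    |weightedForm c u v w| ≤ M * (√(weightedForm 1 u v v) * √(weightedForm 1 u w w)) := by
  have hn : (0 : ℝ) ≤ (Fintype.card ι : ℝ)⁻¹ := by positivity
  calc |weightedForm c u v w|
      = (Fintype.card ι : ℝ)⁻¹ * |∑ i, c i * (inner ℝ (u i) v * inner ℝ (u i) w)| := by
        rw [weightedForm_apply, abs_mul, abs_of_nonneg hn]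
    _ ≤ (Fintype.card ι : ℝ)⁻¹ * (M * ∑ i, |inner ℝ (u i) v| * |inner ℝ (u i) w|) := by
        rw [Finset.mul_sum]
        refine mul_le_mul_of_nonneg_left ((Finset.abs_sum_le_sum_abs _ _).trans ?_) hn
        refine Finset.sum_le_sum fun i _ => ?_
        rw [abs_mul, abs_mul]
        exact mul_le_mul_of_nonneg_right (hM i) (by positivity)
    _ ≤ (Fintype.card ι : ℝ)⁻¹ *
          (M * (√(∑ i, |inner ℝ (u i) v| ^ 2) * √(∑ i, |inner ℝ (u i) w| ^ 2))) := by
        gcongr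
        exact Real.sum_mul_le_sqrt_mul_sqrt _ _ _
    _ = M * (√(weightedForm 1 u v v) * √(weightedForm 1 u w w)) := by
        simp only [weightedForm_one_self, sq_abs, Real.sqrt_mul hn]
        linear_combination (-M * √(∑ i, inner ℝ (u i) v ^ 2) * √(∑ i, inner ℝ (u i) w ^ 2)) *
          Real.mul_self_sqrt hn

theorem sqrt_weightedForm_one_self_le {R : ℝ} (hR0 : 0 ≤ R) (hR : ∀ i, ‖u i‖ ^ 2 ≤ R) (v : E) :
    √(weightedForm 1 u v v) ≤ √R * ‖v‖ := by
  rw [Real.sqrt_le_left (by positivity), mul_pow, Real.sq_sqrt hR0, weightedForm_one_self]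
  have hterm : ∀ i, inner ℝ (u i) v ^ 2 ≤ R * ‖v‖ ^ 2 := fun i =>
    calc inner ℝ (u i) v ^ 2 ≤ (‖u i‖ * ‖v‖) ^ 2 := by
          rw [← sq_abs]
          gcongr
          exact abs_real_inner_le_norm _ _
      _ ≤ R * ‖v‖ ^ 2 := by
          rw [mul_pow]
          gcongr
          exact hR i
  refine inv_mul_le_of_le_mul₀ (by positivity) (by positivity) ?_
  simpa using Finset.sum_le_card_nsmul Finset.univ _ _ fun i _ => hterm i

theorem abs_weightedForm_le_of_norm_sq_le {M R : ℝ} (hM0 : 0 ≤ M) (hM : ∀ i, |c i| ≤ M)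
    (hR0 : 0 ≤ R) (hR : ∀ i, ‖u i‖ ^ 2 ≤ R) (v w : E) :
    |weightedForm c u v w| ≤ M * R * (‖v‖ * ‖w‖) := by
  calc |weightedForm c u v w|
      ≤ M * (√(weightedForm 1 u v v) * √(weightedForm 1 u w w)) := abs_weightedForm_le hM0 hM v w
    _ ≤ M * ((√R * ‖v‖) * (√R * ‖w‖)) := by
        gcongr <;> exact sqrt_weightedForm_one_self_le hR0 hR _
    _ = M * R * (‖v‖ * ‖w‖) := by
        linear_combination (M * ‖v‖ * ‖w‖) * Real.mul_self_sqrt hR0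

theorem abs_weightedForm_one_sub_inner_le {η : ℝ}
    (hη : ∀ v, |weightedForm 1 u v v - ‖v‖ ^ 2| ≤ η * ‖v‖ ^ 2) (v w : E) :
    |weightedForm 1 u v w - inner ℝ v w| ≤ η * (‖v‖ * ‖w‖) := by
  have hsymm : (weightedForm 1 u - innerₗ E).IsSymm :=
    ⟨fun v w => by
      simp only [LinearMap.sub_apply, innerₗ_apply_apply,
        (isSymm_weightedForm 1 u).eq v w, real_inner_comm w v]⟩
  simpa only [LinearMap.sub_apply, innerₗ_apply_apply] using
    abs_bilinForm_le_of_abs_self_le hsymm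
      (fun v => by simpa only [LinearMap.sub_apply, innerₗ_apply_apply,
        real_inner_self_eq_norm_sq] using hη v) v w

end WeightedForm

section SignErrors

variable {n : ℕ}

theorem sq_le_sq_of_sgn_ne {s : ℤˣ} {t r : ℝ} (ht : 0 ≤ t)
    (h : sgn (t * ((s : ℤ) : ℝ) + r) ≠ s) : t ^ 2 ≤ r ^ 2 := by
  unfold sgn at h
  rcases Int.units_eq_one_or s with rfl | rfl <;> split_ifs at h with hpos <;>
    push_cast at hpos h <;> first | exact absurd rfl h | nlinarith

theorem sq_le_sq_of_neg_sgn_ne {s : ℤˣ} {t r : ℝ} (ht : t ≤ 0)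
    (h : -sgn (t * ((s : ℤ) : ℝ) + r) ≠ s) : t ^ 2 ≤ r ^ 2 := by
  rw [← neg_sq t]
  refine sq_le_sq_of_sgn_ne (s := -s) (neg_nonneg.2 ht) fun hs => h ?_
  rw [neg_eq_iff_eq_neg, ← hs]
  push_cast
  ring_nf

theorem card_mul_le_sum_sq {ι : Type*} [Fintype ι] (p : ι → Prop) [DecidablePred p] {r : ι → ℝ}
    {a : ℝ} (h : ∀ i, p i → a ≤ r i ^ 2) :
    ((Finset.univ.filter p).card : ℝ) * a ≤ ∑ i, r i ^ 2 := by
  rw [← nsmul_eq_mul]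
  refine (Finset.card_nsmul_le_sum _ (fun i => r i ^ 2) a fun i hi =>
    h i (Finset.mem_filter.1 hi).2).trans ?_
  exact Finset.sum_le_sum_of_subset_of_nonneg (Finset.subset_univ _) fun _ _ _ => sq_nonneg _

theorem misclass_sgn_mul_sq_le (y : Fin n → ℤˣ) (r : Fin n → ℝ) (t : ℝ) :
    misclass (fun i => sgn (t * ((y i : ℤ) : ℝ) + r i)) y * t ^ 2 ≤ (n : ℝ)⁻¹ * ∑ i, r i ^ 2 := by
  rw [misclass, mul_assoc]
  refine mul_le_mul_of_nonneg_left ?_ (by positivity)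
  rcases le_total 0 t with ht | ht
  · exact (mul_le_mul_of_nonneg_right (min_le_left _ _) (sq_nonneg t)).trans
      (card_mul_le_sum_sq _ fun i => sq_le_sq_of_sgn_ne ht)
  · exact (mul_le_mul_of_nonneg_right (min_le_right _ _) (sq_nonneg t)).trans
      (card_mul_le_sum_sq _ fun i => sq_le_sq_of_neg_sgn_ne ht)

end SignErrors

section GridNet

variable {d : ℕ}

/-- The points of the cube `[-1, 1]^d` whose coordinates are multiples of `1 / N`, which form a
`d / N`-net of the unit ball. -/
noncomputable def gridNet (d N : ℕ) : Finset (EuclideanSpace ℝ (Fin d)) :=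
  (Fintype.piFinset fun _ : Fin d => Finset.Icc (-(N : ℤ)) N).image fun g =>
    WithLp.toLp 2 fun k => (g k : ℝ) / N

theorem card_gridNet_le (d N : ℕ) : (gridNet d N).card ≤ (2 * N + 1) ^ d := by
  refine Finset.card_image_le.trans_eq ?_
  rw [Fintype.card_piFinset]
  simp only [Int.card_Icc, Finset.prod_const, Finset.card_univ, Fintype.card_fin]
  congr 1
  omega

theorem norm_le_natCast_mul_of_abs_apply_le {v : EuclideanSpace ℝ (Fin d)} {a : ℝ}
    (h : ∀ k, |v k| ≤ a) : ‖v‖ ≤ d * a := by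
  have hnonneg : 0 ≤ d * a := calc
    (0 : ℝ) ≤ ∑ k, |v k| := Finset.sum_nonneg fun k _ => abs_nonneg (v k)
    _ ≤ ∑ _k : Fin d, a := Finset.sum_le_sum fun k _ => h k
    _ = d * a := by simp only [Finset.sum_const, Finset.card_univ, Fintype.card_fin, nsmul_eq_mul]
  refine abs_le_of_sq_le_sq' ?_ hnonneg |>.2
  calc ‖v‖ ^ 2 = ∑ k, v k ^ 2 := EuclideanSpace.real_norm_sq_eq v
    _ ≤ ∑ _k : Fin d, a ^ 2 :=
      Finset.sum_le_sum fun k _ => sq_le_sq.2 ((h k).trans (le_abs_self a))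
    _ = d * a ^ 2 := by
      simp only [Finset.sum_const, Finset.card_univ, Fintype.card_fin, nsmul_eq_mul]
    _ ≤ d ^ 2 * a ^ 2 :=
      mul_le_mul_of_nonneg_right (mod_cast Nat.le_self_pow two_ne_zero d) (sq_nonneg a)
    _ = (d * a) ^ 2 := (mul_pow _ _ 2).symm

theorem abs_sub_floor_div_le {N : ℕ} (hN : 0 < N) (t : ℝ) : |t - ⌊N * t⌋ / N| ≤ 1 / N := by
  have hN0 : (0 : ℝ) < N := by exact_mod_cast hN
  have hfract : t - ⌊N * t⌋ / N = Int.fract (N * t) / N := by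
    rw [Int.fract]
    field_simp
  rw [hfract, abs_of_nonneg (div_nonneg (Int.fract_nonneg _) hN0.le)]
  exact div_le_div_of_nonneg_right (Int.fract_lt_one _).le hN0.le

theorem exists_mem_gridNet {N : ℕ} (hN : 0 < N) (v : EuclideanSpace ℝ (Fin d)) (hv : ‖v‖ ≤ 1) :
    ∃ p ∈ gridNet d N, ‖v - p‖ ≤ d / N ∧ ∀ k, v k = 0 → p k = 0 := by
  have hvk : ∀ k, |v k| ≤ 1 := fun k => (PiLp.norm_apply_le v k).trans hv
  refine ⟨WithLp.toLp 2 fun k => (⌊N * v k⌋ : ℝ) / N, ?_, ?_, fun k hk => by simp [hk]⟩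
  · refine Finset.mem_image.2 ⟨fun k => ⌊N * v k⌋, Fintype.mem_piFinset.2 fun k => ?_, rfl⟩
    obtain ⟨hlower, hupper⟩ := abs_le.1 (hvk k)
    rw [Finset.mem_Icc, Int.le_floor, ← @Int.cast_le ℝ]
    push_cast
    exact ⟨by nlinarith [N.cast_nonneg (α := ℝ)],
      (Int.floor_le _).trans (mul_le_of_le_one_right N.cast_nonneg hupper)⟩
  · rw [div_eq_mul_one_div]
    exact norm_le_natCast_mul_of_abs_apply_le fun k => abs_sub_floor_div_le hN (v k)

end GridNet

section Whitening

variable {n d : ℕ}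

theorem transpose_invSqrt (A : Matrix (Fin d) (Fin d) ℝ) :
    (invSqrt A).transpose = invSqrt A := by
  rw [← Matrix.conjTranspose_eq_transpose_of_trivial]
  exact cfc_predicate (p := IsSelfAdjoint) _ A

theorem invSqrt_mul_mul_invSqrt {A : Matrix (Fin d) (Fin d) ℝ} (hA : A.PosDef) :
    invSqrt A * A * invSqrt A = 1 := by
  have hsa : IsSelfAdjoint A := hA.isHermitian
  have hpos : ∀ t ∈ spectrum ℝ A, 0 < √t := by
    intro t ht
    rw [hA.isHermitian.spectrum_real_eq_range_eigenvalues] at ht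
    obtain ⟨i, rfl⟩ := ht
    exact Real.sqrt_pos.2 (hA.eigenvalues_pos i)
  have hcont : ContinuousOn (fun t : ℝ => (√t)⁻¹) (spectrum ℝ A) :=
    Real.continuous_sqrt.continuousOn.inv₀ fun t ht => (hpos t ht).ne'
  have hcfc : invSqrt A * A * invSqrt A = cfc (fun t : ℝ => (√t)⁻¹ * t * (√t)⁻¹) A := by
    rw [cfc_mul (fun t : ℝ => (√t)⁻¹ * t) (fun t => (√t)⁻¹) A (hcont.mul continuousOn_id) hcont,
      cfc_mul (fun t : ℝ => (√t)⁻¹) (fun t => t) A hcont continuousOn_id, cfc_id' ℝ A]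
    rfl
  rw [hcfc, cfc_congr (g := fun _ => (1 : ℝ)) fun t ht => ?_, cfc_const_one ℝ A]
  have hsqrt := hpos t ht
  rw [mul_assoc, inv_mul_eq_one₀ hsqrt.ne', eq_mul_inv_iff_mul_eq₀ hsqrt.ne']
  exact Real.mul_self_sqrt (Real.sqrt_pos.1 hsqrt).le

theorem isUnit_invSqrt {A : Matrix (Fin d) (Fin d) ℝ} (hA : A.PosDef) : IsUnit (invSqrt A) :=
  IsUnit.of_mul_eq_one (A * invSqrt A) (by rw [← mul_assoc, invSqrt_mul_mul_invSqrt hA])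

theorem transpose_whiten_mul_whiten {X : Matrix (Fin n) (Fin d) ℝ}
    (hX : (X.transpose * X).PosDef) : (whiten X).transpose * whiten X = (n : ℝ) • 1 := by
  rw [whiten, Matrix.transpose_smul, Matrix.transpose_mul, transpose_invSqrt, Matrix.smul_mul,
    Matrix.mul_smul, smul_smul, Real.mul_self_sqrt n.cast_nonneg, ← invSqrt_mul_mul_invSqrt hX]
  simp only [Matrix.mul_assoc]

theorem inner_toLp_row_eq_mulVec (W : Matrix (Fin n) (Fin d) ℝ) (i : Fin n)
    (t : EuclideanSpace ℝ (Fin d)) : inner ℝ (WithLp.toLp 2 (W i)) t = W.mulVec t.ofLp i := by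
  rw [euclideanSpace_real_inner_eq_sum]
  rfl

theorem weightedForm_one_row {W : Matrix (Fin n) (Fin d) ℝ} (hn : n ≠ 0)
    (hW : W.transpose * W = (n : ℝ) • 1) (t t' : EuclideanSpace ℝ (Fin d)) :
    weightedForm 1 (fun i => WithLp.toLp 2 (W i)) t t' = inner ℝ t t' := by
  have hn0 : (n : ℝ) ≠ 0 := Nat.cast_ne_zero.2 hn
  have hdot : W.mulVec t.ofLp ⬝ᵥ W.mulVec t'.ofLp = n * (t.ofLp ⬝ᵥ t'.ofLp) := by
    rw [Matrix.dotProduct_mulVec, ← Matrix.mulVec_transpose, Matrix.mulVec_mulVec, hW,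
      Matrix.smul_mulVec, Matrix.one_mulVec, smul_dotProduct, smul_eq_mul]
  simp only [weightedForm_apply, Pi.one_apply, one_mul, inner_toLp_row_eq_mulVec, Fintype.card_fin]
  rw [euclideanSpace_real_inner_eq_sum, inv_mul_eq_iff_eq_mul₀ hn0]
  exact hdot

theorem isHermitian_weightedCov (W : Matrix (Fin n) (Fin d) ℝ) : (weightedCov W).IsHermitian := by
  ext i j
  simp only [weightedCov, Matrix.conjTranspose_apply, Matrix.smul_apply, Matrix.sum_apply,
    Matrix.vecMulVec_apply, star_trivial, mul_comm (W _ j)]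

theorem toEuclideanLin_weightedCov_apply (W : Matrix (Fin n) (Fin d) ℝ)
    (t : EuclideanSpace ℝ (Fin d)) :
    Matrix.toEuclideanLin (weightedCov W) t = (n : ℝ)⁻¹ • ∑ i,
      ((∑ j, W i j ^ 2 - d) * inner ℝ (WithLp.toLp 2 (W i)) t) •
        (WithLp.toLp 2 (W i) : EuclideanSpace ℝ (Fin d)) := by
  simp only [inner_toLp_row_eq_mulVec, ← WithLp.toLp_smul, ← WithLp.toLp_sum]
  refine WithLp.ofLp_injective 2 ?_
  rw [Matrix.ofLp_toLpLin, Matrix.toLin'_apply, weightedCov, Matrix.smul_mulVec,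
    Matrix.sum_mulVec]
  congr 1
  refine Finset.sum_congr rfl fun i _ => ?_
  rw [Matrix.smul_mulVec, Matrix.vecMulVec_mulVec, mul_smul, op_smul_eq_smul]
  rfl

theorem inner_toEuclideanLin_weightedCov (W : Matrix (Fin n) (Fin d) ℝ)
    (t t' : EuclideanSpace ℝ (Fin d)) :
    inner ℝ t' (Matrix.toEuclideanLin (weightedCov W) t) =
      weightedForm (fun i => ∑ j, W i j ^ 2 - d) (fun i => WithLp.toLp 2 (W i)) t t' := by
  rw [toEuclideanLin_weightedCov_apply, real_inner_smul_right, inner_sum, weightedForm_apply,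
    Fintype.card_fin]
  simp only [real_inner_smul_right, mul_assoc, real_inner_comm]

theorem mul_inner_self_le_of_isLeast_eigenvalue {S : Matrix (Fin d) (Fin d) ℝ}
    (hS : S.IsHermitian) {l : ℝ}
    (hl : IsLeast {t : ℝ | Module.End.HasEigenvalue (Matrix.toEuclideanLin S) t} l)
    (t : EuclideanSpace ℝ (Fin d)) : l * inner ℝ t t ≤ inner ℝ t (Matrix.toEuclideanLin S t) := by
  have hsymm : (Matrix.toEuclideanLin S).IsSymmetric :=
    Matrix.isSymmetric_toEuclideanLin_iff.2 hS
  set b := hsymm.eigenvectorBasis finrank_euclideanSpace_fin with hb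
  rw [← b.sum_inner_mul_inner t t, ← b.sum_inner_mul_inner t (Matrix.toEuclideanLin S t),
    Finset.mul_sum]
  refine Finset.sum_le_sum fun j _ => ?_
  have hcoord : inner ℝ (b j) (Matrix.toEuclideanLin S t) =
      hsymm.eigenvalues finrank_euclideanSpace_fin j * inner ℝ (b j) t := by
    rw [← hsymm (b j) t, hb, hsymm.apply_eigenvectorBasis, real_inner_smul_left]
    rfl
  have hmin : l ≤ hsymm.eigenvalues finrank_euclideanSpace_fin j :=
    hl.2 (hsymm.hasEigenvalue_eigenvalues finrank_euclideanSpace_fin j)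
  rw [hcoord, real_inner_comm t (b j), mul_left_comm (inner ℝ t (b j))]
  exact mul_le_mul_of_nonneg_right hmin (mul_self_nonneg _)

section LinearImage

variable {x u : Fin n → EuclideanSpace ℝ (Fin d)}
  (T : EuclideanSpace ℝ (Fin d) ≃ₗ[ℝ] EuclideanSpace ℝ (Fin d))

theorem adjoint_linearEquiv_bijective : Function.Bijective (LinearMap.adjoint T.toLinearMap) := by
  refine ⟨Function.LeftInverse.injective (g := LinearMap.adjoint T.symm.toLinearMap) fun v => ?_,
    Function.RightInverse.surjective (g := LinearMap.adjoint T.symm.toLinearMap) fun v => ?_⟩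
  · rw [← LinearMap.comp_apply, ← LinearMap.adjoint_comp]
    simp
  · rw [← LinearMap.comp_apply, ← LinearMap.adjoint_comp]
    simp

variable {T}

theorem posDef_gram_dataMatrix (hx : ∀ i, x i = T (u i))
    (hpos : ∀ v, v ≠ 0 → 0 < weightedForm 1 u v v) :
    ((dataMatrix x).transpose * dataMatrix x).PosDef := by
  rw [← Matrix.conjTranspose_eq_transpose_of_trivial]
  refine Matrix.PosDef.conjTranspose_mul_self _ fun v w hvw => ?_
  set z : EuclideanSpace ℝ (Fin d) := WithLp.toLp 2 (v - w)
  have horth : ∀ i, inner ℝ (u i) (LinearMap.adjoint T.toLinearMap z) = 0 := by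
    intro i
    have hrow : (dataMatrix x).mulVec (v - w) i = 0 := by
      rw [Matrix.mulVec_sub]
      exact congrFun (sub_eq_zero.2 hvw) i
    rw [LinearMap.adjoint_inner_right, LinearEquiv.coe_coe, ← hx, ← hrow,
      ← inner_toLp_row_eq_mulVec]
    rfl
  have hz0 : z = 0 := by
    refine (injective_iff_map_eq_zero _).1 (adjoint_linearEquiv_bijective T).1 z ?_
    by_contra hne
    simpa [weightedForm_one_self, horth] using hpos _ hne
  exact sub_eq_zero.1 ((WithLp.toLp_eq_zero 2).1 hz0)

theorem exists_surjective_inner_row_whiten (hn : n ≠ 0) (hx : ∀ i, x i = T (u i))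
    (hpos : ∀ v, v ≠ 0 → 0 < weightedForm 1 u v v) :
    ∃ k : EuclideanSpace ℝ (Fin d) → EuclideanSpace ℝ (Fin d), Function.Surjective k ∧
      ∀ i t, inner ℝ (WithLp.toLp 2 (whiten (dataMatrix x) i)) t = inner ℝ (u i) (k t) := by
  set X := dataMatrix x
  set R := √(n : ℝ) • invSqrt (X.transpose * X) with hR
  have hR_unit : IsUnit R :=
    (isUnit_invSqrt (posDef_gram_dataMatrix hx hpos)).smul
      (Units.mk0 √(n : ℝ) (Real.sqrt_ne_zero'.2 (Nat.cast_pos.2 (Nat.pos_of_ne_zero hn))))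
  refine ⟨LinearMap.adjoint T.toLinearMap ∘ Matrix.toEuclideanLin R,
    (adjoint_linearEquiv_bijective T).2.comp fun p => ?_, fun i t => ?_⟩
  · obtain ⟨t, ht⟩ := Matrix.mulVec_surjective_iff_isUnit.2 hR_unit p.ofLp
    exact ⟨WithLp.toLp 2 t, WithLp.ofLp_injective 2 ht⟩
  · rw [inner_toLp_row_eq_mulVec, whiten, ← Matrix.mul_smul, ← hR, ← Matrix.mulVec_mulVec,
      Function.comp_apply, LinearMap.adjoint_inner_right, LinearEquiv.coe_coe, ← hx]
    exact (inner_toLp_row_eq_mulVec X i (Matrix.toEuclideanLin R t)).symm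

/-
Whitening is affine invariant: in the coordinates `u`, the output depends on `X` only through the
sample second moment form of the `u i`, and `‖w i‖²` is the leverage `h i` of the `i`-th point.
-/
theorem IsSpectralOutput.exists_generalizedEigenvector (hn : n ≠ 0) (hx : ∀ i, x i = T (u i))
    (hpos : ∀ v, v ≠ 0 → 0 < weightedForm 1 u v v) {yhat : Fin n → ℤˣ}
    (hy : IsSpectralOutput (dataMatrix x) yhat) :
    ∃ (q : EuclideanSpace ℝ (Fin d)) (h : Fin n → ℝ) (l : ℝ),
      (yhat = fun i => sgn (inner ℝ (u i) q)) ∧ weightedForm 1 u q q = 1 ∧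
      (∀ p, weightedForm (fun i => h i - d) u q p = l * weightedForm 1 u q p) ∧
      (∀ p, l * weightedForm 1 u p p ≤ weightedForm (fun i => h i - d) u p p) ∧
      ∀ i, ∃ p, (∀ z, weightedForm 1 u p z = inner ℝ (u i) z) ∧ inner ℝ (u i) p = h i := by
  obtain ⟨v, ⟨hv, l, hl, hSv⟩, rfl⟩ := hy
  obtain ⟨k, hk_surj, hk⟩ := exists_surjective_inner_row_whiten hn hx hpos
  have hgram := transpose_whiten_mul_whiten (posDef_gram_dataMatrix hx hpos)
  set W := whiten (dataMatrix x)
  set w : Fin n → EuclideanSpace ℝ (Fin d) := fun i => WithLp.toLp 2 (W i)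
  have hform : ∀ (c : Fin n → ℝ) t t', weightedForm c u (k t) (k t') = weightedForm c w t t' :=
    fun c t t' => by simp only [weightedForm_apply, w, hk]
  have hone : ∀ t t', weightedForm 1 u (k t) (k t') = inner ℝ t t' := fun t t' =>
    (hform 1 t t').trans (weightedForm_one_row hn hgram t t')
  have hweight : ∀ t t', weightedForm (fun i => ∑ j, W i j ^ 2 - d) u (k t) (k t') =
      inner ℝ t' (Matrix.toEuclideanLin (weightedCov W) t) := fun t t' =>
    (hform _ t t').trans (inner_toEuclideanLin_weightedCov W t t').symm
  refine ⟨k v, fun i => ∑ j, W i j ^ 2, l, ?_, ?_, hk_surj.forall.2 fun t => ?_,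
    hk_surj.forall.2 fun t => ?_, fun i => ⟨k (w i), hk_surj.forall.2 fun t => ?_, ?_⟩⟩
  · funext i
    rw [← hk, inner_toLp_row_eq_mulVec]
  · rw [hone, real_inner_self_eq_norm_sq, hv, one_pow]
  · rw [hweight, hSv, real_inner_smul_right, hone, real_inner_comm]
  · rw [hweight, hone]
    exact mul_inner_self_le_of_isLeast_eigenvalue (isHermitian_weightedCov W) hl t
  · rw [hone, hk]
  · rw [← hk, real_inner_self_eq_norm_sq, EuclideanSpace.real_norm_sq_eq]

end LinearImage

end Whitening

section GaussianMoments

open Polynomial in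
theorem deriv_eval_mul_exp_half_sq (p : ℝ[X]) :
    deriv (fun t => p.eval t * Real.exp (t ^ 2 / 2)) =
      fun t => (derivative p + X * p).eval t * Real.exp (t ^ 2 / 2) := by
  ext t
  have hsq : HasDerivAt (fun t : ℝ => t ^ 2 / 2) t t := by
    simpa using (hasDerivAt_pow 2 t).div_const 2
  rw [((p.hasDerivAt t).fun_mul hsq.exp).deriv]
  simp only [eval_add, eval_mul, eval_X]
  ring

open Polynomial in
theorem iteratedDeriv_exp_half_sq (k : ℕ) :
    iteratedDeriv k (fun t : ℝ => Real.exp (t ^ 2 / 2)) =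
      fun t => (((fun p : ℝ[X] => derivative p + X * p)^[k]) 1).eval t * Real.exp (t ^ 2 / 2) := by
  induction k with
  | zero => simp only [iteratedDeriv_zero, Function.iterate_zero, id, eval_one, one_mul]
  | succ k ih =>
    rw [iteratedDeriv_succ, ih, deriv_eval_mul_exp_half_sq, Function.iterate_succ_apply']

theorem hasSubgaussianMGF_id_gaussianReal : HasSubgaussianMGF id 1 (gaussianReal 0 1) where
  integrable_exp_mul t := integrable_exp_mul_gaussianReal t
  mgf_le t := by simp [mgf_id_gaussianReal]

theorem integral_sq_gaussianReal : ∫ t, t ^ 2 ∂(gaussianReal 0 1) = 1 := by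
  have hvar := variance_of_integral_eq_zero aemeasurable_id
    (integral_id_gaussianReal (μ := 0) (v := 1))
  simpa [variance_id_gaussianReal] using hvar.symm

theorem integral_pow_four_gaussianReal : ∫ t, t ^ 4 ∂(gaussianReal 0 1) = 3 := by
  have hmem : (0 : ℝ) ∈ interior (integrableExpSet id (gaussianReal 0 1)) := by
    simp [hasSubgaussianMGF_id_gaussianReal.integrableExpSet_eq_univ]
  have hmoment := iteratedDeriv_mgf_zero hmem 4
  rw [mgf_id_gaussianReal] at hmoment
  simp only [zero_mul, zero_add, NNReal.coe_one, one_mul, iteratedDeriv_exp_half_sq] at hmoment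
  simp only [Function.iterate_succ_apply', Function.iterate_zero, id, Polynomial.derivative_add,
    Polynomial.derivative_mul, Polynomial.derivative_X, Polynomial.derivative_one,
    Polynomial.eval_add, Polynomial.eval_mul, Polynomial.eval_X, Polynomial.eval_one,
    Polynomial.eval_zero] at hmoment
  norm_num at hmoment
  exact hmoment.symm

end GaussianMoments

section Mixture

variable {Ω : Type*} {d : ℕ}

/-- The vector obtained from `Γ` by replacing its coordinate `k₀` by the mixture `ρ Y + σ Γ k₀` of
the scalar `Y` and the noise. -/
noncomputable def mixtureVector (ρ σ : ℝ) (k₀ : Fin d) (Y : Ω → ℝ)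
    (Γ : Ω → EuclideanSpace ℝ (Fin d)) (ω : Ω) : EuclideanSpace ℝ (Fin d) :=
  WithLp.toLp 2 (Function.update (Γ ω) k₀ (ρ * Y ω + σ * Γ ω k₀))

theorem mixtureVector_self (ρ σ : ℝ) (k₀ : Fin d) (Y : Ω → ℝ) (Γ : Ω → EuclideanSpace ℝ (Fin d))
    (ω : Ω) : mixtureVector ρ σ k₀ Y Γ ω k₀ = ρ * Y ω + σ * Γ ω k₀ :=
  Function.update_self ..

theorem mixtureVector_of_ne (ρ σ : ℝ) {k k₀ : Fin d} (hk : k ≠ k₀) (Y : Ω → ℝ)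
    (Γ : Ω → EuclideanSpace ℝ (Fin d)) (ω : Ω) : mixtureVector ρ σ k₀ Y Γ ω k = Γ ω k :=
  Function.update_of_ne hk ..

variable [MeasurableSpace Ω] {P : Measure Ω}

section Independence

variable {α β γ ι : Type*} [MeasurableSpace α] [MeasurableSpace β] [MeasurableSpace γ]
  {X : Ω → α} {Y : Ω → β} {Z : Ω → γ}

theorem indepFun_prodMk_of_indepFun [IsProbabilityMeasure P] (hX : Measurable X)
    (hY : Measurable Y) (hZ : Measurable Z) (hXYZ : IndepFun X (fun ω => (Y ω, Z ω)) P)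
    (hYZ : IndepFun Y Z P) : IndepFun (fun ω => (X ω, Y ω)) Z P := by
  have hXY : IndepFun X Y P := hXYZ.comp measurable_id measurable_fst
  have := Measure.isProbabilityMeasure_map (μ := P) hX.aemeasurable
  have := Measure.isProbabilityMeasure_map (μ := P) hY.aemeasurable
  have := Measure.isProbabilityMeasure_map (μ := P) hZ.aemeasurable
  rw [indepFun_iff_map_prod_eq_prod_map_map (hX.prodMk hY).aemeasurable hZ.aemeasurable,
    (indepFun_iff_map_prod_eq_prod_map_map hX.aemeasurable hY.aemeasurable).1 hXY]
  have hassoc := (measurePreserving_prodAssoc (P.map X) (P.map Y) (P.map Z)).symm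
  rw [← hassoc.map_eq,
    ← (indepFun_iff_map_prod_eq_prod_map_map hY.aemeasurable hZ.aemeasurable).1 hYZ,
    ← (indepFun_iff_map_prod_eq_prod_map_map hX.aemeasurable (hY.prodMk hZ).aemeasurable).1 hXYZ,
    Measure.map_map (MeasurableEquiv.measurable _) (hX.prodMk (hY.prodMk hZ))]
  rfl

theorem iIndepFun_update [DecidableEq ι] {f : ι → Ω → α} (hf : iIndepFun f P) {k₀ : ι}
    (hX : IndepFun X (fun ω (k : {k // k ≠ k₀}) => f k ω) P) :
    iIndepFun (Function.update f k₀ X) P := by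
  rw [iIndepFun_iff_measure_inter_preimage_eq_mul]
  have hoff : ∀ {T : Finset ι}, k₀ ∉ T → ∀ A : ι → Set α,
      ⋂ k ∈ T, Function.update f k₀ X k ⁻¹' A k = ⋂ k ∈ T, f k ⁻¹' A k := fun hT A =>
    Set.iInter₂_congr fun k hk => by rw [Function.update_of_ne (ne_of_mem_of_not_mem hk hT)]
  have hprod : ∀ {T : Finset ι}, k₀ ∉ T → ∀ A : ι → Set α,
      ∏ k ∈ T, P (Function.update f k₀ X k ⁻¹' A k) = ∏ k ∈ T, P (f k ⁻¹' A k) := fun hT A =>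
    Finset.prod_congr rfl fun k hk => by
      rw [Function.update_of_ne (ne_of_mem_of_not_mem hk hT)]
  intro S A hA
  by_cases hS : k₀ ∈ S
  · obtain ⟨T, hT, rfl⟩ : ∃ T, k₀ ∉ T ∧ insert k₀ T = S :=
      ⟨S.erase k₀, S.notMem_erase k₀, Finset.insert_erase hS⟩
    have hrest : ⋂ k ∈ T, f k ⁻¹' A k = (fun ω (k : {k // k ≠ k₀}) => f k ω) ⁻¹'
        Set.pi (Subtype.val ⁻¹' (T : Set ι)) fun k => A k := by
      ext ω
      simp only [Set.mem_iInter, Set.mem_preimage, Set.mem_pi, Finset.mem_coe, Subtype.forall]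
      exact ⟨fun h k _ hk => h k hk, fun h k hk => h k (ne_of_mem_of_not_mem hk hT) hk⟩
    have hpi : MeasurableSet (Set.pi (Subtype.val ⁻¹' (T : Set ι)) fun k : {k // k ≠ k₀} => A k) :=
      .pi (T.finite_toSet.preimage Subtype.val_injective.injOn).countable fun k hk =>
        hA k (Finset.mem_insert_of_mem hk)
    rw [Finset.set_biInter_insert, Finset.prod_insert hT, hoff hT, hprod hT, hrest,
      Function.update_self, hX.measure_inter_preimage_eq_mul _ _ (hA k₀ (T.mem_insert_self k₀)) hpi,
      ← hrest, hf.measure_inter_preimage_eq_mul T fun k hk => hA k (Finset.mem_insert_of_mem hk)]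
  · rw [hoff hS, hprod hS]
    exact hf.measure_inter_preimage_eq_mul S hA

theorem indepFun_apply_restrict_ne [Finite ι] {f : ι → Ω → α} (hf : iIndepFun f P)
    (hm : ∀ k, Measurable (f k)) (k₀ : ι) :
    IndepFun (f k₀) (fun ω (k : {k // k ≠ k₀}) => f k ω) P := by
  classical
  have := Fintype.ofFinite ι
  exact (hf.indepFun_finset {k₀} (Finset.univ.erase k₀)
    (Finset.disjoint_singleton_left.2 (Finset.notMem_erase k₀ _)) hm).comp
    (φ := fun v => v ⟨k₀, Finset.mem_singleton_self k₀⟩)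
    (ψ := fun v (k : {k // k ≠ k₀}) => v ⟨k, Finset.mem_erase.2 ⟨k.2, Finset.mem_univ _⟩⟩)
    (measurable_pi_apply (X := fun _ => α) _)
    (measurable_pi_lambda _ fun _ => measurable_pi_apply (X := fun _ => α) _)

end Independence

variable {Y : Ω → ℝ} {Γ : Ω → EuclideanSpace ℝ (Fin d)}

section StandardGaussian

theorem map_ofLp_eq_pi_of_map_eq_stdGaussian (hΓ : Measurable Γ)
    (h : P.map Γ = stdGaussian (EuclideanSpace ℝ (Fin d))) :
    P.map (fun ω k => Γ ω k) = Measure.pi fun _ => gaussianReal 0 1 := by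
  have hcomp : P.map (fun ω k => Γ ω k) = (P.map Γ).map WithLp.ofLp :=
    (Measure.map_map (by fun_prop) hΓ).symm
  rw [hcomp, h, ← map_pi_eq_stdGaussian, Measure.map_map (by fun_prop) (by fun_prop)]
  exact Measure.map_id

theorem map_apply_of_map_eq_stdGaussian (hΓ : Measurable Γ)
    (h : P.map Γ = stdGaussian (EuclideanSpace ℝ (Fin d))) (k : Fin d) :
    P.map (fun ω => Γ ω k) = gaussianReal 0 1 := by
  rw [← (measurePreserving_eval (fun _ : Fin d => gaussianReal 0 1) k).map_eq,
    ← map_ofLp_eq_pi_of_map_eq_stdGaussian hΓ h,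
    Measure.map_map (measurable_pi_apply k) (by fun_prop)]
  rfl

theorem integral_comp_of_map_eq_stdGaussian (hΓ : Measurable Γ)
    (h : P.map Γ = stdGaussian (EuclideanSpace ℝ (Fin d))) {f : ℝ → ℝ} (hf : Measurable f)
    (k : Fin d) : ∫ ω, f (Γ ω k) ∂P = ∫ t, f t ∂(gaussianReal 0 1) := by
  rw [← map_apply_of_map_eq_stdGaussian hΓ h k,
    integral_map (by fun_prop) hf.aestronglyMeasurable]

theorem isIsotropic_of_map_eq_stdGaussian (hΓ : Measurable Γ)
    (h : P.map Γ = stdGaussian (EuclideanSpace ℝ (Fin d))) : IsIsotropic P Γ where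
  measurable := hΓ
  indep := by
    have : IsProbabilityMeasure (P.map Γ) := h ▸ inferInstance
    have := P.isProbabilityMeasure_of_map Γ
    rw [iIndepFun_iff_map_fun_eq_pi_map fun k => by fun_prop,
      map_ofLp_eq_pi_of_map_eq_stdGaussian hΓ h]
    simp only [map_apply_of_map_eq_stdGaussian hΓ h]
  subgaussian k := by
    rw [← HasSubgaussianMGF.id_map_iff (by fun_prop), map_apply_of_map_eq_stdGaussian hΓ h]
    exact hasSubgaussianMGF_id_gaussianReal
  mean k := (integral_comp_of_map_eq_stdGaussian hΓ h measurable_id k).trans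
    integral_id_gaussianReal
  second_moment k := (integral_comp_of_map_eq_stdGaussian hΓ h (measurable_id.pow_const 2) k).trans
    integral_sq_gaussianReal

theorem integral_pow_four_of_map_eq_stdGaussian (hΓ : Measurable Γ)
    (h : P.map Γ = stdGaussian (EuclideanSpace ℝ (Fin d))) (k : Fin d) :
    ∫ ω, Γ ω k ^ 4 ∂P = 3 :=
  (integral_comp_of_map_eq_stdGaussian hΓ h (measurable_id.pow_const 4) k).trans
    integral_pow_four_gaussianReal

end StandardGaussian

section MixtureVector

variable {ρ σ : ℝ} {k₀ : Fin d}

theorem measurable_mixtureVector (hY : Measurable Y) (hΓ : Measurable Γ) :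
    Measurable (mixtureVector ρ σ k₀ Y Γ) := by
  refine (WithLp.measurable_toLp 2 _).comp (measurable_pi_lambda _ fun k => ?_)
  rcases eq_or_ne k k₀ with rfl | hk
  · simp only [Function.update_self]
    fun_prop
  · simp only [Function.update_of_ne hk]
    fun_prop

theorem iIndepFun_mixtureVector_apply (hY : Measurable Y) (hΓ : IsIsotropic P Γ)
    (hYΓ : IndepFun Y Γ P) : iIndepFun (fun k ω => mixtureVector ρ σ k₀ Y Γ ω k) P := by
  have := hΓ.isProbabilityMeasure
  have hpair : IndepFun (fun ω => (Y ω, Γ ω k₀)) (fun ω (k : {k // k ≠ k₀}) => Γ ω k) P :=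
    indepFun_prodMk_of_indepFun hY (hΓ.measurable_apply k₀)
      (measurable_pi_lambda _ fun k => hΓ.measurable_apply k)
      (hYΓ.comp (ψ := fun v : EuclideanSpace ℝ (Fin d) =>
        (v k₀, fun k : {k // k ≠ k₀} => v k)) measurable_id (by fun_prop))
      (indepFun_apply_restrict_ne hΓ.indep hΓ.measurable_apply k₀)
  have hmix : IndepFun (fun ω => ρ * Y ω + σ * Γ ω k₀) (fun ω (k : {k // k ≠ k₀}) => Γ ω k) P :=
    hpair.comp (φ := fun p : ℝ × ℝ => ρ * p.1 + σ * p.2) (by fun_prop) measurable_id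
  convert! iIndepFun_update hΓ.indep hmix using 1
  funext k ω
  rcases eq_or_ne k k₀ with rfl | hk
  · rw [mixtureVector_self, Function.update_self]
  · rw [mixtureVector_of_ne ρ σ hk, Function.update_of_ne hk]

theorem integral_sq_mul_add_mul (hY : HasSubgaussianMGF Y 1 P)
    (hY0 : ∫ ω, Y ω ∂P = 0) {Z : Ω → ℝ} (hZ : HasSubgaussianMGF Z 1 P) (hYZ : IndepFun Y Z P) :
    ∫ ω, (ρ * Y ω + σ * Z ω) ^ 2 ∂P = ρ ^ 2 * ∫ ω, Y ω ^ 2 ∂P + σ ^ 2 * ∫ ω, Z ω ^ 2 ∂P := by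
  have hmem : ∀ {V : Ω → ℝ}, HasSubgaussianMGF V 1 P → MemLp V 2 P := fun hV => hV.memLp 2
  have hcross : ∫ ω, Y ω * Z ω ∂P = 0 := by
    rw [hYZ.integral_fun_mul_eq_mul_integral (hmem hY).aestronglyMeasurable
      (hmem hZ).aestronglyMeasurable, hY0, zero_mul]
  have hexpand : ∀ ω, (ρ * Y ω + σ * Z ω) ^ 2 =
      ρ ^ 2 * Y ω ^ 2 + 2 * ρ * σ * (Y ω * Z ω) + σ ^ 2 * Z ω ^ 2 := fun ω => by ring
  have hYsq : Integrable (fun ω => ρ ^ 2 * Y ω ^ 2) P := (hmem hY).integrable_sq.const_mul _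
  have hYZ_int : Integrable (fun ω => 2 * ρ * σ * (Y ω * Z ω)) P :=
    ((hmem hY).integrable_mul (hmem hZ)).const_mul _
  have hZsq : Integrable (fun ω => σ ^ 2 * Z ω ^ 2) P := (hmem hZ).integrable_sq.const_mul _
  have hsum : Integrable (fun ω => ρ ^ 2 * Y ω ^ 2 + 2 * ρ * σ * (Y ω * Z ω)) P := hYsq.add hYZ_int
  simp only [hexpand]
  rw [integral_add hsum hZsq, integral_add hYsq hYZ_int, integral_const_mul,
    integral_const_mul, integral_const_mul, hcross, mul_zero, add_zero]

theorem isIsotropic_mixtureVector (hY : Measurable Y) (hY_sub : HasSubgaussianMGF Y 1 P)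
    (hY_mean : ∫ ω, Y ω ∂P = 0) (hY_sq : ∫ ω, Y ω ^ 2 ∂P = 1) (hΓ : IsIsotropic P Γ)
    (hYΓ : IndepFun Y Γ P) (hρσ : ρ ^ 2 + σ ^ 2 = 1) :
    IsIsotropic P (mixtureVector ρ σ k₀ Y Γ) := by
  have hYΓk : IndepFun Y (fun ω => Γ ω k₀) P :=
    hYΓ.comp (ψ := fun v : EuclideanSpace ℝ (Fin d) => v k₀) measurable_id (by fun_prop)
  refine ⟨measurable_mixtureVector hY hΓ.measurable, iIndepFun_mixtureVector_apply hY hΓ hYΓ,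
    fun k => ?_, fun k => ?_, fun k => ?_⟩ <;> rcases eq_or_ne k k₀ with rfl | hk
  · simp only [mixtureVector_self]
    convert! (hY_sub.const_mul ρ).add_of_indepFun ((hΓ.subgaussian k).const_mul σ)
      (hYΓk.comp (φ := fun t => ρ * t) (ψ := fun t => σ * t) (by fun_prop) (by fun_prop)) using 1
    refine NNReal.eq ?_
    exact hρσ.symm.trans (congrArg₂ (· + ·) (mul_one _).symm (mul_one _).symm)
  · simpa only [mixtureVector_of_ne ρ σ hk] using hΓ.subgaussian k
  · simp only [mixtureVector_self]
    rw [integral_add (hY_sub.integrable.const_mul ρ) ((hΓ.subgaussian k).integrable.const_mul σ),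
      integral_const_mul, integral_const_mul, hY_mean, hΓ.mean, mul_zero, mul_zero, add_zero]
  · simpa only [mixtureVector_of_ne ρ σ hk] using hΓ.mean k
  · simp only [mixtureVector_self]
    rw [integral_sq_mul_add_mul hY_sub hY_mean (hΓ.subgaussian k) hYΓk, hY_sq, hΓ.second_moment,
      mul_one, mul_one, hρσ]
  · simpa only [mixtureVector_of_ne ρ σ hk] using hΓ.second_moment k

theorem add_pow_four_le (a b : ℝ) : (a + b) ^ 4 ≤ 6 / 5 * a ^ 4 + 9261 * b ^ 4 := by
  have hsq : (a + b) ^ 2 ≤ 21 / 20 * a ^ 2 + 21 * b ^ 2 := by nlinarith [sq_nonneg (a - 20 * b)]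
  have hpow : ((a + b) ^ 2) ^ 2 ≤ (21 / 20 * a ^ 2 + 21 * b ^ 2) ^ 2 := by gcongr
  nlinarith [sq_nonneg (a ^ 2 - 400 * b ^ 2), sq_nonneg (a ^ 2), sq_nonneg (b ^ 2)]

theorem integral_mixtureVector_self_pow_four_le
    (hY : ∀ ω, |Y ω| ≤ 1) (hΓ : IsIsotropic P Γ) (hu : IsIsotropic P (mixtureVector ρ σ k₀ Y Γ)) :
    ∫ ω, mixtureVector ρ σ k₀ Y Γ ω k₀ ^ 4 ∂P ≤
      6 / 5 * ρ ^ 4 + 9261 * σ ^ 4 * ∫ ω, Γ ω k₀ ^ 4 ∂P := by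
  have := hΓ.isProbabilityMeasure
  have hint := (hΓ.integrable_pow_four k₀).const_mul (9261 * σ ^ 4)
  calc ∫ ω, mixtureVector ρ σ k₀ Y Γ ω k₀ ^ 4 ∂P
      ≤ ∫ ω, (6 / 5 * ρ ^ 4 + 9261 * σ ^ 4 * Γ ω k₀ ^ 4) ∂P := by
        refine integral_mono (hu.integrable_pow_four k₀) ((integrable_const _).add hint) fun ω => ?_
        have hlabel : ρ ^ 4 * Y ω ^ 4 ≤ ρ ^ 4 := by
          refine mul_le_of_le_one_right (by positivity) ?_
          simpa only [Even.pow_abs (show Even 4 by decide)] using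
            pow_le_one₀ (n := 4) (abs_nonneg _) (hY ω)
        have hadd := add_pow_four_le (ρ * Y ω) (σ * Γ ω k₀)
        simp only [mixtureVector_self]
        rw [mul_pow, mul_pow] at hadd
        linarith
    _ = 6 / 5 * ρ ^ 4 + 9261 * σ ^ 4 * ∫ ω, Γ ω k₀ ^ 4 ∂P := by
        rw [integral_add (integrable_const _) hint, integral_const, integral_const_mul,
          probReal_univ, one_smul]

end MixtureVector

section Label

variable {y : Ω → ℤˣ}

theorem measurableSet_singleton_units (s : ℤˣ) : MeasurableSet ({s} : Set ℤˣ) :=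
  ⟨{(s : ℤ)}, .singleton _, by ext t; simp [Units.ext_iff]⟩

theorem measurable_units_cast : Measurable fun s : ℤˣ => ((s : ℤ) : ℝ) :=
  (measurable_from_top (f := fun z : ℤ => (z : ℝ))).comp (comap_measurable _)

theorem abs_units_cast (s : ℤˣ) : |((s : ℤ) : ℝ)| = 1 := by
  rcases Int.units_eq_one_or s with rfl | rfl <;> norm_num

theorem integral_label_sq [IsProbabilityMeasure P] (y : Ω → ℤˣ) :
    ∫ ω, ((y ω : ℤ) : ℝ) ^ 2 ∂P = 1 := by
  simp only [← sq_abs ((y _ : ℤ) : ℝ), abs_units_cast, one_pow, integral_const, probReal_univ,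
    one_smul]

theorem integral_label [IsFiniteMeasure P] (hy : Measurable y)
    (hyp : P (y ⁻¹' {1}) = P (y ⁻¹' {-1})) : ∫ ω, ((y ω : ℤ) : ℝ) ∂P = 0 := by
  have hind : ∀ ω, ((y ω : ℤ) : ℝ) =
      (y ⁻¹' {1}).indicator (fun _ => (1 : ℝ)) ω - (y ⁻¹' {-1}).indicator (fun _ => 1) ω := by
    intro ω
    rcases Int.units_eq_one_or (y ω) with h | h <;> simp [Set.indicator, h]
  have hm : ∀ s, MeasurableSet (y ⁻¹' {s}) := fun s => hy (measurableSet_singleton_units s)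
  simp only [hind]
  rw [integral_sub ((integrable_const _).indicator (hm 1))
    ((integrable_const _).indicator (hm (-1))), integral_indicator_const _ (hm 1),
    integral_indicator_const _ (hm (-1)), measureReal_def, measureReal_def, hyp, sub_self]

theorem hasSubgaussianMGF_label [IsProbabilityMeasure P] (hy : Measurable y)
    (hyp : P (y ⁻¹' {1}) = P (y ⁻¹' {-1})) :
    HasSubgaussianMGF (fun ω => ((y ω : ℤ) : ℝ)) 1 P := by
  convert! hasSubgaussianMGF_of_mem_Icc_of_integral_eq_zero (a := -1) (b := 1)
    (measurable_units_cast.comp hy).aemeasurable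
    (.of_forall fun ω => abs_le.1 (abs_units_cast (y ω)).le) (integral_label hy hyp) using 1
  refine NNReal.eq ?_
  push_cast
  norm_num

end Label

end Mixture

section Standardization

open scoped MatrixOrder

theorem isUnit_sqrt_of_posDef {ι : Type*} [Fintype ι] [DecidableEq ι] {A : Matrix ι ι ℝ}
    (hA : A.PosDef) : IsUnit (CFC.sqrt A) :=
  isUnit_of_mul_isUnit_left ((CFC.sqrt_mul_sqrt_self A hA.posSemidef.nonneg).symm ▸ hA.isUnit)

theorem exists_linearEquiv_apply_eq_toEuclideanCLM {ι : Type*} [Fintype ι] [DecidableEq ι]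
    {A : Matrix ι ι ℝ} (hA : IsUnit A) : ∃ e : EuclideanSpace ℝ ι ≃ₗ[ℝ] EuclideanSpace ℝ ι,
      ∀ v, e v = Matrix.toEuclideanCLM (𝕜 := ℝ) A v := by
  have hunit : IsUnit (Matrix.toEuclideanCLM (n := ι) (𝕜 := ℝ) A) := hA.map _
  have hinj : Function.Injective (Matrix.toEuclideanCLM (n := ι) (𝕜 := ℝ) A).toLinearMap :=
    (ContinuousLinearMap.isUnit_iff_bijective.1 hunit).1
  exact ⟨LinearEquiv.ofInjectiveEndo _ hinj, fun _ => rfl⟩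

variable {d : ℕ} {m : EuclideanSpace ℝ (Fin d)} {Sig : Matrix (Fin d) (Fin d) ℝ}

theorem snr_eq_norm_sq (m : EuclideanSpace ℝ (Fin d)) (hS : Sig.PosDef) :
    snr m Sig = ‖Matrix.toEuclideanCLM (𝕜 := ℝ) (CFC.sqrt Sig)⁻¹ m‖ ^ 2 := by
  have hsym : (CFC.sqrt Sig).transpose = CFC.sqrt Sig := by
    rw [← Matrix.conjTranspose_eq_transpose_of_trivial]
    exact (CFC.sqrt_nonneg Sig).isSelfAdjoint
  conv_lhs => rw [snr, ← CFC.sqrt_mul_sqrt_self Sig hS.posSemidef.nonneg]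
  rw [EuclideanSpace.real_norm_sq_eq, Matrix.mul_inv_rev, ← Matrix.mulVec_mulVec,
    Matrix.dotProduct_mulVec, ← Matrix.mulVec_transpose, Matrix.transpose_nonsing_inv, hsym]
  simp only [dotProduct, sq, Matrix.ofLp_toEuclideanCLM]

theorem noiseLevel_pos (m : EuclideanSpace ℝ (Fin d)) (hS : Sig.PosDef) : 0 < noiseLevel m Sig := by
  rw [noiseLevel, snr_eq_norm_sq m hS]
  positivity

theorem noiseLevel_sq_mul (m : EuclideanSpace ℝ (Fin d)) (hS : Sig.PosDef) :
    noiseLevel m Sig ^ 2 * (snr m Sig + 1) = 1 := by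
  rw [noiseLevel, snr_eq_norm_sq m hS, div_pow, Real.sq_sqrt (by positivity), one_pow]
  exact one_div_mul_cancel (by positivity)

theorem sqrt_one_sub_noiseLevel_sq (m : EuclideanSpace ℝ (Fin d)) (hS : Sig.PosDef) :
    √(1 - noiseLevel m Sig ^ 2) =
      noiseLevel m Sig * ‖Matrix.toEuclideanCLM (𝕜 := ℝ) (CFC.sqrt Sig)⁻¹ m‖ := by
  have hsq := noiseLevel_sq_mul m hS
  rw [snr_eq_norm_sq m hS] at hsq
  have hσ := noiseLevel_pos m hS
  rw [Real.sqrt_eq_iff_mul_self_eq (by nlinarith [sq_nonneg (noiseLevel m Sig *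
    ‖Matrix.toEuclideanCLM (𝕜 := ℝ) (CFC.sqrt Sig)⁻¹ m‖)]) (by positivity)]
  linarith

variable {Ω : Type*} [MeasurableSpace Ω] {P : Measure Ω}

theorem measure_inter_preimage_eq_mul_of_cond_map_eq {α β : Type*} [MeasurableSpace α]
    [Countable β] [IsFiniteMeasure P] {y : Ω → β} {Z : Ω → α} {ν : Measure α}
    (hy : ∀ s, MeasurableSet (y ⁻¹' {s})) (hZ : Measurable Z)
    (h : ∀ s, (cond P (y ⁻¹' {s})).map Z = ν) {B : Set α} (hB : MeasurableSet B) (A : Set β) :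
    P (y ⁻¹' A ∩ Z ⁻¹' B) = P (y ⁻¹' A) * ν B := by
  have hslice : ∀ s : A, P.restrict (Z ⁻¹' B) (y ⁻¹' {s.1}) = P (y ⁻¹' {s.1}) * ν B := fun s => by
    rw [Measure.restrict_apply (hy s), ← cond_mul_eq_inter (hy s), ← h s, Measure.map_apply hZ hB,
      mul_comm]
  have hA : ∀ Q : Measure Ω, ∑' s : A, Q (y ⁻¹' {s.1}) = Q (y ⁻¹' A) := fun Q =>
    tsum_measure_preimage_singleton A.to_countable fun s _ => hy s
  rw [← Measure.restrict_apply' (hZ hB), ← hA, ← hA, ← ENNReal.tsum_mul_right]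
  exact tsum_congr hslice

theorem map_eq_of_cond_map_eq {α β : Type*} [MeasurableSpace α] [Countable β]
    [IsProbabilityMeasure P] {y : Ω → β} {Z : Ω → α} {ν : Measure α}
    (hy : ∀ s, MeasurableSet (y ⁻¹' {s})) (hZ : Measurable Z)
    (h : ∀ s, (cond P (y ⁻¹' {s})).map Z = ν) : P.map Z = ν := by
  ext B hB
  rw [Measure.map_apply hZ hB, ← Set.univ_inter (Z ⁻¹' B), ← Set.preimage_univ (f := y),
    measure_inter_preimage_eq_mul_of_cond_map_eq hy hZ h hB, Set.preimage_univ, measure_univ,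
    one_mul]

theorem indepFun_of_cond_map_eq {α β : Type*} [MeasurableSpace α] [MeasurableSpace β]
    [Countable β] [IsProbabilityMeasure P] {y : Ω → β} {Z : Ω → α}
    {ν : Measure α} (hy : ∀ s, MeasurableSet (y ⁻¹' {s})) (hZ : Measurable Z)
    (h : ∀ s, (cond P (y ⁻¹' {s})).map Z = ν) : IndepFun y Z P := by
  rw [indepFun_iff_measure_inter_preimage_eq_mul]
  intro A B _ hB
  rw [measure_inter_preimage_eq_mul_of_cond_map_eq hy hZ h hB, ← Measure.map_apply hZ hB,
    map_eq_of_cond_map_eq hy hZ h]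

/-- The standardised noise `Σ^{-1/2} (x - s m)` of an observation `x` with label `s`. -/
noncomputable def standardizedNoise (m : EuclideanSpace ℝ (Fin d)) (Sig : Matrix (Fin d) (Fin d) ℝ)
    (x : EuclideanSpace ℝ (Fin d)) (s : ℤˣ) : EuclideanSpace ℝ (Fin d) :=
  Matrix.toEuclideanCLM (𝕜 := ℝ) (CFC.sqrt Sig)⁻¹ (x - ((s : ℤ) : ℝ) • m)

theorem measurable_standardizedNoise {x : Ω → EuclideanSpace ℝ (Fin d)} {y : Ω → ℤˣ}
    (hx : Measurable x) (hy : Measurable y) :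
    Measurable fun ω => standardizedNoise m Sig (x ω) (y ω) :=
  (ContinuousLinearMap.measurable _).comp
    (hx.sub ((measurable_units_cast.comp hy).smul_const m))

theorem cond_map_standardizedNoise (hS : Sig.PosDef) {x : Ω → EuclideanSpace ℝ (Fin d)}
    {y : Ω → ℤˣ} (hx : Measurable x) (hy : Measurable y) {s : ℤˣ}
    (hlaw : (cond P (y ⁻¹' {s})).map x = multivariateGaussian (((s : ℤ) : ℝ) • m) Sig) :
    (cond P (y ⁻¹' {s})).map (fun ω => standardizedNoise m Sig (x ω) (y ω)) =
      stdGaussian (EuclideanSpace ℝ (Fin d)) := by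
  have hcongr : (fun ω => standardizedNoise m Sig (x ω) (y ω)) =ᵐ[cond P (y ⁻¹' {s})]
      (standardizedNoise m Sig · s) ∘ x :=
    ae_cond_of_forall_mem (hy (measurableSet_singleton_units s)) fun ω hω =>
      congrArg (standardizedNoise m Sig (x ω)) hω
  have hmeas : Measurable (standardizedNoise m Sig · s) :=
    measurable_standardizedNoise measurable_id measurable_const
  have hinv : (standardizedNoise m Sig · s) ∘
      (fun z => ((s : ℤ) : ℝ) • m + Matrix.toEuclideanCLM (𝕜 := ℝ) (CFC.sqrt Sig) z) = id := by
    funext z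
    rw [Function.comp_apply, standardizedNoise, add_sub_cancel_left, ← mul_apply_eq_comp,
      ← map_mul, Matrix.nonsing_inv_mul _ ((Matrix.isUnit_iff_isUnit_det _).1
        (isUnit_sqrt_of_posDef hS)), map_one, one_apply_eq_self, id]
  rw [Measure.map_congr hcongr, ← Measure.map_map hmeas hx, hlaw, multivariateGaussian,
    Measure.map_map hmeas (by fun_prop), hinv, Measure.map_id]

end Standardization

section Whitened

open scoped MatrixOrder

variable {Ω : Type*} [MeasurableSpace Ω] {P : Measure Ω} {n d : ℕ} {m : EuclideanSpace ℝ (Fin d)}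
  {Sig : Matrix (Fin d) (Fin d) ℝ} {x : Fin n → Ω → EuclideanSpace ℝ (Fin d)}
  {y : Fin n → Ω → ℤˣ}

theorem exists_linearIsometryEquiv_apply_eq_smul_single (v : EuclideanSpace ℝ (Fin d))
    (k₀ : Fin d) : ∃ U : EuclideanSpace ℝ (Fin d) ≃ₗᵢ[ℝ] EuclideanSpace ℝ (Fin d),
      U v = ‖v‖ • EuclideanSpace.single k₀ 1 := by
  refine ⟨_, Submodule.reflection_sub ?_⟩
  rw [norm_smul, PiLp.norm_single, norm_norm, norm_one, mul_one]

theorem isUnit_diagonal_update_one {σ : ℝ} (hσ : σ ≠ 0) (k₀ : Fin d) :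
    IsUnit (Matrix.diagonal (Function.update (1 : Fin d → ℝ) k₀ σ)) := by
  rw [Matrix.isUnit_diagonal, Pi.isUnit_iff]
  intro k
  rcases eq_or_ne k k₀ with rfl | hk
  · simpa only [Function.update_self, isUnit_iff_ne_zero] using hσ
  · simp only [Function.update_of_ne hk, Pi.one_apply, isUnit_one]

-- Rotate `Σ^{-1/2} m` onto the axis `k₀` and rescale that axis by the noise level.
theorem exists_linearEquiv_apply_mixtureVector_eq (m : EuclideanSpace ℝ (Fin d)) (hS : Sig.PosDef)
    (k₀ : Fin d) :
    ∃ (T : EuclideanSpace ℝ (Fin d) ≃ₗ[ℝ] EuclideanSpace ℝ (Fin d))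
      (U : EuclideanSpace ℝ (Fin d) ≃ₗᵢ[ℝ] EuclideanSpace ℝ (Fin d)), ∀ x (s : ℤˣ),
      x = T (mixtureVector √(1 - noiseLevel m Sig ^ 2) (noiseLevel m Sig) k₀
        (fun s : ℤˣ => ((s : ℤ) : ℝ)) (fun s => U (standardizedNoise m Sig x s)) s) := by
  obtain ⟨U, hU⟩ := exists_linearIsometryEquiv_apply_eq_smul_single
    (Matrix.toEuclideanCLM (𝕜 := ℝ) (CFC.sqrt Sig)⁻¹ m) k₀
  obtain ⟨D, hD⟩ := exists_linearEquiv_apply_eq_toEuclideanCLM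
    (isUnit_diagonal_update_one (noiseLevel_pos m hS).ne' k₀)
  obtain ⟨L, hL⟩ := exists_linearEquiv_apply_eq_toEuclideanCLM
    (Matrix.isUnit_nonsing_inv_iff.2 (isUnit_sqrt_of_posDef hS))
  refine ⟨(L.trans (U.toLinearEquiv.trans D)).symm, U, fun x s => ?_⟩
  have hnoise : U (standardizedNoise m Sig x s) = U (L x) - ((s : ℤ) : ℝ) •
      ‖Matrix.toEuclideanCLM (𝕜 := ℝ) (CFC.sqrt Sig)⁻¹ m‖ • EuclideanSpace.single k₀ 1 := by
    rw [standardizedNoise, map_sub, map_smul, map_sub, map_smul, hU, hL]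
  have hcoord : ∀ v k, D v k = Function.update (1 : Fin d → ℝ) k₀ (noiseLevel m Sig) k * v k :=
    fun v k => by rw [hD, Matrix.ofLp_toEuclideanCLM, Matrix.mulVec_diagonal]
  rw [LinearEquiv.eq_symm_apply]
  ext k
  change D (U (L x)) k = _
  rw [hcoord]
  rcases eq_or_ne k k₀ with rfl | hk
  · rw [Function.update_self, mixtureVector_self, sqrt_one_sub_noiseLevel_sq m hS, hnoise]
    simp only [PiLp.sub_apply, PiLp.smul_apply, PiLp.single_apply, if_true, smul_eq_mul]
    ring
  · rw [Function.update_of_ne hk, mixtureVector_of_ne _ _ hk, hnoise]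
    simp only [PiLp.sub_apply, PiLp.smul_apply, PiLp.single_apply, if_neg hk, smul_eq_mul,
      Pi.one_apply]
    ring

theorem IsMixtureSample.exists_whitened [IsProbabilityMeasure P] (hS : Sig.PosDef)
    (h : IsMixtureSample P m Sig x y) (k₀ : Fin d) :
    ∃ (T : EuclideanSpace ℝ (Fin d) ≃ₗ[ℝ] EuclideanSpace ℝ (Fin d))
      (Γ : Fin n → Ω → EuclideanSpace ℝ (Fin d)),
      (∀ i, Measurable (Γ i)) ∧ (∀ i, P.map (Γ i) = stdGaussian (EuclideanSpace ℝ (Fin d))) ∧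
      (∀ i, IndepFun (y i) (Γ i) P) ∧ iIndepFun (fun i ω => (y i ω, Γ i ω)) P ∧
      ∀ i ω, x i ω = T (mixtureVector √(1 - noiseLevel m Sig ^ 2) (noiseLevel m Sig) k₀
        (fun ω => ((y i ω : ℤ) : ℝ)) (Γ i) ω) := by
  obtain ⟨T, U, hT⟩ := exists_linearEquiv_apply_mixtureVector_eq m hS k₀
  have hyS : ∀ i s, MeasurableSet (y i ⁻¹' {s}) := fun i s =>
    h.measurable_y i (measurableSet_singleton_units s)
  let Z : Fin n → Ω → EuclideanSpace ℝ (Fin d) := fun i ω =>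
    standardizedNoise m Sig (x i ω) (y i ω)
  have hZ : ∀ i, Measurable (Z i) := fun i =>
    measurable_standardizedNoise (h.measurable_x i) (h.measurable_y i)
  have hZ_cond : ∀ i s, (cond P (y i ⁻¹' {s})).map (Z i) = stdGaussian _ := fun i s =>
    cond_map_standardizedNoise hS (h.measurable_x i) (h.measurable_y i) (h.law_cond i s)
  have hU : Measurable U := U.continuous.measurable
  refine ⟨T, fun i ω => U (Z i ω), fun i => hU.comp (hZ i), fun i => ?_, fun i => ?_, ?_,
    fun i ω => hT (x i ω) (y i ω)⟩
  · rw [← stdGaussian_map U, ← map_eq_of_cond_map_eq (hyS i) (hZ i) (hZ_cond i)]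
    exact (Measure.map_map hU (hZ i)).symm
  · exact (indepFun_of_cond_map_eq (hyS i) (hZ i) (hZ_cond i)).comp measurable_id hU
  · exact h.indep.comp (fun _ p => (p.2, U (standardizedNoise m Sig p.1 p.2))) fun _ =>
      measurable_snd.prodMk (hU.comp (measurable_standardizedNoise measurable_fst measurable_snd))

end Whitened

section Regime

/-- The scale of the perturbations `10 ^ 7 * errorScale κ n d` of the leverage scores and of the
weighted covariance on a good sample; its square is `(7 + κ) ^ 4 * (d ^ 2 * log n ^ 3 / n)`. -/
noncomputable def errorScale (κ : ℝ) (n d : ℕ) : ℝ :=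
  (7 + κ) ^ 2 * (d * (Real.log n * logRate n))

theorem errorScale_sq (κ : ℝ) (n d : ℕ) :
    errorScale κ n d ^ 2 = (7 + κ) ^ 4 * (d ^ 2 * Real.log n ^ 3 / n) := by
  rw [errorScale, logRate, mul_pow, mul_pow, mul_pow,
    Real.sq_sqrt (div_nonneg (Real.log_natCast_nonneg n) n.cast_nonneg)]
  ring

/-- The regime in which the sample size `n` is so large compared with the dimension `d` that the
deviations of probability at most `n ^ (-κ)` are negligible. -/
structure IsLargeSample (n d : ℕ) (κ : ℝ) : Prop where
  one_le_dim : (1 : ℝ) ≤ d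
  le_size : (1000 : ℝ) ≤ n
  one_le : 1 ≤ κ
  logRate_mul_sq_le : logRate n * ((κ + 1) * Real.log n) ^ 2 ≤ 1
  errorScale_le : 10 ^ 9 * errorScale κ n d ≤ 1

namespace IsLargeSample

variable {n d : ℕ} {κ : ℝ}

theorem size_pos (h : IsLargeSample n d κ) : (0 : ℝ) < n := by linarith [h.le_size]

theorem size_ne_zero (h : IsLargeSample n d κ) : n ≠ 0 := by
  exact_mod_cast h.size_pos.ne'

theorem dim_pos (h : IsLargeSample n d κ) : 0 < d := by
  exact_mod_cast h.one_le_dim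

theorem one_le_sqrt_dim (h : IsLargeSample n d κ) : 1 ≤ √(d : ℝ) :=
  Real.one_le_sqrt.2 h.one_le_dim

theorem sqrt_dim_le (h : IsLargeSample n d κ) : √(d : ℝ) ≤ d :=
  (Real.sqrt_le_sqrt (by nlinarith [h.one_le_dim])).trans_eq (Real.sqrt_sq d.cast_nonneg)

theorem one_le_log (h : IsLargeSample n d κ) : 1 ≤ Real.log n := by
  rw [Real.le_log_iff_exp_le h.size_pos]
  linarith [h.le_size, Real.exp_one_lt_d9]

theorem errorScale_nonneg (h : IsLargeSample n d κ) : 0 ≤ errorScale κ n d := by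
  have := h.one_le_log
  have := logRate_nonneg n
  rw [errorScale]
  positivity

theorem le_errorScale (h : IsLargeSample n d κ) :
    (7 + κ) * (d * logRate n) ≤ errorScale κ n d := by
  have hκ := h.one_le
  have hq := logRate_nonneg n
  calc (7 + κ) * (d * logRate n) ≤ (7 + κ) ^ 2 * (d * logRate n) := by
        gcongr
        nlinarith
    _ ≤ errorScale κ n d := by
        rw [errorScale]
        gcongr
        exact le_mul_of_one_le_left hq h.one_le_log

theorem mul_sqrt_dim_mul_logRate_le (h : IsLargeSample n d κ) :
    (7 + κ) * (√d * logRate n) ≤ errorScale κ n d := by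
  have hκ := h.one_le
  refine le_trans ?_ h.le_errorScale
  have := logRate_nonneg n
  gcongr
  exact h.sqrt_dim_le

theorem mul_dim_mul_logRate_le_one (h : IsLargeSample n d κ) :
    10 ^ 9 * ((7 + κ) * (d * logRate n)) ≤ 1 := by
  linarith [h.le_errorScale, h.errorScale_le]

theorem exponent_mul_dim_mul_logRate_le_one (h : IsLargeSample n d κ) :
    κ * (d * logRate n) ≤ 1 := by
  have : 0 ≤ d * logRate n := mul_nonneg d.cast_nonneg (logRate_nonneg n)
  linarith [h.mul_dim_mul_logRate_le_one]

theorem dim_sq_mul_log_le_size (h : IsLargeSample n d κ) :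
    16 * 10 ^ 9 * ((7 + κ) ^ 2 * (d ^ 2 * Real.log n)) ≤ n := by
  have h_rate := h.mul_dim_mul_logRate_le_one
  have h_nonneg : 0 ≤ (7 + κ) * (d * logRate n) := by
    have := h.one_le
    have := logRate_nonneg n
    positivity
  calc 16 * 10 ^ 9 * ((7 + κ) ^ 2 * ((d : ℝ) ^ 2 * Real.log n))
      = (n : ℝ) * (16 * 10 ^ 9 * ((7 + κ) * (d * logRate n)) ^ 2) := by
        rw [← natCast_mul_logRate_sq]; ring
    _ ≤ (n : ℝ) * 1 := by gcongr; nlinarith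
    _ = n := mul_one _

theorem one_le_size_mul_logRate (h : IsLargeSample n d κ) : 1 ≤ n * logRate n := by
  calc 1 ≤ Real.log n := h.one_le_log
    _ = n * logRate n * logRate n := by rw [← natCast_mul_logRate_sq]; ring
    _ ≤ n * logRate n := mul_le_of_le_one_right (mul_nonneg n.cast_nonneg (logRate_nonneg n))
        (logRate_le_one n)

theorem radius_mul_logRate_le (h : IsLargeSample n d κ) :
    33 * κ * (d * Real.log n) * logRate n ≤ 1 := by
  have hκ := h.one_le
  have h_nonneg := h.errorScale_nonneg
  have h_log := h.one_le_log
  have hq := logRate_nonneg n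
  calc 33 * κ * (d * Real.log n) * logRate n
      ≤ 33 * (7 + κ) ^ 2 * (d * Real.log n) * logRate n := by gcongr; nlinarith
    _ = 33 * errorScale κ n d := by rw [errorScale]; ring
    _ ≤ 10 ^ 9 * errorScale κ n d := by gcongr; norm_num
    _ ≤ 1 := h.errorScale_le

theorem radius_le_size (h : IsLargeSample n d κ) : 33 * κ * (d * Real.log n) ≤ n := by
  have hκ := h.one_le
  have h_log := h.one_le_log
  calc 33 * κ * (d * Real.log n) ≤ 33 * κ * (d * Real.log n) * (n * logRate n) :=
        le_mul_of_one_le_right (by positivity) h.one_le_size_mul_logRate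
    _ = n * (33 * κ * (d * Real.log n) * logRate n) := by ring
    _ ≤ n * 1 := by gcongr; exact h.radius_mul_logRate_le
    _ = n := mul_one _

theorem dim_mul_log_le_radius (h : IsLargeSample n d κ) :
    33 * (d * Real.log n) ≤ 33 * κ * (d * Real.log n) := by
  have h_log := h.one_le_log
  have hκ := h.one_le
  gcongr
  linarith

theorem dim_le_size (h : IsLargeSample n d κ) : (d : ℝ) ≤ n := by
  have h_dim : (d : ℝ) ≤ d * Real.log n := le_mul_of_one_le_right d.cast_nonneg h.one_le_log
  linarith [h.dim_mul_log_le_radius, h.radius_le_size, h.one_le_dim]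

theorem net_radius_mul_sq_le (h : IsLargeSample n d κ) :
    (d : ℝ) / ((n ^ 5 : ℕ) : ℝ) * n ^ 2 ≤ logRate n / 10 ^ 3 := by
  have hn := h.size_pos
  have h_rate : (1000 : ℝ) * 1 ≤ n * (n * logRate n) := by
    gcongr
    exacts [h.le_size, h.one_le_size_mul_logRate]
  calc (d : ℝ) / ((n ^ 5 : ℕ) : ℝ) * n ^ 2 ≤ (n : ℝ) / ((n ^ 5 : ℕ) : ℝ) * (n : ℝ) ^ 2 := by
        gcongr; exact_mod_cast h.dim_le_size
    _ = 1 / (n : ℝ) ^ 2 := by push_cast; field_simp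
    _ ≤ logRate n / 10 ^ 3 := by
        rw [div_le_div_iff₀ (by positivity) (by positivity)]
        linarith

theorem cross_error_le (h : IsLargeSample n d κ) :
    128 * √d * ((288 + κ) * logRate n) * √d ≤ 10 ^ 5 * ((7 + κ) * (d * logRate n)) := by
  have hκ := h.one_le
  have hq := logRate_nonneg n
  calc 128 * √d * ((288 + κ) * logRate n) * √d
      = 128 * (288 + κ) * ((√d * √d) * logRate n) := by ring
    _ ≤ 10 ^ 5 * (7 + κ) * (d * logRate n) := by
        rw [Real.mul_self_sqrt d.cast_nonneg]
        gcongr ?_ * _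
        linarith
    _ = _ := by ring

theorem sq_mul_le_errorScale (h : IsLargeSample n d κ) :
    κ ^ 2 * (d * (Real.log n * logRate n)) ≤ errorScale κ n d := by
  have hκ := h.one_le
  have h_log := h.one_le_log
  have hq := logRate_nonneg n
  rw [errorScale]
  gcongr
  linarith

theorem radius_sq_le (h : IsLargeSample n d κ) :
    (33 * κ * (d * Real.log n)) ^ 2 ≤ n * (1089 * errorScale κ n d) := by
  have h_dim : d * logRate n ≤ 1 :=
    (le_mul_of_one_le_left (mul_nonneg d.cast_nonneg (logRate_nonneg n)) h.one_le).trans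
      h.exponent_mul_dim_mul_logRate_le_one
  calc (33 * κ * (d * Real.log n)) ^ 2
      = 1089 * (κ ^ 2 * ((d : ℝ) ^ 2 * (Real.log n * Real.log n))) := by ring
    _ = 1089 * (κ ^ 2 * ((d : ℝ) ^ 2 * (Real.log n * ((n : ℝ) * logRate n ^ 2)))) := by
        rw [natCast_mul_logRate_sq]
    _ = n * (1089 * (κ ^ 2 * (d * (Real.log n * logRate n)) * (d * logRate n))) := by ring
    _ ≤ n * (1089 * (errorScale κ n d * 1)) := by
        have := h.errorScale_nonneg
        have := logRate_nonneg n
        gcongr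
        exact h.sq_mul_le_errorScale
    _ = n * (1089 * errorScale κ n d) := by rw [mul_one]

theorem covariance_error_le (h : IsLargeSample n d κ) :
    320 * (7 + κ) * √d * logRate n ≤ 320 * errorScale κ n d := by
  linarith [h.mul_sqrt_dim_mul_logRate_le]

end IsLargeSample

end Regime

section GoodSample

variable {n d : ℕ} {κ : ℝ} {k₀ : Fin d}

/-- The deviation bounds that hold simultaneously with high probability for isotropic vectors `u i`
whose coordinate `k₀` has small fourth moment, and for the noise `γ i` in that coordinate. -/
structure IsGoodSample (κ : ℝ) (k₀ : Fin d) (u : Fin n → EuclideanSpace ℝ (Fin d))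
    (γ : Fin n → ℝ) : Prop where
  covariance : ∀ p ∈ gridNet d (n ^ 5), |∑ j, (inner ℝ p (u j) ^ 2 - ‖p‖ ^ 2)| ≤
    n * (64 * (7 + κ) * √d * logRate n) * ‖p‖ ^ 2
  weight : ∀ i, |‖u i‖ ^ 2 - d| ≤ 32 * √d * (κ * Real.log n)
  leave_one_out : ∀ i, |∑ j ∈ Finset.univ.erase i, (inner ℝ (u i) (u j) ^ 2 - ‖u i‖ ^ 2)| ≤
    n * (64 * κ * logRate n) * ‖u i‖ ^ 2
  diagonal : ∑ i, (‖u i‖ ^ 2 - d) * (u i k₀ * u i k₀) ≤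
    n * (1 / 4 + 128 * √d * ((288 + κ) * logRate n))
  cross : ∀ k, k ≠ k₀ → |∑ i, (‖u i‖ ^ 2 - d) * (u i k₀ * u i k)| ≤
    n * (128 * √d * ((288 + κ) * logRate n))
  orthogonal : ∀ p ∈ gridNet d (n ^ 5), p k₀ = 0 →
    3 / 2 * n * ‖p‖ ^ 2 ≤ ∑ i, (‖u i‖ ^ 2 - d) * inner ℝ p (u i) ^ 2
  noise : ∑ i, γ i ^ 2 ≤ 2 * n

variable {Ω : Type*} [MeasurableSpace Ω] {P : Measure Ω}

theorem measureReal_exists_le {ι : Type*} (s : Finset ι) (p : ι → Ω → Prop) {c : ℝ}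
    (h : ∀ i ∈ s, P.real {ω | p i ω} ≤ c) : P.real {ω | ∃ i ∈ s, p i ω} ≤ s.card * c := by
  have h_union : {ω | ∃ i ∈ s, p i ω} = ⋃ i ∈ s, {ω | p i ω} := by
    ext ω
    simp only [Set.mem_ofPred_eq, Set.mem_iUnion, exists_prop]
  rw [h_union, ← nsmul_eq_mul]
  exact (measureReal_biUnion_finset_le s _).trans (Finset.sum_le_card_nsmul s _ c h)

theorem measureReal_union_le_add {A B : Set Ω} {a b : ℝ} (hA : P.real A ≤ a) (hB : P.real B ≤ b) :
    P.real (A ∪ B) ≤ a + b :=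
  (measureReal_union_le A B).trans (add_le_add hA hB)

theorem card_gridNet_pow_five_le (hn : 3 ≤ n) :
    ((gridNet d (n ^ 5)).card : ℝ) ≤ Real.exp (7 * d * Real.log n) := by
  have h_base : 2 * n ^ 5 + 1 ≤ n ^ 7 :=
    calc 2 * n ^ 5 + 1 ≤ 9 * n ^ 5 := by have := Nat.one_le_pow 5 n (by omega); omega
      _ ≤ n ^ 2 * n ^ 5 := Nat.mul_le_mul_right _ (by nlinarith)
      _ = n ^ 7 := by ring
  calc ((gridNet d (n ^ 5)).card : ℝ) ≤ ((n : ℝ) ^ 7) ^ d := by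
        exact_mod_cast (card_gridNet_le d (n ^ 5)).trans (Nat.pow_le_pow_left h_base d)
    _ = Real.exp (7 * d * Real.log n) := by
        have hn0 : (0 : ℝ) < n := by positivity
        rw [← pow_mul, ← Real.rpow_natCast, Real.rpow_def_of_pos hn0]
        push_cast
        ring_nf

theorem card_gridNet_mul_exp_le (hn : 3 ≤ n) (hd : 0 < d) (hκ : 0 ≤ κ) {a : ℝ}
    (ha : (7 + κ) * (d * Real.log n) ≤ a) :
    ((gridNet d (n ^ 5)).card : ℝ) * Real.exp (-a) ≤ (n : ℝ) ^ (-κ) := by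
  have hd1 : (1 : ℝ) ≤ d := by exact_mod_cast hd
  have h_log : κ * Real.log n ≤ d * (κ * Real.log n) :=
    le_mul_of_one_le_left (mul_nonneg hκ (Real.log_natCast_nonneg n)) hd1
  calc _ ≤ Real.exp (7 * d * Real.log n) * Real.exp (-a) := by
        gcongr; exact card_gridNet_pow_five_le hn
    _ = Real.exp (7 * d * Real.log n - a) := by rw [← Real.exp_add, sub_eq_add_neg]
    _ ≤ Real.exp (-(κ * Real.log n)) := by rw [Real.exp_le_exp]; linarith
    _ = (n : ℝ) ^ (-κ) := exp_neg_mul_log_natCast (by omega) κ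

theorem IsIsotropic.two_mul_norm_sq_le_integral_weight_inner_sq
    {u : Ω → EuclideanSpace ℝ (Fin d)} (hu : IsIsotropic P u)
    (h4 : ∀ k, k ≠ k₀ → 3 ≤ ∫ ω, u ω k ^ 4 ∂P) {w : EuclideanSpace ℝ (Fin d)} (hw : w k₀ = 0) :
    2 * ‖w‖ ^ 2 ≤ ∫ ω, (‖u ω‖ ^ 2 - d) * inner ℝ w (u ω) ^ 2 ∂P := by
  rw [hu.integral_weight_inner_sq, EuclideanSpace.real_norm_sq_eq, Finset.mul_sum]
  refine Finset.sum_le_sum fun k _ => ?_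
  rcases eq_or_ne k k₀ with rfl | hk
  · rw [hw]
    norm_num
  · nlinarith [h4 k hk, sq_nonneg (w k)]

namespace IsLargeSample

variable {u : Fin n → Ω → EuclideanSpace ℝ (Fin d)}

theorem three_le_size (h : IsLargeSample n d κ) : 3 ≤ n := by
  have : (3 : ℝ) ≤ n := by linarith [h.le_size]
  exact_mod_cast this

theorem measureReal_covariance_le (h : IsLargeSample n d κ) (hu : ∀ i, IsIsotropic P (u i))
    (hind : iIndepFun u P) :
    P.real {ω | ∃ p ∈ gridNet d (n ^ 5), n * (64 * (7 + κ) * √d * logRate n) * ‖p‖ ^ 2 <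
      |∑ j, (inner ℝ p (u j ω) ^ 2 - ‖p‖ ^ 2)|} ≤ 2 * (n : ℝ) ^ (-κ) := by
  have hκ := h.one_le
  have hq := logRate_nonneg n
  have hs : 64 * (7 + κ) * √d * logRate n ≤ 256 := by
    linarith [h.mul_sqrt_dim_mul_logRate_le, h.errorScale_nonneg, h.errorScale_le]
  have h_exponent : (7 + κ) * (d * Real.log n) ≤
      n * (64 * (7 + κ) * √d * logRate n) ^ 2 / 4096 :=
    calc (7 + κ) * (d * Real.log n) ≤ (7 + κ) ^ 2 * (d * Real.log n) := by
          have := h.one_le_log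
          gcongr
          nlinarith
      _ = (7 + κ) ^ 2 * (√d ^ 2 * (n * logRate n ^ 2)) := by
          rw [Real.sq_sqrt d.cast_nonneg, natCast_mul_logRate_sq]
      _ = n * (64 * (7 + κ) * √d * logRate n) ^ 2 / 4096 := by ring
  calc _ ≤ _ := measureReal_exists_le _ _ fun p _ => measureReal_abs_sum_inner_sq_gt_le hu hind p
        (Finset.card_univ.trans (Fintype.card_fin n)).le (by positivity) hs
    _ ≤ 2 * (n : ℝ) ^ (-κ) := by
        rw [mul_left_comm]
        gcongr
        exact card_gridNet_mul_exp_le h.three_le_size h.dim_pos (by linarith) h_exponent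

theorem measureReal_weight_le (h : IsLargeSample n d κ) (hu : ∀ i, IsIsotropic P (u i)) :
    P.real {ω | ∃ i ∈ Finset.univ, 32 * √d * (κ * Real.log n) < |‖u i ω‖ ^ 2 - d|} ≤
      n * (6 * (n : ℝ) ^ (-κ)) := by
  refine (measureReal_exists_le _ _ fun i _ =>
    measureReal_abs_weight_gt_le (hu i) h.dim_pos (κ * Real.log n)).trans_eq ?_
  rw [exp_neg_mul_log_natCast h.size_ne_zero, Finset.card_univ, Fintype.card_fin]

theorem measureReal_leave_one_out_le (h : IsLargeSample n d κ) (hu : ∀ i, IsIsotropic P (u i))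
    (hind : iIndepFun u P) :
    P.real {ω | ∃ i ∈ Finset.univ, n * (64 * κ * logRate n) * ‖u i ω‖ ^ 2 <
      |∑ j ∈ Finset.univ.erase i, (inner ℝ (u i ω) (u j ω) ^ 2 - ‖u i ω‖ ^ 2)|} ≤
      n * (2 * (n : ℝ) ^ (-κ)) := by
  have hκ := h.one_le
  have hq := logRate_nonneg n
  have hs : 64 * κ * logRate n ≤ 256 := by
    have : κ * logRate n ≤ κ * (d * logRate n) := by
      gcongr
      exact le_mul_of_one_le_left hq h.one_le_dim
    linarith [h.exponent_mul_dim_mul_logRate_le_one]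
  refine (measureReal_exists_le _ _ fun i _ => measureReal_abs_sum_inner_sq_gt_le_of_notMem hu hind
    (Finset.notMem_erase i _) ((Finset.card_le_univ _).trans_eq (Fintype.card_fin n))
    (by positivity) hs).trans ?_
  rw [← exp_neg_mul_log_natCast h.size_ne_zero, Finset.card_univ, Fintype.card_fin]
  gcongr
  calc κ * Real.log n ≤ κ ^ 2 * Real.log n := by
        have := h.one_le_log
        gcongr
        nlinarith
    _ = n * (64 * κ * logRate n) ^ 2 / 4096 := by rw [← natCast_mul_logRate_sq]; ring

theorem measureReal_diagonal_le (h : IsLargeSample n d κ) (hu : ∀ i, IsIsotropic P (u i))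
    (hind : iIndepFun u P) (h4 : ∀ i, ∫ ω, u i ω k₀ ^ 4 ∂P ≤ 5 / 4) :
    P.real {ω | n * (1 / 4 + 128 * √d * ((288 + κ) * logRate n)) <
      ∑ i, (‖u i ω‖ ^ 2 - d) * (u i ω k₀ * u i ω k₀)} ≤
      (Real.exp 32 + 4) * (n : ℝ) ^ (-κ) := by
  have := hind.isProbabilityMeasure
  refine (measureReal_mono fun ω hω => ?_).trans (measureReal_sum_weight_mul_ge_le
    (Fintype.card_fin n) h.size_ne_zero hu hind h.dim_pos k₀ k₀ (c := 1) (m := 1 / 4) h.one_le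
    h.logRate_mul_sq_le abs_one.le fun i => ?_)
  · rw [Set.mem_ofPred_eq, one_mul]
    exact le_of_lt hω
  · rw [(hu i).integral_weight_mul, if_pos rfl]
    linarith [h4 i]

theorem measureReal_cross_le (h : IsLargeSample n d κ) (hu : ∀ i, IsIsotropic P (u i))
    (hind : iIndepFun u P) (k₀ : Fin d) :
    P.real {ω | ∃ k ∈ Finset.univ.erase k₀, n * (128 * √d * ((288 + κ) * logRate n)) <
      |∑ i, (‖u i ω‖ ^ 2 - d) * (u i ω k₀ * u i ω k)|} ≤
      n * (2 * ((Real.exp 32 + 4) * (n : ℝ) ^ (-κ))) := by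
  have := hind.isProbabilityMeasure
  have h_card : ((Finset.univ.erase k₀).card : ℝ) ≤ n := by
    refine le_trans ?_ h.dim_le_size
    exact_mod_cast (Finset.card_le_univ _).trans_eq (Fintype.card_fin d)
  have h_tail {k : Fin d} (hk : k₀ ≠ k) {c : ℝ} (hc : |c| ≤ 1) :=
    measureReal_sum_weight_mul_ge_le (Fintype.card_fin n) h.size_ne_zero hu hind h.dim_pos k₀ k
      (m := 0) h.one_le h.logRate_mul_sq_le hc
      fun i => by rw [(hu i).integral_weight_mul, if_neg hk, mul_zero]
  refine (measureReal_exists_le _ _ fun k hk => ?_).trans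
    (mul_le_mul_of_nonneg_right h_card (by positivity))
  have hk := (Finset.ne_of_mem_erase hk).symm
  rw [two_mul]
  refine (measureReal_mono fun ω hω => ?_).trans (measureReal_union_le_add
    (h_tail hk abs_one.le) (h_tail hk (abs_neg (1 : ℝ) ▸ abs_one.le)))
  simp only [Set.mem_union, Set.mem_ofPred_eq, zero_add, one_mul, neg_one_mul] at hω ⊢
  exact le_abs.1 hω.le

theorem measureReal_orthogonal_le (h : IsLargeSample n d κ) (hu : ∀ i, IsIsotropic P (u i))
    (hind : iIndepFun u P) (h4 : ∀ i k, k ≠ k₀ → 3 ≤ ∫ ω, u i ω k ^ 4 ∂P) :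
    P.real {ω | ∃ p ∈ (gridNet d (n ^ 5)).filter fun p => p k₀ = 0,
      ∑ i, (‖u i ω‖ ^ 2 - d) * inner ℝ p (u i ω) ^ 2 < 3 / 2 * n * ‖p‖ ^ 2} ≤
      (n : ℝ) ^ (-κ) := by
  have hκ := h.one_le
  have hd : (0 : ℝ) < d := by exact_mod_cast h.dim_pos
  have h_exponent : (7 + κ) * (d * Real.log n) ≤ n / (16 * 10 ^ 9 * d) := by
    rw [le_div_iff₀ (by positivity)]
    calc (7 + κ) * (d * Real.log n) * (16 * 10 ^ 9 * d)
        = 16 * 10 ^ 9 * ((7 + κ) * ((d : ℝ) ^ 2 * Real.log n)) := by ring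
      _ ≤ 16 * 10 ^ 9 * ((7 + κ) ^ 2 * ((d : ℝ) ^ 2 * Real.log n)) := by
          have := h.one_le_log
          gcongr
          nlinarith
      _ ≤ n := h.dim_sq_mul_log_le_size
  calc _ ≤ _ := measureReal_exists_le _ _ fun p hp => measureReal_sum_weight_inner_sq_lt_le
        (Fintype.card_fin n) hu hind h.dim_pos fun i =>
          (hu i).two_mul_norm_sq_le_integral_weight_inner_sq (h4 i) (Finset.mem_filter.1 hp).2
    _ ≤ ((gridNet d (n ^ 5)).card : ℝ) * Real.exp (-(n / (16 * 10 ^ 9 * d))) := by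
        gcongr
        exact Finset.filter_subset _ _
    _ ≤ _ := card_gridNet_mul_exp_le h.three_le_size h.dim_pos (by linarith) h_exponent

theorem measureReal_noise_le (h : IsLargeSample n d κ) {γ : Fin n → Ω → ℝ} (hind : iIndepFun γ P)
    (hmeas : ∀ i, Measurable (γ i)) (hsub : ∀ i, HasSubgaussianMGF (γ i) 1 P)
    (h2 : ∀ i, ∫ ω, γ i ω ^ 2 ∂P = 1) :
    P.real {ω | 2 * n < ∑ i, γ i ω ^ 2} ≤ 2 * (n : ℝ) ^ (-κ) := by
  have := hind.isProbabilityMeasure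
  have hκ := h.one_le
  have h_log := h.one_le_log
  have h_exponent : κ * Real.log n ≤ n * 1 ^ 2 / 4096 := by
    have h_size := h.dim_sq_mul_log_le_size
    have : κ * (1 * Real.log n) ≤ (7 + κ) ^ 2 * ((d : ℝ) ^ 2 * Real.log n) := by
      gcongr
      · nlinarith
      · exact one_le_pow₀ h.one_le_dim
    linarith
  calc P.real {ω | 2 * n < ∑ i, γ i ω ^ 2}
      ≤ P.real {ω | (n : ℝ) * 1 < |∑ i, (γ i ω ^ 2 - 1)|} := by
        refine measureReal_mono fun ω hω => ?_
        simp only [Set.mem_ofPred_eq, Finset.sum_sub_distrib, Finset.sum_const, Finset.card_univ,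
          Fintype.card_fin, nsmul_eq_mul, mul_one] at hω ⊢
        exact lt_abs.2 (Or.inl (by linarith))
    _ ≤ 2 * Real.exp (-(n * 1 ^ 2 / 4096)) := measureReal_abs_sum_sq_sub_one_gt_le hind hmeas hsub
        h2 (Finset.card_univ.trans (Fintype.card_fin n)).le zero_le_one (by norm_num)
    _ ≤ 2 * (n : ℝ) ^ (-κ) := by
        rw [← exp_neg_mul_log_natCast h.size_ne_zero]
        gcongr

theorem measureReal_not_isGoodSample_le (h : IsLargeSample n d κ)
    (hu : ∀ i, IsIsotropic P (u i)) (hind : iIndepFun u P)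
    (h4 : ∀ i k, k ≠ k₀ → 3 ≤ ∫ ω, u i ω k ^ 4 ∂P) (h4' : ∀ i, ∫ ω, u i ω k₀ ^ 4 ∂P ≤ 5 / 4)
    {γ : Fin n → Ω → ℝ} (hγind : iIndepFun γ P) (hγ : ∀ i, Measurable (γ i))
    (hγsub : ∀ i, HasSubgaussianMGF (γ i) 1 P) (hγ2 : ∀ i, ∫ ω, γ i ω ^ 2 ∂P = 1) :
    P.real {ω | ¬ IsGoodSample κ k₀ (fun i => u i ω) fun i => γ i ω} ≤
      (13 + 3 * (Real.exp 32 + 4)) * (n * (n : ℝ) ^ (-κ)) := by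
  have := hind.isProbabilityMeasure
  have h_union := measureReal_union_le_add (h.measureReal_covariance_le hu hind)
    (measureReal_union_le_add (h.measureReal_weight_le hu)
    (measureReal_union_le_add (h.measureReal_leave_one_out_le hu hind)
    (measureReal_union_le_add (h.measureReal_diagonal_le hu hind h4')
    (measureReal_union_le_add (h.measureReal_cross_le hu hind k₀)
    (measureReal_union_le_add (h.measureReal_orthogonal_le hu hind h4)
    (h.measureReal_noise_le hγind hγ hγsub hγ2))))))
  refine (measureReal_mono fun ω hω => ?_).trans (h_union.trans ?_)
  · by_contra h_good
    simp only [Set.mem_union, Set.mem_ofPred_eq, not_or, not_exists, not_and, not_lt,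
      Finset.mem_univ, Finset.mem_erase, Finset.mem_filter, and_true, and_imp,
      forall_const] at h_good
    obtain ⟨h_cov, h_weight, h_leave, h_diag, h_cross, h_orth, h_noise⟩ := h_good
    exact hω ⟨h_cov, h_weight, h_leave, h_diag, h_cross, h_orth, h_noise⟩
  · have h_exp := (Real.exp_pos 32).le
    have h_rate : (n : ℝ) ^ (-κ) ≤ n * (n : ℝ) ^ (-κ) :=
      le_mul_of_one_le_left (by positivity) (by linarith [h.le_size])
    have h_exp_rate := mul_le_mul_of_nonneg_left h_rate h_exp
    linarith

end IsLargeSample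

end GoodSample

namespace IsLargeSample

variable {n d : ℕ} {κ : ℝ}

theorem exists_mem_gridNet_abs_weightedForm_sub_le (h : IsLargeSample n d κ)
    {u : Fin n → EuclideanSpace ℝ (Fin d)} {c : Fin n → ℝ} (hu : ∀ i, ‖u i‖ ^ 2 ≤ n)
    (hc : ∀ i, |c i| ≤ n) {v : EuclideanSpace ℝ (Fin d)} (hv : ‖v‖ = 1) :
    ∃ p ∈ gridNet d (n ^ 5), |‖p‖ ^ 2 - 1| ≤ 3 * (logRate n / 10 ^ 3) ∧
      |weightedForm c u v v - weightedForm c u p p| ≤ 3 * (logRate n / 10 ^ 3) ∧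
      ∀ k, v k = 0 → p k = 0 := by
  obtain ⟨p, hp, hvp, hpk⟩ := exists_mem_gridNet (N := n ^ 5)
    (pow_pos (Nat.pos_of_ne_zero h.size_ne_zero) 5) v hv.le
  have hn := h.le_size
  have hdist : ‖v - p‖ * n ^ 2 ≤ logRate n / 10 ^ 3 :=
    (mul_le_mul_of_nonneg_right hvp (by positivity)).trans h.net_radius_mul_sq_le
  have hdist' : ‖v - p‖ ≤ ‖v - p‖ * n ^ 2 := le_mul_of_one_le_right (norm_nonneg _) (by nlinarith)
  have hq := logRate_le_one n
  have hsum : ‖v + p‖ ≤ 3 := by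
    have := norm_add_le v p
    have := norm_sub_norm_le p v
    rw [norm_sub_rev] at this
    linarith
  refine ⟨p, hp, ?_, ?_, hpk⟩
  · have hnorm : |‖p‖ - 1| ≤ ‖v - p‖ := by
      rw [← hv, norm_sub_rev]
      exact abs_norm_sub_norm_le p v
    rw [abs_le] at hnorm ⊢
    constructor <;> nlinarith [norm_nonneg p]
  · calc |weightedForm c u v v - weightedForm c u p p|
        ≤ n * n * (‖v - p‖ * ‖v + p‖) :=
          abs_bilinForm_self_sub_self_le (isSymm_weightedForm c u)
            (abs_weightedForm_le_of_norm_sq_le n.cast_nonneg hc n.cast_nonneg hu) v p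
      _ ≤ n * n * (‖v - p‖ * 3) := by gcongr
      _ ≤ 3 * (logRate n / 10 ^ 3) := by linarith

end IsLargeSample

theorem sum_abs_apply_le_sqrt_mul_norm {d : ℕ} (b : EuclideanSpace ℝ (Fin d)) :
    ∑ k, |b k| ≤ √d * ‖b‖ := by
  have h := Real.sum_mul_le_sqrt_mul_sqrt Finset.univ (fun _ : Fin d => (1 : ℝ)) fun k => |b k|
  simpa [EuclideanSpace.norm_eq] using h

theorem weightedForm_one_self_sub_eq {n d : ℕ} (h : n ≠ 0)
    (u : Fin n → EuclideanSpace ℝ (Fin d)) (i : Fin n) :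
    weightedForm 1 u (u i) (u i) - ‖u i‖ ^ 2 = (n : ℝ)⁻¹ * ((‖u i‖ ^ 2) ^ 2 - ‖u i‖ ^ 2 +
      ∑ j ∈ Finset.univ.erase i, (inner ℝ (u i) (u j) ^ 2 - ‖u i‖ ^ 2)) := by
  have hsplit := Finset.add_sum_erase Finset.univ
    (fun j => inner ℝ (u i) (u j) ^ 2 - ‖u i‖ ^ 2) (Finset.mem_univ i)
  rw [real_inner_self_eq_norm_sq] at hsplit
  rw [hsplit, weightedForm_one_self, Finset.sum_sub_distrib, mul_sub]
  simp [h, real_inner_comm (u i)]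

theorem weightedForm_single_left {n d : ℕ} (c : Fin n → ℝ) (u : Fin n → EuclideanSpace ℝ (Fin d))
    (k₀ : Fin d) (b : EuclideanSpace ℝ (Fin d)) :
    weightedForm c u (EuclideanSpace.single k₀ 1) b =
      ∑ k, b k * ((n : ℝ)⁻¹ * ∑ i, c i * (u i k₀ * u i k)) := by
  simp only [weightedForm_apply, EuclideanSpace.inner_single_right,
    euclideanSpace_real_inner_eq_sum, Finset.mul_sum, Fintype.card_fin, conj_trivial, one_mul]
  rw [Finset.sum_comm]
  refine Finset.sum_congr rfl fun k _ => Finset.sum_congr rfl fun i _ => ?_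
  ring

namespace IsGoodSample

variable {n d : ℕ} {κ : ℝ} {k₀ : Fin d} {u : Fin n → EuclideanSpace ℝ (Fin d)} {γ : Fin n → ℝ}

theorem norm_sq_le (hg : IsGoodSample κ k₀ u γ) (h : IsLargeSample n d κ) (i : Fin n) :
    ‖u i‖ ^ 2 ≤ 33 * κ * (d * Real.log n) := by
  have hκ := h.one_le
  have h_log := h.one_le_log
  have h_weight := (abs_le.1 (hg.weight i)).2
  have h_sqrt : 32 * √(d : ℝ) * (κ * Real.log n) ≤ 32 * d * (κ * Real.log n) := by
    gcongr; exact h.sqrt_dim_le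
  have h_dim : (d : ℝ) ≤ d * (κ * Real.log n) :=
    le_mul_of_one_le_right d.cast_nonneg (one_le_mul_of_one_le_of_one_le hκ h_log)
  linarith

theorem norm_sq_le_size (hg : IsGoodSample κ k₀ u γ) (h : IsLargeSample n d κ) (i : Fin n) :
    ‖u i‖ ^ 2 ≤ n :=
  (hg.norm_sq_le h i).trans h.radius_le_size

theorem abs_weight_le_size (hg : IsGoodSample κ k₀ u γ) (h : IsLargeSample n d κ) (i : Fin n) :
    |‖u i‖ ^ 2 - d| ≤ n := by
  rw [abs_le]
  constructor <;> linarith [hg.norm_sq_le_size h i, h.dim_le_size, sq_nonneg ‖u i‖,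
    d.cast_nonneg (α := ℝ)]

theorem abs_weightedForm_one_sub_le_of_mem_gridNet (hg : IsGoodSample κ k₀ u γ)
    (h : IsLargeSample n d κ) {p : EuclideanSpace ℝ (Fin d)} (hp : p ∈ gridNet d (n ^ 5)) :
    |weightedForm 1 u p p - ‖p‖ ^ 2| ≤ 64 * (7 + κ) * √d * logRate n * ‖p‖ ^ 2 := by
  have hn := h.size_pos
  have hsum : weightedForm 1 u p p - ‖p‖ ^ 2 =
      (n : ℝ)⁻¹ * ∑ j, (inner ℝ p (u j) ^ 2 - ‖p‖ ^ 2) := by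
    rw [weightedForm_one_self, Finset.sum_sub_distrib, mul_sub]
    simp [hn.ne', real_inner_comm p]
  rw [hsum, abs_mul, abs_of_pos (inv_pos.2 hn), inv_mul_le_iff₀ hn, ← mul_assoc]
  exact hg.covariance p hp

theorem abs_weightedForm_one_sub_le (hg : IsGoodSample κ k₀ u γ) (h : IsLargeSample n d κ)
    (v : EuclideanSpace ℝ (Fin d)) :
    |weightedForm 1 u v v - ‖v‖ ^ 2| ≤ 320 * (7 + κ) * √d * logRate n * ‖v‖ ^ 2 := by
  have hq0 := logRate_nonneg n
  have hq1 := logRate_le_one n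
  have h_rate : logRate n ≤ 64 * (7 + κ) * √d * logRate n := by
    refine le_mul_of_one_le_left hq0 (one_le_mul_of_one_le_of_one_le ?_ h.one_le_sqrt_dim)
    linarith [h.one_le]
  refine abs_bilinForm_self_sub_norm_sq_le fun a ha => ?_
  obtain ⟨p, hp, hpnorm, happrox, -⟩ := h.exists_mem_gridNet_abs_weightedForm_sub_le
    (c := 1) (hg.norm_sq_le_size h) (fun _ => by rw [Pi.one_apply, abs_one]; linarith [h.le_size])
    ha
  have hnet := hg.abs_weightedForm_one_sub_le_of_mem_gridNet h hp
  rw [abs_le] at hpnorm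
  have hscale : 64 * (7 + κ) * √d * logRate n * ‖p‖ ^ 2 ≤ 64 * (7 + κ) * √d * logRate n * 2 := by
    gcongr
    · linarith
    · linarith
  rw [abs_le] at happrox hnet ⊢
  constructor <;> linarith

theorem le_weightedForm_weight (hg : IsGoodSample κ k₀ u γ) (h : IsLargeSample n d κ)
    {b : EuclideanSpace ℝ (Fin d)} (hb : b k₀ = 0) :
    7 / 5 * ‖b‖ ^ 2 ≤ weightedForm (fun i => ‖u i‖ ^ 2 - d) u b b := by
  have hn := h.size_pos
  have hq := logRate_le_one n
  refine mul_norm_sq_le_bilinForm_self fun a ha => ?_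
  obtain ⟨p, hp, hpnorm, happrox, hpk⟩ := h.exists_mem_gridNet_abs_weightedForm_sub_le
    (hg.norm_sq_le_size h) (hg.abs_weight_le_size h) ha
  have hnet : 3 / 2 * ‖p‖ ^ 2 ≤ weightedForm (fun i => ‖u i‖ ^ 2 - d) u p p := by
    have horth := hg.orthogonal p hp (hpk k₀ (by simp [hb]))
    simp only [weightedForm_apply, Fintype.card_fin, ← sq, real_inner_comm p]
    rw [← div_eq_inv_mul, le_div_iff₀ hn]
    linarith
  linarith [(abs_le.1 hpnorm).1, (abs_le.1 happrox).1]

theorem abs_weightedForm_one_self_sub_le (hg : IsGoodSample κ k₀ u γ) (h : IsLargeSample n d κ)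
    (i : Fin n) :
    |weightedForm 1 u (u i) (u i) - ‖u i‖ ^ 2| ≤ 5000 * errorScale κ n d := by
  have hn := h.size_pos
  have hκ := h.one_le
  have hq := logRate_nonneg n
  have hnorm := hg.norm_sq_le h i
  have h_radius : 1 ≤ 33 * κ * (d * Real.log n) := by
    have := one_le_mul_of_one_le_of_one_le h.one_le_dim h.one_le_log
    linarith [h.dim_mul_log_le_radius]
  have h_diag : |(‖u i‖ ^ 2) ^ 2 - ‖u i‖ ^ 2| ≤ 2 * (33 * κ * (d * Real.log n)) ^ 2 := by
    have : 0 ≤ ‖u i‖ ^ 2 := by positivity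
    rw [abs_le]
    constructor <;> nlinarith
  have h_off : |∑ j ∈ Finset.univ.erase i, (inner ℝ (u i) (u j) ^ 2 - ‖u i‖ ^ 2)| ≤
      n * (2112 * errorScale κ n d) :=
    calc _ ≤ n * (64 * κ * logRate n) * ‖u i‖ ^ 2 := hg.leave_one_out i
      _ ≤ n * (64 * κ * logRate n) * (33 * κ * (d * Real.log n)) := by gcongr
      _ = n * (2112 * (κ ^ 2 * (d * (Real.log n * logRate n)))) := by ring
      _ ≤ n * (2112 * errorScale κ n d) := by gcongr; exact h.sq_mul_le_errorScale
  rw [weightedForm_one_self_sub_eq h.size_ne_zero, abs_mul, abs_of_pos (inv_pos.2 hn),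
    inv_mul_le_iff₀ hn]
  refine (abs_add_le _ _).trans ?_
  have : 0 ≤ n * errorScale κ n d := mul_nonneg hn.le h.errorScale_nonneg
  linarith [h.radius_sq_le]

theorem abs_leverage_sub_le (hg : IsGoodSample κ k₀ u γ) (h : IsLargeSample n d κ)
    {i : Fin n} {p : EuclideanSpace ℝ (Fin d)}
    (hp : ∀ z, weightedForm 1 u p z = inner ℝ (u i) z) :
    |inner ℝ (u i) p - ‖u i‖ ^ 2| ≤ 10 ^ 7 * errorScale κ n d := by
  have hκ := h.one_le
  have hq := logRate_nonneg n
  have h_scale := h.errorScale_nonneg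
  refine (abs_inner_sub_norm_sq_le (by positivity)
    (by linarith [h.covariance_error_le, h.errorScale_le])
    (abs_weightedForm_one_sub_inner_le (hg.abs_weightedForm_one_sub_le h)) hp
    (hg.abs_weightedForm_one_self_sub_le h i) (hg.norm_sq_le h i)).trans ?_
  have h_sq : 2 * (320 * (7 + κ) * √d * logRate n) ^ 2 * (33 * κ * (d * Real.log n)) ≤
      6758400 * errorScale κ n d :=
    calc _ = 6758400 * ((7 + κ) ^ 2 * (d * (Real.log n * logRate n)) *
            (κ * (√(d : ℝ) ^ 2 * logRate n))) := by ring
      _ = 6758400 * (errorScale κ n d * (κ * (d * logRate n))) := by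
          rw [Real.sq_sqrt d.cast_nonneg, errorScale]
      _ ≤ 6758400 * (errorScale κ n d * 1) := by gcongr; exact h.exponent_mul_dim_mul_logRate_le_one
      _ = _ := by rw [mul_one]
  linarith

theorem weightedForm_weight_single_le (hg : IsGoodSample κ k₀ u γ) (h : IsLargeSample n d κ) :
    weightedForm (fun i => ‖u i‖ ^ 2 - d) u (EuclideanSpace.single k₀ 1)
      (EuclideanSpace.single k₀ 1) ≤ 1 / 2 := by
  have hn := h.size_pos
  have hκ := h.one_le
  have hq := logRate_nonneg n
  have h_error : 128 * √d * ((288 + κ) * logRate n) ≤ 1 / 4 := by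
    have h_sqrt := le_mul_of_one_le_right
      (show 0 ≤ 128 * √d * ((288 + κ) * logRate n) by positivity) h.one_le_sqrt_dim
    linarith [h.cross_error_le, h.mul_dim_mul_logRate_le_one]
  have h_apply : weightedForm (fun i => ‖u i‖ ^ 2 - d) u (EuclideanSpace.single k₀ 1)
      (EuclideanSpace.single k₀ 1) = (n : ℝ)⁻¹ * ∑ i, (‖u i‖ ^ 2 - d) * (u i k₀ * u i k₀) := by
    simp [weightedForm_apply, EuclideanSpace.inner_single_right]
  rw [h_apply, inv_mul_le_iff₀ hn]
  refine hg.diagonal.trans ?_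
  gcongr
  linarith

theorem abs_weightedForm_weight_single_le (hg : IsGoodSample κ k₀ u γ) (h : IsLargeSample n d κ)
    {b : EuclideanSpace ℝ (Fin d)} (hb : b k₀ = 0) :
    |weightedForm (fun i => ‖u i‖ ^ 2 - d) u (EuclideanSpace.single k₀ 1) b| ≤
      10 ^ 7 * errorScale κ n d * ‖b‖ := by
  have hn := h.size_pos
  have hκ := h.one_le
  have hq := logRate_nonneg n
  have h_term : ∀ k, |b k * ((n : ℝ)⁻¹ * ∑ i, (‖u i‖ ^ 2 - d) * (u i k₀ * u i k))| ≤
      |b k| * (128 * √d * ((288 + κ) * logRate n)) := by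
    intro k
    rcases eq_or_ne k k₀ with rfl | hk
    · simp [hb]
    · rw [abs_mul, abs_mul, abs_of_pos (inv_pos.2 hn)]
      exact mul_le_mul_of_nonneg_left ((inv_mul_le_iff₀ hn).2 (hg.cross k hk)) (abs_nonneg _)
  rw [weightedForm_single_left]
  calc _ ≤ ∑ k, |b k| * (128 * √d * ((288 + κ) * logRate n)) :=
        (Finset.abs_sum_le_sum_abs _ _).trans (Finset.sum_le_sum fun k _ => h_term k)
    _ = (∑ k, |b k|) * (128 * √d * ((288 + κ) * logRate n)) := (Finset.sum_mul _ _ _).symm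
    _ ≤ (√d * ‖b‖) * (128 * √d * ((288 + κ) * logRate n)) := by
        gcongr; exact sum_abs_apply_le_sqrt_mul_norm b
    _ = 128 * √d * ((288 + κ) * logRate n) * √d * ‖b‖ := by ring
    _ ≤ 10 ^ 7 * errorScale κ n d * ‖b‖ := by
        gcongr ?_ * _
        linarith [h.cross_error_le, h.le_errorScale, h.errorScale_nonneg]

theorem weightedForm_one_self_mem_Icc (hg : IsGoodSample κ k₀ u γ) (h : IsLargeSample n d κ)
    (v : EuclideanSpace ℝ (Fin d)) :
    weightedForm 1 u v v ∈ Set.Icc (1 / 2 * ‖v‖ ^ 2) (2 * ‖v‖ ^ 2) := by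
  have h_error : 320 * (7 + κ) * √d * logRate n * ‖v‖ ^ 2 ≤ 1 / 2 * ‖v‖ ^ 2 := by
    gcongr
    linarith [h.covariance_error_le, h.errorScale_le, h.errorScale_nonneg]
  have h_cov := abs_le.1 (hg.abs_weightedForm_one_sub_le h v)
  constructor <;> linarith [sq_nonneg ‖v‖]

theorem abs_weightedForm_sub_weight_le (hg : IsGoodSample κ k₀ u γ) (h : IsLargeSample n d κ)
    {c : Fin n → ℝ} {ε : ℝ} (hε : 0 ≤ ε) (hc : ∀ i, |c i - ‖u i‖ ^ 2| ≤ ε)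
    (v w : EuclideanSpace ℝ (Fin d)) :
    |weightedForm (fun i => c i - d) u v w - weightedForm (fun i => ‖u i‖ ^ 2 - d) u v w| ≤
      2 * ε * (‖v‖ * ‖w‖) := by
  have h_sqrt : ∀ v, √(weightedForm 1 u v v) ≤ √2 * ‖v‖ := fun v => by
    rw [Real.sqrt_le_left (by positivity), mul_pow, Real.sq_sqrt zero_le_two]
    exact (hg.weightedForm_one_self_mem_Icc h v).2
  rw [← LinearMap.sub_apply, ← LinearMap.sub_apply, ← weightedForm_sub]
  calc _ ≤ ε * (√(weightedForm 1 u v v) * √(weightedForm 1 u w w)) :=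
        abs_weightedForm_le hε (fun i => by simpa using hc i) v w
    _ ≤ ε * ((√2 * ‖v‖) * (√2 * ‖w‖)) := by gcongr <;> exact h_sqrt _
    _ = 2 * ε * (‖v‖ * ‖w‖) := by
        linear_combination (ε * ‖v‖ * ‖w‖) * Real.mul_self_sqrt zero_le_two

theorem exists_eq_sgn_inner_smul_single_add (hg : IsGoodSample κ k₀ u γ)
    (h : IsLargeSample n d κ) {T : EuclideanSpace ℝ (Fin d) ≃ₗ[ℝ] EuclideanSpace ℝ (Fin d)}
    {x : Fin n → EuclideanSpace ℝ (Fin d)} (hx : ∀ i, x i = T (u i)) {yhat : Fin n → ℤˣ}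
    (hy : IsSpectralOutput (dataMatrix x) yhat) :
    ∃ (α : ℝ) (b : EuclideanSpace ℝ (Fin d)),
      (yhat = fun i => sgn (inner ℝ (u i) (α • EuclideanSpace.single k₀ 1 + b))) ∧
      ‖b‖ ≤ 20 * (10 ^ 7 * errorScale κ n d) ∧ 1 / 2 ≤ α ^ 2 ∧ α ^ 2 ≤ 2 := by
  have h_scale := h.errorScale_nonneg
  have h_inner : ∀ b, inner ℝ (EuclideanSpace.single k₀ (1 : ℝ)) b = b k₀ := fun b => by
    simp [EuclideanSpace.inner_single_left]
  have hpos : ∀ v, v ≠ 0 → 0 < weightedForm 1 u v v := fun v hv =>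
    lt_of_lt_of_le (by have := norm_pos_iff.2 hv; positivity)
      (hg.weightedForm_one_self_mem_Icc h v).1
  obtain ⟨q, lev, l, rfl, hq, heig, hray, hlev⟩ :=
    hy.exists_generalizedEigenvector h.size_ne_zero hx hpos
  have h_lev : ∀ i, |lev i - ‖u i‖ ^ 2| ≤ 10 ^ 7 * errorScale κ n d := fun i => by
    obtain ⟨p, hp, hpi⟩ := hlev i
    rw [← hpi]
    exact hg.abs_leverage_sub_le h hp
  have h_cov : ∀ v w, |weightedForm 1 u v w - inner ℝ v w| ≤
      10 ^ 7 * errorScale κ n d * (‖v‖ * ‖w‖) := fun v w =>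
    (abs_weightedForm_one_sub_inner_le (hg.abs_weightedForm_one_sub_le h) v w).trans <|
      mul_le_mul_of_nonneg_right (by linarith [h.covariance_error_le]) (by positivity)
  obtain ⟨α, b, rfl, -, hb, hα⟩ := exists_eq_smul_add_of_generalizedEigenvector
    (e := EuclideanSpace.single k₀ (1 : ℝ)) (by simp) (by positivity)
    (by linarith [h.errorScale_le]) h_cov
    (hg.abs_weightedForm_sub_weight_le h (by positivity) h_lev)
    (hg.weightedForm_weight_single_le h)
    (fun b hb => hg.abs_weightedForm_weight_single_le h ((h_inner b).symm.trans hb))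
    (fun b hb => hg.le_weightedForm_weight h ((h_inner b).symm.trans hb)) hq heig hray
  exact ⟨α, b, rfl, hb, hα⟩

theorem mean_sq_noise_add_inner_le (hg : IsGoodSample κ k₀ u γ) (h : IsLargeSample n d κ)
    (s : ℝ) (b : EuclideanSpace ℝ (Fin d)) :
    (n : ℝ)⁻¹ * ∑ i, (s * γ i + inner ℝ (u i) b) ^ 2 ≤ 4 * s ^ 2 + 4 * ‖b‖ ^ 2 := by
  have hn := h.size_pos
  have h_inner : ∑ i, inner ℝ (u i) b ^ 2 = n * weightedForm 1 u b b := by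
    rw [weightedForm_one_self, Fintype.card_fin, mul_inv_cancel_left₀ hn.ne']
  rw [inv_mul_le_iff₀ hn]
  calc ∑ i, (s * γ i + inner ℝ (u i) b) ^ 2
      ≤ ∑ i, (2 * s ^ 2 * γ i ^ 2 + 2 * inner ℝ (u i) b ^ 2) :=
        Finset.sum_le_sum fun i _ => by nlinarith [sq_nonneg (s * γ i - inner ℝ (u i) b)]
    _ = 2 * s ^ 2 * ∑ i, γ i ^ 2 + 2 * (n * weightedForm 1 u b b) := by
        rw [Finset.sum_add_distrib, ← Finset.mul_sum, ← Finset.mul_sum, h_inner]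
    _ ≤ 2 * s ^ 2 * (2 * n) + 2 * (n * (2 * ‖b‖ ^ 2)) := by
        gcongr
        exacts [hg.noise, (hg.weightedForm_one_self_mem_Icc h b).2]
    _ = n * (4 * s ^ 2 + 4 * ‖b‖ ^ 2) := by ring

theorem misclass_le (hg : IsGoodSample κ k₀ u γ) (h : IsLargeSample n d κ) {σ : ℝ}
    (hσ : σ ^ 2 ≤ 1 / 2) {y : Fin n → ℤˣ}
    (hu : ∀ i, u i k₀ = √(1 - σ ^ 2) * ((y i : ℤ) : ℝ) + σ * γ i)
    {T : EuclideanSpace ℝ (Fin d) ≃ₗ[ℝ] EuclideanSpace ℝ (Fin d)}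
    {x : Fin n → EuclideanSpace ℝ (Fin d)} (hx : ∀ i, x i = T (u i)) {yhat : Fin n → ℤˣ}
    (hy : IsSpectralOutput (dataMatrix x) yhat) :
    misclass yhat y ≤ 32 * σ ^ 2 + 6400 * (10 ^ 7 * errorScale κ n d) ^ 2 := by
  obtain ⟨α, b, rfl, hb, hα, hα'⟩ := hg.exists_eq_sgn_inner_smul_single_add h hx hy
  have h_signal : ∀ i, inner ℝ (u i) (α • EuclideanSpace.single k₀ (1 : ℝ) + b) =
      α * √(1 - σ ^ 2) * ((y i : ℤ) : ℝ) + (α * σ * γ i + inner ℝ (u i) b) := fun i => by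
    rw [inner_add_right, real_inner_smul_right, EuclideanSpace.inner_single_right, hu]
    simp only [one_mul, conj_trivial]
    ring
  simp only [h_signal]
  set r := fun i => α * σ * γ i + inner ℝ (u i) b
  set M := misclass (fun i => sgn (α * √(1 - σ ^ 2) * ((y i : ℤ) : ℝ) + r i)) y
  have hM : 0 ≤ M := by simp only [M, misclass]; positivity
  have h_margin : 1 / 4 ≤ (α * √(1 - σ ^ 2)) ^ 2 := by
    rw [mul_pow, Real.sq_sqrt (by linarith)]
    nlinarith
  have h_residual : (α * σ) ^ 2 ≤ 2 * σ ^ 2 := by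
    rw [mul_pow]
    gcongr
  have hb' : ‖b‖ ^ 2 ≤ (20 * (10 ^ 7 * errorScale κ n d)) ^ 2 := by gcongr
  calc M ≤ 4 * (M * (α * √(1 - σ ^ 2)) ^ 2) := by nlinarith
    _ ≤ 4 * ((n : ℝ)⁻¹ * ∑ i, r i ^ 2) := by
        refine mul_le_mul_of_nonneg_left ?_ zero_le_four
        exact misclass_sgn_mul_sq_le y r _
    _ ≤ 4 * (4 * (α * σ) ^ 2 + 4 * ‖b‖ ^ 2) := by
        gcongr
        exact hg.mean_sq_noise_add_inner_le h (α * σ) b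
    _ ≤ 32 * σ ^ 2 + 6400 * (10 ^ 7 * errorScale κ n d) ^ 2 := by linarith

end IsGoodSample

open Filter

theorem misclass_le_one {n : ℕ} (yhat y : Fin n → ℤˣ) : misclass yhat y ≤ 1 := by
  rw [misclass]
  refine inv_mul_le_one_of_le₀ ((min_le_left _ _).trans ?_) n.cast_nonneg
  exact_mod_cast (Finset.card_le_univ _).trans_eq (Fintype.card_fin n)

theorem IsSpectralOutput.dim_ne_zero {n d : ℕ} {X : Matrix (Fin n) (Fin d) ℝ} {yhat : Fin n → ℤˣ}
    (h : IsSpectralOutput X yhat) : d ≠ 0 := by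
  obtain ⟨v, ⟨hv, -⟩, -⟩ := h
  rintro rfl
  rw [Subsingleton.elim v 0, norm_zero] at hv
  exact zero_ne_one hv

section Sample

variable {Ω : Type*} [MeasurableSpace Ω] {P : Measure Ω} {n d : ℕ}
  {m : EuclideanSpace ℝ (Fin d)} {Sig : Matrix (Fin d) (Fin d) ℝ}
  {x : Fin n → Ω → EuclideanSpace ℝ (Fin d)} {y : Fin n → Ω → ℤˣ} {κ σ : ℝ} {k₀ : Fin d}

theorem integral_mixtureVector_self_pow_four_le_five_quarters {Y : Ω → ℝ}
    {Γ : Ω → EuclideanSpace ℝ (Fin d)} (hσ : σ ^ 2 ≤ 1 / 1000) (hY : ∀ ω, |Y ω| ≤ 1)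
    (hΓ : Measurable Γ) (hΓ_law : P.map Γ = stdGaussian (EuclideanSpace ℝ (Fin d)))
    (hu : IsIsotropic P (mixtureVector √(1 - σ ^ 2) σ k₀ Y Γ)) :
    ∫ ω, mixtureVector √(1 - σ ^ 2) σ k₀ Y Γ ω k₀ ^ 4 ∂P ≤ 5 / 4 := by
  refine (integral_mixtureVector_self_pow_four_le hY
    (isIsotropic_of_map_eq_stdGaussian hΓ hΓ_law) hu).trans ?_
  have h_sqrt : √(1 - σ ^ 2) ^ 4 = (1 - σ ^ 2) ^ 2 := by
    rw [show 4 = 2 * 2 by norm_num, pow_mul, Real.sq_sqrt (by linarith)]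
  rw [integral_pow_four_of_map_eq_stdGaussian hΓ hΓ_law, h_sqrt]
  nlinarith [sq_nonneg σ]

variable [IsProbabilityMeasure P]

theorem IsMixtureSample.isIsotropic_mixtureVector (h : IsMixtureSample P m Sig x y)
    (hσ : σ ^ 2 ≤ 1) {Γ : Ω → EuclideanSpace ℝ (Fin d)} (hΓ : Measurable Γ)
    (hΓ_law : P.map Γ = stdGaussian (EuclideanSpace ℝ (Fin d))) {i : Fin n}
    (hyΓ : IndepFun (y i) Γ P) :
    IsIsotropic P (mixtureVector √(1 - σ ^ 2) σ k₀ (fun ω => ((y i ω : ℤ) : ℝ)) Γ) := by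
  have hyp := (h.prob_label i 1).trans (h.prob_label i (-1)).symm
  refine _root_.isIsotropic_mixtureVector (measurable_units_cast.comp (h.measurable_y i))
    (hasSubgaussianMGF_label (h.measurable_y i) hyp) (integral_label (h.measurable_y i) hyp)
    (integral_label_sq (y i)) (isIsotropic_of_map_eq_stdGaussian hΓ hΓ_law)
    (hyΓ.comp measurable_units_cast measurable_id) ?_
  rw [Real.sq_sqrt (by linarith), sub_add_cancel]

theorem IsMixtureSample.measureReal_not_isGoodSample_le (h : IsMixtureSample P m Sig x y)
    (hlarge : IsLargeSample n d κ) (hσ : σ ^ 2 ≤ 1 / 1000)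
    {Γ : Fin n → Ω → EuclideanSpace ℝ (Fin d)} (hΓ : ∀ i, Measurable (Γ i))
    (hΓ_law : ∀ i, P.map (Γ i) = stdGaussian (EuclideanSpace ℝ (Fin d)))
    (hyΓ : ∀ i, IndepFun (y i) (Γ i) P) (hpair : iIndepFun (fun i ω => (y i ω, Γ i ω)) P) :
    P.real {ω | ¬ IsGoodSample κ k₀ (fun i => mixtureVector √(1 - σ ^ 2) σ k₀
        (fun ω => ((y i ω : ℤ) : ℝ)) (Γ i) ω) fun i => Γ i ω k₀} ≤
      (13 + 3 * (Real.exp 32 + 4)) * (n * (n : ℝ) ^ (-κ)) := by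
  have hu i := h.isIsotropic_mixtureVector (k₀ := k₀) (hσ.trans (by norm_num)) (hΓ i) (hΓ_law i)
    (hyΓ i)
  have hu_indep : iIndepFun (fun i => mixtureVector √(1 - σ ^ 2) σ k₀
      (fun ω => ((y i ω : ℤ) : ℝ)) (Γ i)) P :=
    hpair.comp (fun _ => mixtureVector √(1 - σ ^ 2) σ k₀
        (fun p : ℤˣ × EuclideanSpace ℝ (Fin d) => ((p.1 : ℤ) : ℝ)) Prod.snd) fun _ =>
      measurable_mixtureVector (measurable_units_cast.comp measurable_fst) measurable_snd
  have hγ_indep : iIndepFun (fun i ω => Γ i ω k₀) P :=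
    hpair.comp (fun _ p => p.2 k₀) fun _ => by fun_prop
  have hΓ_iso i := isIsotropic_of_map_eq_stdGaussian (hΓ i) (hΓ_law i)
  refine hlarge.measureReal_not_isGoodSample_le hu hu_indep (fun i k hk => ?_) (fun i => ?_)
    hγ_indep (fun i => by have := hΓ i; fun_prop) (fun i => (hΓ_iso i).subgaussian k₀) fun i => ?_
  · simp only [mixtureVector_of_ne _ _ hk]
    exact (integral_pow_four_of_map_eq_stdGaussian (hΓ i) (hΓ_law i) k).ge
  · exact integral_mixtureVector_self_pow_four_le_five_quarters hσ
      (fun ω => (abs_units_cast (y i ω)).le) (hΓ i) (hΓ_law i) (hu i)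
  · rw [integral_comp_of_map_eq_stdGaussian (f := (· ^ 2)) (hΓ i) (hΓ_law i) (by fun_prop) k₀,
      integral_sq_gaussianReal]

theorem IsMixtureSample.exists_measurableSet_misclass_le (hS : Sig.PosDef)
    (h : IsMixtureSample P m Sig x y) (hσ : noiseLevel m Sig ^ 2 ≤ 1 / 1000)
    (hlarge : IsLargeSample n d κ) :
    ∃ E : Set Ω, MeasurableSet E ∧
      1 - (13 + 3 * (Real.exp 32 + 4)) * (n * (n : ℝ) ^ (-κ)) ≤ P.real E ∧
      ∀ ω ∈ E, ∀ yhat : Fin n → ℤˣ, IsSpectralOutput (dataMatrix fun i => x i ω) yhat →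
        misclass yhat (fun i => y i ω) ≤
          32 * noiseLevel m Sig ^ 2 + 6400 * (10 ^ 7 * errorScale κ n d) ^ 2 := by
  let k₀ : Fin d := ⟨0, hlarge.dim_pos⟩
  obtain ⟨T, Γ, hΓ, hΓ_law, hyΓ, hpair, hx⟩ := h.exists_whitened hS k₀
  let B : Set Ω := {ω | ¬ IsGoodSample κ k₀ (fun i => mixtureVector √(1 - noiseLevel m Sig ^ 2)
    (noiseLevel m Sig) k₀ (fun ω => ((y i ω : ℤ) : ℝ)) (Γ i) ω) fun i => Γ i ω k₀}
  have hB_le : P.real B ≤ _ := h.measureReal_not_isGoodSample_le hlarge hσ hΓ hΓ_law hyΓ hpair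
  have hB_meas := measurableSet_toMeasurable P B
  refine ⟨(toMeasurable P B)ᶜ, hB_meas.compl, ?_, fun ω hω yhat hy => ?_⟩
  · rw [probReal_compl_eq_one_sub hB_meas, measureReal_def, measure_toMeasurable,
      ← measureReal_def]
    gcongr
  · have hgood : ω ∉ B := fun hωB => hω (subset_toMeasurable P B hωB)
    exact (not_not.1 hgood).misclass_le hlarge (by linarith)
      (fun i => mixtureVector_self _ _ _ _ _ _) (fun i => hx i ω) hy

end Sample

theorem eventually_logRate_mul_sq_le (c : ℝ) :
    ∀ᶠ n : ℕ in atTop, logRate n * (c * Real.log n) ^ 2 ≤ 1 := by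
  have h_log := (Real.isLittleO_pow_log_id_atTop (n := 5)).bound
    (show (0 : ℝ) < (c ^ 4 + 1)⁻¹ by positivity)
  filter_upwards [tendsto_natCast_atTop_atTop.eventually h_log, eventually_gt_atTop 0]
    with n hn hn_pos
  have hL : 0 ≤ Real.log n := Real.log_natCast_nonneg n
  rw [id, Real.norm_of_nonneg (pow_nonneg hL 5), Real.norm_of_nonneg n.cast_nonneg,
    ← div_eq_inv_mul, le_div_iff₀ (by positivity)] at hn
  have h_sq : n * (logRate n * (c * Real.log n) ^ 2) ^ 2 = c ^ 4 * Real.log n ^ 5 := by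
    rw [mul_pow, ← mul_assoc, natCast_mul_logRate_sq]; ring
  refine (sq_le_one_iff₀ (mul_nonneg (logRate_nonneg n) (sq_nonneg _))).1 ?_
  refine le_of_mul_le_mul_left ?_ (Nat.cast_pos.2 hn_pos : (0 : ℝ) < n)
  linarith [pow_nonneg hL 5]

-- For `n ≥ 2` and `d ≥ 1` the ratio is at least `1 / (8 n)`, so a large `C` forces `n` to be large.
theorem exists_isLargeSample_of_mul_lt_one {κ : ℝ} (hκ : 1 ≤ κ) (K : ℝ) :
    ∃ C : ℝ, 10 ^ 18 * (7 + κ) ^ 4 ≤ C ∧ ∀ {n d : ℕ}, 2 ≤ n → d ≠ 0 →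
      C * ((d : ℝ) ^ 2 * Real.log n ^ 3 / n) < 1 → K ≤ n ∧ IsLargeSample n d κ := by
  obtain ⟨n₀, hn₀⟩ := eventually_atTop.1 ((eventually_logRate_mul_sq_le (κ + 1)).and
    (tendsto_natCast_atTop_atTop.eventually
      ((eventually_ge_atTop (1000 : ℝ)).and (eventually_ge_atTop K))))
  refine ⟨8 * n₀ + 10 ^ 18 * (7 + κ) ^ 4, by simp, fun {n d} hn hd hlt => ?_⟩
  set r : ℝ := (d : ℝ) ^ 2 * Real.log n ^ 3 / n
  have hr : 1 / 8 ≤ n * r := by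
    have h_log : 1 / 2 ≤ Real.log n := by
      have := Real.log_le_log two_pos (by exact_mod_cast hn : (2 : ℝ) ≤ n)
      linarith [Real.log_two_gt_d9]
    have h_dim : (1 : ℝ) ≤ d := by exact_mod_cast Nat.one_le_iff_ne_zero.2 hd
    calc (1 / 8 : ℝ) = 1 ^ 2 * (1 / 2) ^ 3 := by norm_num
      _ ≤ (d : ℝ) ^ 2 * Real.log n ^ 3 := by gcongr
      _ = n * r := (mul_div_cancel₀ _ (by positivity)).symm
  have hr_pos : 0 < r := pos_of_mul_pos_right (by linarith) n.cast_nonneg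
  have h_scale : 0 ≤ 10 ^ 18 * (7 + κ) ^ 4 * r := by positivity
  have hn₀n : n₀ ≤ n := by
    have : (n₀ : ℝ) ≤ n := le_of_mul_le_mul_right (by linarith) hr_pos
    exact_mod_cast this
  obtain ⟨h_rate, h_size, hK⟩ := hn₀ n hn₀n
  refine ⟨hK, by exact_mod_cast Nat.one_le_iff_ne_zero.2 hd, h_size, hκ, h_rate, ?_⟩
  refine (le_abs_self _).trans ((sq_le_one_iff_abs_le_one _).1 ?_)
  have h_init : 0 ≤ n₀ * r := mul_nonneg n₀.cast_nonneg hr_pos.le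
  calc (10 ^ 9 * errorScale κ n d) ^ 2 = 10 ^ 18 * (7 + κ) ^ 4 * r := by
        rw [mul_pow, errorScale_sq]; ring
    _ ≤ 1 := by linarith

theorem mul_natCast_mul_rpow_le {K C : ℝ} {n : ℕ} (hn : n ≠ 0) (hK : K ≤ n) :
    K * (n * (n : ℝ) ^ (-(C + 2))) ≤ (n : ℝ) ^ (-C) := by
  have hn_pos : (0 : ℝ) < n := by positivity
  calc K * (n * (n : ℝ) ^ (-(C + 2))) ≤ n * (n * (n : ℝ) ^ (-(C + 2))) := by gcongr
    _ = (n : ℝ) ^ (2 + -(C + 2)) := by rw [Real.rpow_add hn_pos, Real.rpow_two]; ring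
    _ = (n : ℝ) ^ (-C) := by ring_nf

theorem mainTheorem3_general (C₁ : ℝ) (hC₁ : 0 < C₁) :
    ∃ C₂ : ℝ, 0 < C₂ ∧
      ∀ (n d : ℕ) (m : EuclideanSpace ℝ (Fin d)) (Sig : Matrix (Fin d) (Fin d) ℝ)
        (Ω : Type*) [MeasurableSpace Ω] (P : Measure Ω) [IsProbabilityMeasure P]
        (x : Fin n → Ω → EuclideanSpace ℝ (Fin d)) (y : Fin n → Ω → ℤˣ),
        n ≠ 0 →
        Sig.PosDef →
        IsMixtureSample P m Sig x y →
        ∃ E : Set Ω, MeasurableSet E ∧ 1 - (n : ℝ) ^ (-C₁) ≤ P.real E ∧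
          ∀ ω ∈ E, ∀ yhat : Fin n → ℤˣ,
            IsSpectralOutput (dataMatrix fun i => x i ω) yhat →
            misclass yhat (fun i => y i ω) ≤
              C₂ * (noiseLevel m Sig ^ 2 + (d : ℝ) ^ 2 * Real.log n ^ 3 / n) := by
  obtain ⟨C, hC, hlarge⟩ := exists_isLargeSample_of_mul_lt_one (κ := C₁ + 2) (by linarith)
    (13 + 3 * (Real.exp 32 + 4))
  have hC_pos : 0 < C := lt_of_lt_of_le (by positivity) hC
  refine ⟨C + 1000, by positivity, fun n d m Sig Ω _ P _ x y hn hS h => ?_⟩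
  have hr : 0 ≤ (d : ℝ) ^ 2 * Real.log n ^ 3 / n := by positivity
  set r : ℝ := (d : ℝ) ^ 2 * Real.log n ^ 3 / n
  have := sq_nonneg (noiseLevel m Sig)
  by_cases htriv : d = 0 ∨ 1 ≤ (C + 1000) * (noiseLevel m Sig ^ 2 + r)
  · exact ⟨Set.univ, .univ, by simpa using Real.rpow_nonneg n.cast_nonneg _, fun ω _ yhat hy =>
      htriv.elim (absurd · hy.dim_ne_zero) (misclass_le_one _ _).trans⟩
  obtain ⟨hd, hlt⟩ := not_or.1 htriv
  rcases (Nat.one_le_iff_ne_zero.2 hn).eq_or_lt with rfl | hn2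
  · exact ⟨∅, .empty, by simp, fun ω hω => hω.elim⟩
  obtain ⟨hK, hlarge⟩ := hlarge hn2 hd (by nlinarith)
  obtain ⟨E, hE, hPE, hmis⟩ := h.exists_measurableSet_misclass_le hS (by nlinarith) hlarge
  refine ⟨E, hE, ?_, fun ω hω yhat hy => (hmis ω hω yhat hy).trans ?_⟩
  · linarith [mul_natCast_mul_rpow_le (C := C₁) hn hK]
  · rw [mul_pow, errorScale_sq]
    nlinarith

theorem mainTheorem3 (δ c C₁ : ℝ) (hδ : δ ∈ Set.Ioo (0 : ℝ) 1) (hc : 0 < c) (hC₁ : 0 < C₁) :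
    ∃ C₂ : ℝ, 0 < C₂ ∧
      ∀ (n d : ℕ) (m : EuclideanSpace ℝ (Fin d)) (Sig : Matrix (Fin d) (Fin d) ℝ)
        (Ω : Type*) [MeasurableSpace Ω] (P : Measure Ω) [IsProbabilityMeasure P]
        (x : Fin n → Ω → EuclideanSpace ℝ (Fin d)) (y : Fin n → Ω → ℤˣ),
        Sig.PosDef →
        IsMixtureSample P m Sig x y →
        noiseLevel m Sig < 1 - δ →
        (n : ℝ) > c * (d : ℝ) ^ 2 * Real.log n ^ 3 →
        -- a measurable event, so that the bound holds for every choice of the eigenvector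
        ∃ E : Set Ω, MeasurableSet E ∧ 1 - (n : ℝ) ^ (-C₁) ≤ P.real E ∧
          ∀ ω ∈ E, ∀ yhat : Fin n → ℤˣ,
            IsSpectralOutput (dataMatrix fun i => x i ω) yhat →
            misclass yhat (fun i => y i ω) ≤
              C₂ * (noiseLevel m Sig ^ 2 + (d : ℝ) ^ 2 * Real.log n ^ 3 / n) := by
  obtain ⟨C₂, hC₂, H⟩ := mainTheorem3_general C₁ hC₁
  exact ⟨C₂, hC₂, fun n d m Sig Ω _ P _ x y hS h _ hn =>
    H n d m Sig Ω P x y (by rintro rfl; simp at hn) hS h⟩
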